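/- Let $n\ge 3$, $2+\frac{2}{n-2}<p\le\infty$, and put $\alpha_0=\frac{n-2}{2}-\frac{n-1}{p}>0$ (with $1/\infty=0$). For $0<\varepsilon<\alpha_0$ let $\alpha=\alpha_0$ if $\alpha_0\notin\mathbf Z$ and $\alpha=\alpha_0-\varepsilon$ if $\alpha_0\in\mathbf Z$. For a function $f$ on $(-1,1)$ with values in a Banach space, $f\in\mathcal C^{\alpha}((-1,1))$ means that $f$ has $[\alpha]$ continuous derivatives and that the $[\alpha]$-th derivative is Hölder continuous of order $\alpha-[\alpha]$ on every compact subset of $(-1,1)$. Equip $\mathrm{SO}(n)$ with its Haar probability measure and let $\mathrm{SO}(n-1)\subset \mathrm{SO}(n)$ be the subgroup that fixes the first coordinate vector $e_1$. For a compact group $G$, a function $m\in L_\infty(G)$ is an $S_p$-$S_q$-multiplier (an $S_p$-multiplier if $p=q$) if the map $(a_{g,h})\mapsto (m(gh^{-1})a_{g,h})$, defined on Hilbert–Schmidt operators on $L_2(G)$ (given by kernels in $L_2(G\times G)$), is bounded from the norm of the Schatten class $S_p(L_2(G))$ to that of $S_q(L_2(G))$; $S_\infty$ denotes the compact operators with the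 operator norm. (1) Let $\varphi\colon \mathrm{SO}(n)\to\mathbf C$ be an $\mathrm{SO}(n-1)$-biinvariant function which is an $S_p$-multiplier or, more generally, an $S_p$-$S_\infty$-multiplier on $\mathrm{SO}(n)$. Then there is a function $\widetilde\varphi$ on $[-1,1]$ with $\varphi(k)=\widetilde\varphi(k_{11})$ for all $k\in \mathrm{SO}(n)$, and $\widetilde\varphi$ is of class $\mathcal C^\alpha$ on $(-1,1)$ after modification of $\varphi$ on a null set: there is $\psi\colon(-1,1)\to\mathbf C$, belonging to $\mathcal C^\alpha((-1,1))$ for every $\varepsilon\in(0,\alpha_0)$, such that $\varphi(k)=\psi(k_{11})$ for almost every $k\in \mathrm{SO}(n)$. If $\widetilde\varphi$ is continuous on $(-1,1)$, then $\widetilde\varphi$ itself belongs to $\mathcal C^\alpha((-1,1))$ for every $\varepsilon\in(0,\alpha_0)$. (2) Let $\lambda$ be the left regular representation of $\mathrm{SO}(n)$, $(\lambda(g)f)(x)=f(g^{-1}x)$. The operator $\int_{\mathrm{SO}(n-1)\times \mathrm{SO}(n-1)}\lambda(ugu')\,du\,du'$ on $L_2(\mathrm{SO}(n))$ (a strong integral,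 for Haar probability measures) depends only on $\delta=g_{11}$; denote it by $T_\delta$. The map $\delta\mapsto T_\delta$ belongs to $\mathcal C^{\alpha}\big((-1,1);S_p(L_2(\mathrm{SO}(n)))\big)$ for every $\varepsilon\in(0,\alpha_0)$. -/

import Mathlib

open MeasureTheory Set Filter Topology
open scoped ENNReal NNReal Matrix

namespace SchurRegularity

noncomputable section

/-! ### Schatten classes -/

section Schatten

variable {H : Type*} [NormedAddCommGroup H] [InnerProductSpace ℂ H]

/-- The `k`-th singular number (`k = 0, 1, 2, …`) of a bounded operator on a Hilbert space: its
distance in operator norm to the operators of rank at most `k`. -/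
def singularNumber (A : H →L[ℂ] H) (k : ℕ) : ℝ≥0∞ :=
  ⨅ F : {F : H →L[ℂ] H // LinearMap.rank (F : H →ₗ[ℂ] H) ≤ (k : Cardinal)}, ‖A - F.1‖ₑ

open Classical in
/-- The Schatten norm `‖A‖_p`, i.e. the `ℓ_p`-norm of the sequence of singular numbers, with value
`∞` when `A` is not in the class; for `p = ∞` it is the operator norm. -/
def schattenNorm (p : ℝ≥0∞) (A : H →L[ℂ] H) : ℝ≥0∞ :=
  if p = ∞ then ⨆ k, singularNumber A k
  else (∑' k, singularNumber A k ^ p.toReal) ^ (1 / p.toReal)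

/-- `A ∈ S_p(H)`. For `p < ∞` compactness follows from the finiteness of the norm; `S_∞(H)` is
the space of compact operators. -/
def MemSchatten (p : ℝ≥0∞) (A : H →L[ℂ] H) : Prop :=
  IsCompactOperator A ∧ schattenNorm p A < ∞

end Schatten

/-! ### The classes `C^α` -/

/-- `f ∈ C^α(J)` for an interval `J` and `α > 0`: `f` has `[α]` continuous derivatives
on `J`, and the last one is Hölder continuous of order `α - [α]` on every compact subset of `J`. -/
def HolderClass (α : ℝ) (J : Set ℝ) (f : ℝ → ℂ) : Prop :=
  ContDiffOn ℝ (⌊α⌋₊ : ℕ) f J ∧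
  ∀ K ⊆ J, IsCompact K → ∃ C : ℝ, ∀ x ∈ K, ∀ y ∈ K,
    ‖iteratedDerivWithin ⌊α⌋₊ f J x - iteratedDerivWithin ⌊α⌋₊ f J y‖
      ≤ C * |x - y| ^ (α - ⌊α⌋₊)

/-- `T ∈ C^α(J; S_p(H))`: same class for functions with values in the Banach space `S_p(H)`.
Here `D j` is the `j`-th derivative of `T`; all limits are in the norm of `S_p(H)`. -/
def HolderClassSchatten {H : Type*} [NormedAddCommGroup H] [InnerProductSpace ℂ H]
    (p : ℝ≥0∞) (α : ℝ) (J : Set ℝ) (T : ℝ → H →L[ℂ] H) : Prop :=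
  ∃ D : ℕ → ℝ → H →L[ℂ] H,
    (∀ x ∈ J, D 0 x = T x) ∧
    (∀ j ≤ ⌊α⌋₊, ∀ x ∈ J, MemSchatten p (D j x) ∧
      Tendsto (fun y => schattenNorm p (D j y - D j x)) (𝓝[J] x) (𝓝 0)) ∧
    (∀ j < ⌊α⌋₊, ∀ x ∈ J,
      Tendsto (fun y => schattenNorm p (((y - x : ℝ) : ℂ)⁻¹ • (D j y - D j x) - D (j + 1) x))
        (𝓝[J \ {x}] x) (𝓝 0)) ∧
    ∀ K ⊆ J, IsCompact K → ∃ C : ℝ≥0, ∀ x ∈ K, ∀ y ∈ K,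
      schattenNorm p (D ⌊α⌋₊ x - D ⌊α⌋₊ y) ≤ C * ENNReal.ofReal (|x - y| ^ (α - ⌊α⌋₊))

/-! ### Schur multipliers -/

section Multiplier

variable {G : Type*} [MeasurableSpace G] (μ : Measure G)

/-- The bounded operator `A` on `L_2(G)` is the integral operator
`f ↦ (g ↦ ∫ a(g, h) f(h) dμ(h))`, i.e. it is the "matrix" `(a(g, h))_{g, h}`. -/
def HasKernel (A : Lp ℂ 2 μ →L[ℂ] Lp ℂ 2 μ) (a : G → G → ℂ) : Prop :=
  ∀ f : Lp ℂ 2 μ, A f =ᵐ[μ] fun g => ∫ h, a g h * f h ∂μ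

/-- The function `m ∈ L_∞(G)` is an `S_p`-`S_q`-multiplier (an `S_p`-multiplier if `p = q`): the
map `(a(g, h)) ↦ (m(g h⁻¹) a(g, h))`, which acts on the Hilbert–Schmidt operators, i.e. on the
operators with a kernel in `L_2(G × G)`, is bounded from the norm of `S_p(L_2(G))` to the norm
of `S_q(L_2(G))`. -/
def IsSchurMultiplier [Group G] (p q : ℝ≥0∞) (m : G → ℂ) : Prop :=
  MemLp m ∞ μ ∧
  ∃ C : ℝ≥0, ∀ (a : G → G → ℂ) (A : Lp ℂ 2 μ →L[ℂ] Lp ℂ 2 μ),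
    MemLp (Function.uncurry a) 2 (μ.prod μ) → HasKernel μ A a →
      ∃ B : Lp ℂ 2 μ →L[ℂ] Lp ℂ 2 μ,
        HasKernel μ B (fun g h => m (g * h⁻¹) * a g h) ∧
          schattenNorm q B ≤ C * schattenNorm p A

end Multiplier

/-! ### The group `SO(n)` and its subgroup `SO(n-1)` -/

/-- The special orthogonal group. -/
abbrev SO (n : ℕ) := Matrix.specialOrthogonalGroup (Fin n) ℝ

instance (n : ℕ) : IsTopologicalGroup (SO n) where
  continuous_inv := by
    refine Continuous.subtype_mk (f := fun A : SO n => A.1ᵀ) ?_ _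
    fun_prop

instance (n : ℕ) : CompactSpace (SO n) := by
  refine isCompact_iff_compactSpace.mp ?_
  have hsub : ((SO n : Submonoid (Matrix (Fin n) (Fin n) ℝ)) : Set (Matrix (Fin n) (Fin n) ℝ))
      = {A : Matrix (Fin n) (Fin n) ℝ | A * Aᵀ = 1 ∧ A.det = 1} := by
    ext A
    simp [Matrix.mem_specialOrthogonalGroup_iff, Matrix.mem_orthogonalGroup_iff]
  have hcl : IsClosed {A : Matrix (Fin n) (Fin n) ℝ | A * Aᵀ = 1 ∧ A.det = 1} :=
    (isClosed_eq (by fun_prop) continuous_const).inter (isClosed_eq (by fun_prop) continuous_const)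
  have hK : IsCompact (Set.univ.pi fun _ : Fin n => Set.univ.pi fun _ : Fin n =>
      Set.Icc (-1 : ℝ) 1) :=
    isCompact_univ_pi fun _ => isCompact_univ_pi fun _ => isCompact_Icc
  rw [hsub]
  refine IsCompact.of_isClosed_subset hK hcl ?_
  rintro A ⟨hA, -⟩ i - j -
  have h1 : ∑ k, A i k * A i k = 1 := by
    have := congrFun (congrFun hA i) i
    simpa [Matrix.mul_apply] using this
  have h2 : A i j * A i j ≤ 1 := h1 ▸ Finset.single_le_sum (f := fun k => A i k * A i k)
    (fun k _ => mul_self_nonneg _) (Finset.mem_univ j)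
  exact abs_le.mp (abs_le_one_iff_mul_self_le_one.mpr h2)

instance (n : ℕ) : SecondCountableTopology (SO n) :=
  inferInstanceAs (SecondCountableTopology
    {A : Fin n → Fin n → ℝ // (A : Matrix (Fin n) (Fin n) ℝ) ∈ SO n})

instance (n : ℕ) : MeasurableSpace (SO n) := borel _

instance (n : ℕ) : BorelSpace (SO n) := ⟨rfl⟩

/-- The Haar probability measure of a compact group. -/
abbrev haarProb (G : Type*) [Group G] [TopologicalSpace G] [IsTopologicalGroup G] [CompactSpace G]
    [MeasurableSpace G] [BorelSpace G] : Measure G :=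
  Measure.haarMeasure (⊤ : TopologicalSpace.PositiveCompacts G)

/-- `L_2(SO(n))`. -/
abbrev L2SO (n : ℕ) := Lp ℂ 2 (haarProb (SO n))

/-- `SO(n-1)`, as the subgroup of `SO(n)` that fixes the first coordinate vector `e_1`. -/
def SOsub (n : ℕ) [NeZero n] : Subgroup (SO n) where
  carrier := {k | k.1 *ᵥ Pi.single 0 1 = Pi.single 0 1}
  one_mem' := Matrix.one_mulVec _
  mul_mem' := by
    intro a b ha hb
    simp only [Set.mem_ofPred_eq] at ha hb ⊢
    rw [Submonoid.coe_mul, ← Matrix.mulVec_mulVec, hb, ha]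
  inv_mem' := by
    intro a ha
    simp only [Set.mem_ofPred_eq] at ha ⊢
    have h : (a⁻¹).1 * a.1 = 1 := by rw [← Submonoid.coe_mul]; simp
    nth_rewrite 1 [← ha]
    rw [Matrix.mulVec_mulVec, h, Matrix.one_mulVec]

instance (n : ℕ) [NeZero n] : CompactSpace (SOsub n) := by
  refine isCompact_iff_compactSpace.mp (IsClosed.isCompact ?_)
  exact isClosed_eq (f := fun k : SO n => k.1 *ᵥ Pi.single 0 1)
    (Continuous.matrix_mulVec continuous_subtype_val continuous_const) continuous_const

instance (n : ℕ) [NeZero n] : SecondCountableTopology (SOsub n) :=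
  TopologicalSpace.Subtype.secondCountableTopology _

/-- `φ` is `SO(n-1)`-biinvariant. -/
def IsBiinvariant {n : ℕ} [NeZero n] (φ : SO n → ℂ) : Prop :=
  ∀ u ∈ SOsub n, ∀ v ∈ SOsub n, ∀ k, φ (u * k * v) = φ k

/-- The left regular representation: `(λ(g) f)(x) = f(g⁻¹ x)`. -/
def leftReg {n : ℕ} (g : SO n) (f : L2SO n) : L2SO n := DomMulAct.mk g⁻¹ • f

theorem continuous_leftReg {n : ℕ} [NeZero n] (g : SO n) (f : L2SO n) :
    Continuous fun w : SOsub n × SOsub n => leftReg ((w.1 : SO n) * g * (w.2 : SO n)) f := by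
  unfold leftReg
  have : Fact ((2 : ℝ≥0∞) ≠ ∞) := ⟨by simp⟩
  have h : Continuous fun w : SOsub n × SOsub n => ((w.1 : SO n) * g * (w.2 : SO n))⁻¹ := by
    fun_prop
  have h' := DomMulAct.continuous_mk.comp h
  exact h'.smul continuous_const

theorem integrable_leftReg {n : ℕ} [NeZero n] (g : SO n) (f : L2SO n) :
    Integrable (fun w : SOsub n × SOsub n => leftReg ((w.1 : SO n) * g * (w.2 : SO n)) f)
      ((haarProb (SOsub n)).prod (haarProb (SOsub n))) :=
  (continuous_leftReg g f).integrable_of_hasCompactSupport (HasCompactSupport.of_compactSpace _)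

/-- The operator `∫_{SO(n-1) × SO(n-1)} λ(u g u') du du'` on `L_2(SO(n))` (an integral in the
strong operator topology, for the Haar probability measure of `SO(n-1)`). -/
def doubleAverage {n : ℕ} [NeZero n] (g : SO n) : L2SO n →L[ℂ] L2SO n :=
  LinearMap.mkContinuous
    { toFun := fun f => ∫ w : SOsub n × SOsub n, leftReg ((w.1 : SO n) * g * (w.2 : SO n)) f
        ∂((haarProb (SOsub n)).prod (haarProb (SOsub n)))
      map_add' := fun f₁ f₂ => by
        rw [← integral_add (integrable_leftReg g f₁) (integrable_leftReg g f₂)]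
        simp [leftReg]
      map_smul' := fun c f => by
        rw [RingHom.id_apply, ← integral_smul]
        simp only [leftReg, smul_comm c] }
    (((haarProb (SOsub n)).prod (haarProb (SOsub n))).real univ)
    (fun f => by
      refine (norm_integral_le_of_norm_le_const (C := ‖f‖) (Eventually.of_forall fun w => ?_)).trans
        (mul_comm _ _).le
      simp [leftReg])

/-! ### The exponents -/

/-- `α₀ = (n-2)/2 - (n-1)/p`, where `1/∞ = 0`. -/
def criticalOrder (n : ℕ) (p : ℝ≥0∞) : ℝ := ((n : ℝ) - 2) / 2 - ((n : ℝ) - 1) * (p⁻¹).toReal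

open Classical in
/-- `α = α₀` if `α₀` is not an integer, and `α = α₀ - ε` if it is. -/
def smoothnessOrder (n : ℕ) (p : ℝ≥0∞) (ε : ℝ) : ℝ :=
  if ∃ m : ℤ, criticalOrder n p = m then criticalOrder n p - ε else criticalOrder n p

end

end SchurRegularity

/-! Put d = n - 2. Biinvariant functions on SO(n) are functions of δ = g_11, and they are expanded
in the zonal polynomials P_k = `zonal d k`. With m_k = `mult d k`, of size k^d, the operators E_k =
m_k ∫ P_k(g) λ(g) dg (`harmProj`) are mutually orthogonal projections of rank at most m_k. The
product formula `integral_zonal_product` gives E_k T_δ = P_k(δ) E_k. The E_k separate the left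
SO(n-1)-invariant vectors, hence T_δ = Σ P_k(δ) E_k for |δ| < 1 (`doubleAverage_eq_tsum`). The
S_p-norm of Σ c_k E_k is at most the norm of c in ℓ_p with weight m_k
(`IsProjFamily.schattenNorm_tsum_le`), so (2) reduces to the regularity of the curve δ ↦ (P_k(δ))_k
in that sequence space.

The analytic input is the estimate |P_k^(j)| ≤ A (k+1)^(j - d/2), uniform on [-r, r] for r < 1
(`zonal_iterate_derivative_bound`). It comes from an energy for the Gegenbauer equation that is
largest at 0. The j-th derivative of the curve then lies in the weighted space if d + p(j - d/2) <
-1, that is, if j < d/2 - (d+1)/p = α₀. Its increment over a distance h is bounded termwise by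
(k+1)^(j - d/2) min(1, (k+1)h), and the norm of this is O(h^s) for 0 ≤ s < 1 and s ≤ α₀ - j, with s
= α₀ - j included (`exists_weightedNorm_mult_le`). So the exact order α₀ is reached unless it is an
integer.

For (1), the multiplier is tested on finite sums Σ c_k E_k, whose kernels depend on x y⁻¹ only. The
image B has a kernel of the same type, so the constant function 1 is an eigenvector of B, with
eigenvalue Σ c_k a_k where a_k = m_k ∫ φ P_k. An eigenvalue is bounded by the operator norm, which
explains why S_p-S_∞ boundedness suffices: a is a bounded functional on the weighted space
(`exists_dualBound`). Applied to the curve it gives ψ(δ) = Σ a_k P_k(δ), which inherits the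
regularity, and the L_2-expansion of φ shows that φ(g) = ψ(g_11) almost everywhere
(`ae_eq_zonalSeries`). -/

namespace SchurRegularity

/-! ### Gegenbauer polynomials: recurrence, differential equation, spans -/

section

open Polynomial

/-- The zonal spherical polynomials of the sphere of dimension `d + 1`: the Gegenbauer polynomials
of index `d / 2`, normalised by the value `1` at `1`. -/
noncomputable def zonal (d : ℕ) : ℕ → ℝ[X]
  | 0 => 1
  | 1 => X
  | k + 2 => C ((2 * k + 2 + d : ℝ) / (k + 1 + d)) * X * zonal d (k + 1)
      - C ((k + 1 : ℝ) / (k + 1 + d)) * zonal d k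

theorem zonal_zero (d : ℕ) : zonal d 0 = 1 := by rw [zonal]

theorem zonal_one (d : ℕ) : zonal d 1 = X := by rw [zonal]

theorem zonal_add_two (d k : ℕ) :
    C (k + 1 + d : ℝ) * zonal d (k + 2)
      = C (2 * k + 2 + d : ℝ) * X * zonal d (k + 1) - C (k + 1 : ℝ) * zonal d k := by
  have h : (k + 1 + d : ℝ) ≠ 0 := by positivity
  rw [zonal, mul_sub, ← mul_assoc, ← mul_assoc, ← mul_assoc, ← C_mul, ← C_mul, mul_div_cancel₀ _ h,
    mul_div_cancel₀ _ h]

theorem zonal_eval_one (d k : ℕ) : (zonal d k).eval 1 = 1 := by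
  induction k using Nat.twoStepInduction with
  | zero => simp [zonal_zero]
  | one => simp [zonal_one]
  | more k h1 h2 =>
    have h : (k + 1 + d : ℝ) ≠ 0 := by positivity
    rw [zonal]
    simp only [eval_sub, eval_mul, eval_C, eval_X, h1, h2]
    field_simp
    ring

theorem zonal_eval_neg_one (d k : ℕ) : (zonal d k).eval (-1) = (-1) ^ k := by
  induction k using Nat.twoStepInduction with
  | zero => simp [zonal_zero]
  | one => simp [zonal_one]
  | more k h1 h2 =>
    have h : (k + 1 + d : ℝ) ≠ 0 := by positivity
    rw [zonal]
    simp only [eval_sub, eval_mul, eval_C, eval_X, h1, h2]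
    field_simp
    ring

theorem zonal_succ_of_zero (d : ℕ) : zonal d 1 = X * zonal d 0 := by
  simp [zonal_zero, zonal_one]

/-- The two relations feed each other, hence the joint induction: the second at k and the recurrence
give the first at k + 1, and the differentiated recurrence then gives the second at k + 1. -/
theorem zonal_derivative_aux (d k : ℕ) :
    (1 - X ^ 2) * derivative (zonal d k) = C (k + d : ℝ) * (X * zonal d k - zonal d (k + 1)) ∧
    (1 - X ^ 2) * derivative (zonal d (k + 1))
      = C (k + 1 : ℝ) * (zonal d k - X * zonal d (k + 1)) := by
  induction k with
  | zero => simp [zonal_zero, zonal_one]; ring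
  | succ k ih =>
    obtain ⟨h1, h2⟩ := ih
    have hr := zonal_add_two d k
    have hd := congrArg derivative hr
    simp only [derivative_mul, derivative_sub, derivative_C, derivative_X, zero_mul, zero_add,
      mul_one] at hd
    have hne : C (k + 1 + d : ℝ) ≠ 0 := by
      rw [Ne, C_eq_zero]; positivity
    constructor
    · push_cast
      simp only [C_add, C_mul, map_ofNat, map_one, map_natCast] at *
      linear_combination h2 + hr
    · apply mul_left_cancel₀ hne
      push_cast
      simp only [C_add, C_mul, map_ofNat, map_one, map_natCast] at *
      linear_combination (1 - X ^ 2) * hd + (2 * k + 2 + d) * X * h2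
        - (k + 1) * h1 + (k + 1 + 1) * X * hr

theorem zonal_derivative (d k : ℕ) :
    (1 - X ^ 2) * derivative (zonal d k) = C (k + d : ℝ) * (X * zonal d k - zonal d (k + 1)) :=
  (zonal_derivative_aux d k).1

theorem zonal_derivative_succ (d k : ℕ) :
    (1 - X ^ 2) * derivative (zonal d (k + 1))
      = C (k + 1 : ℝ) * (zonal d k - X * zonal d (k + 1)) :=
  (zonal_derivative_aux d k).2

/-- Differentiate the first relation and multiply by 1 - X²: the first derivatives of P_k and
P_(k+1) that appear are given by the two relations. -/
theorem zonal_ode (d k : ℕ) :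
    (1 - X ^ 2) * derivative (derivative (zonal d k))
      = C (d + 1 : ℝ) * X * derivative (zonal d k) - C (k * (k + d) : ℝ) * zonal d k := by
  have h1 := zonal_derivative d k
  have h2 := zonal_derivative_succ d k
  have hd := congrArg derivative h1
  simp only [derivative_mul, derivative_sub, derivative_C, derivative_X, derivative_one,
    derivative_X_pow, zero_mul, zero_add, one_mul] at hd
  have hne : (1 - X ^ 2 : ℝ[X]) ≠ 0 := by
    intro h
    have := congrArg (eval 0) h
    simp at this
  apply mul_left_cancel₀ hne
  simp only [C_add, C_mul, map_one, map_natCast] at *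
  norm_num at hd
  linear_combination (1 - X ^ 2) * hd + (1 + k) * X * h1 - (k + d) * h2

theorem natDegree_zonal_le (d k : ℕ) : (zonal d k).natDegree ≤ k := by
  induction k using Nat.twoStepInduction with
  | zero => simp [zonal_zero]
  | one => simp [zonal_one]
  | more k h1 h2 =>
    rw [zonal]
    refine (natDegree_sub_le _ _).trans (max_le ?_ ?_)
    · rw [mul_assoc]
      refine (natDegree_C_mul_le _ _).trans (natDegree_mul_le.trans ?_)
      rw [natDegree_X]; omega
    · exact (natDegree_C_mul_le _ _).trans (by omega)

/-- The span of the first `k + 1` zonal polynomials. -/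
noncomputable def zonalSpan (d k : ℕ) : Submodule ℝ ℝ[X] :=
  Submodule.span ℝ (zonal d '' Set.Iic k)

theorem zonal_mem_zonalSpan (d : ℕ) {j k : ℕ} (h : j ≤ k) : zonal d j ∈ zonalSpan d k :=
  Submodule.subset_span ⟨j, h, rfl⟩

theorem zonalSpan_mono (d : ℕ) {j k : ℕ} (h : j ≤ k) : zonalSpan d j ≤ zonalSpan d k :=
  Submodule.span_mono (Set.image_mono (Set.Iic_subset_Iic.mpr h))

theorem X_mul_zonal_mem (d k : ℕ) : X * zonal d k ∈ zonalSpan d (k + 1) := by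
  rcases k with _ | k
  · rw [← zonal_succ_of_zero]; exact zonal_mem_zonalSpan d le_rfl
  · have h : (2 * k + 2 + d : ℝ) ≠ 0 := by positivity
    have : X * zonal d (k + 1) = ((k + 1 + d : ℝ) / (2 * k + 2 + d)) • zonal d (k + 2)
        + ((k + 1 : ℝ) / (2 * k + 2 + d)) • zonal d k := by
      have hne : C (2 * k + 2 + d : ℝ) ≠ 0 := by rwa [Ne, C_eq_zero]
      apply mul_left_cancel₀ hne
      rw [mul_add, smul_eq_C_mul, smul_eq_C_mul, ← mul_assoc (C _) (C _), ← mul_assoc (C _) (C _),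
        ← C_mul, ← C_mul, mul_div_cancel₀ _ h, mul_div_cancel₀ _ h]
      linear_combination -zonal_add_two d k
    rw [this]
    exact add_mem (Submodule.smul_mem _ _ (zonal_mem_zonalSpan d (by omega)))
      (Submodule.smul_mem _ _ (zonal_mem_zonalSpan d (by omega)))

theorem X_mul_mem_zonalSpan (d k : ℕ) {q : ℝ[X]} (hq : q ∈ zonalSpan d k) :
    X * q ∈ zonalSpan d (k + 1) := by
  induction hq using Submodule.span_induction with
  | mem q hq =>
    obtain ⟨j, hj, rfl⟩ := hq
    exact zonalSpan_mono d (Nat.succ_le_succ hj) (X_mul_zonal_mem d j)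
  | zero => simp
  | add q r _ _ hq hr => rw [mul_add]; exact add_mem hq hr
  | smul a q _ hq => rw [mul_smul_comm]; exact Submodule.smul_mem _ _ hq

theorem X_pow_mem_zonalSpan (d m : ℕ) : (X ^ m : ℝ[X]) ∈ zonalSpan d m := by
  induction m with
  | zero => rw [pow_zero, ← zonal_zero d]; exact zonal_mem_zonalSpan d le_rfl
  | succ m ih => rw [pow_succ']; exact X_mul_mem_zonalSpan d m ih

theorem mem_zonalSpan_of_natDegree_le (d : ℕ) {k : ℕ} {q : ℝ[X]} (hq : q.natDegree ≤ k) :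
    q ∈ zonalSpan d k := by
  rw [q.as_sum_range_C_mul_X_pow]
  refine sum_mem fun i hi => ?_
  rw [← smul_eq_C_mul]
  exact Submodule.smul_mem _ _ (zonalSpan_mono d (by rw [Finset.mem_range] at hi; omega)
    (X_pow_mem_zonalSpan d i))

theorem exists_eq_sum_zonal (d : ℕ) {k : ℕ} {q : ℝ[X]} (hq : q.natDegree ≤ k) :
    ∃ b : ℕ → ℝ, q = ∑ j ∈ Finset.range (k + 1), b j • zonal d j := by
  have h := mem_zonalSpan_of_natDegree_le d hq
  clear hq
  induction h using Submodule.span_induction with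
  | mem q hq =>
    obtain ⟨j, hj, rfl⟩ := hq
    refine ⟨fun i => if i = j then 1 else 0, ?_⟩
    simp only [ite_smul, one_smul, zero_smul]
    rw [Finset.sum_ite_eq' _ _ _, if_pos (Finset.mem_range.mpr (Nat.lt_succ_of_le hj))]
  | zero => exact ⟨0, by simp⟩
  | add q r _ _ hq hr =>
    obtain ⟨b, hb⟩ := hq
    obtain ⟨c, hc⟩ := hr
    exact ⟨b + c, by rw [hb, hc, ← Finset.sum_add_distrib]; simp [add_smul]⟩
  | smul a q _ hq =>
    obtain ⟨b, hb⟩ := hq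
    exact ⟨a • b, by rw [hb, Finset.smul_sum]; simp [mul_smul]⟩

/-! ### The orthogonality functional -/

/-- The dimension of the space of spherical harmonics of degree `k` on the sphere of
dimension `d + 1`. -/
noncomputable def mult (d : ℕ) : ℕ → ℝ
  | 0 => 1
  | k + 1 => mult d k * ((2 * k + 2 + d) * (k + d) / ((k + 1) * (2 * k + d)))

theorem mult_pos {d : ℕ} (hd : 1 ≤ d) (k : ℕ) : 0 < mult d k := by
  have : (0 : ℝ) < d := by exact_mod_cast hd
  induction k with
  | zero => simp [mult]
  | succ k ih => rw [mult]; positivity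

/-- The product telescopes. The closed form only serves the growth bounds below: order k^d from
above, order k from below. -/
theorem mult_eq {d : ℕ} (k : ℕ) :
    mult (d + 1) k = (2 * k + d + 1) / (d + 1) * (k + d).choose d := by
  induction k with
  | zero => simp [mult]; field_simp
  | succ k ih =>
    rw [mult, ih]
    have h : ((k + 1 + d).choose d : ℝ) * (k + 1) = (k + d).choose d * (k + 1 + d) := by
      have h1 := Nat.choose_mul_succ_eq (k + d) d
      have h2 : k + d + 1 - d = k + 1 := by omega
      rw [h2] at h1
      rw [show k + 1 + d = k + d + 1 by ring]
      have := congrArg (Nat.cast : ℕ → ℝ) h1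
      push_cast at this
      linarith
    have h0 : (2 * (k : ℝ) + (d + 1 : ℕ)) ≠ 0 := by positivity
    have h' : ((k + 1 + d).choose d : ℝ) = (k + d).choose d * (k + 1 + d) / (k + 1) :=
      eq_div_of_mul_eq (by positivity) h
    rw [h']
    push_cast at h0 ⊢
    field_simp
    ring

theorem choose_le_succ_pow (k d : ℕ) : ((k + d).choose d : ℝ) ≤ (k + 1) ^ d := by
  induction d with
  | zero => simp
  | succ d ih =>
    have h1 := Nat.add_one_mul_choose_eq (k + d) d
    have h2 : ((k + (d + 1)).choose (d + 1) : ℝ) * (d + 1) = (k + d + 1) * (k + d).choose d := by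
      have := congrArg (Nat.cast : ℕ → ℝ) h1
      push_cast at this
      rw [← add_assoc]; linarith
    have h3 : (k + d + 1 : ℝ) ≤ (k + 1) * (d + 1) := by nlinarith [k.cast_nonneg (α := ℝ), d.cast_nonneg (α := ℝ)]
    have h4 : ((k + (d + 1)).choose (d + 1) : ℝ) * (d + 1) ≤ (k + 1) ^ (d + 1) * (d + 1) := by
      rw [h2, pow_succ]
      calc (k + d + 1 : ℝ) * (k + d).choose d ≤ ((k + 1) * (d + 1)) * (k + 1) ^ d := by gcongr
        _ = _ := by ring
    exact le_of_mul_le_mul_right h4 (by positivity)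

theorem mult_le {d : ℕ} (hd : 1 ≤ d) (k : ℕ) : mult d k ≤ 2 * (k + 1) ^ d := by
  obtain ⟨d, rfl⟩ := Nat.exists_eq_add_of_le' hd
  rw [mult_eq]
  have h1 : (2 * k + d + 1 : ℝ) / (d + 1) ≤ 2 * (k + 1) := by
    rw [div_le_iff₀ (by positivity)]
    nlinarith [k.cast_nonneg (α := ℝ), d.cast_nonneg (α := ℝ)]
  calc (2 * k + d + 1 : ℝ) / (d + 1) * (k + d).choose d ≤ (2 * (k + 1)) * (k + 1) ^ d :=
        mul_le_mul h1 (choose_le_succ_pow k d) (by positivity) (by positivity)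
    _ = _ := by ring

theorem le_mult {d : ℕ} (hd : 1 ≤ d) (k : ℕ) : (k : ℝ) / d ≤ mult d k := by
  obtain ⟨d, rfl⟩ := Nat.exists_eq_add_of_le' hd
  rw [mult_eq]
  have h1 : (1 : ℝ) ≤ (k + d).choose d := by
    exact_mod_cast Nat.succ_le_of_lt (Nat.choose_pos (by omega))
  push_cast
  calc (k : ℝ) / (d + 1) ≤ (2 * k + d + 1) / (d + 1) * 1 := by
        rw [mul_one]; gcongr; nlinarith [k.cast_nonneg (α := ℝ), d.cast_nonneg (α := ℝ)]
    _ ≤ _ := by gcongr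

section Functional

variable {d : ℕ} (ν : ℝ[X] →ₗ[ℝ] ℝ)
  (hν : ∀ Q : ℝ[X], ν ((1 - X ^ 2) * derivative Q - C (d + 1 : ℝ) * X * Q) = 0)

include hν

/-- The hypothesis `hν` is integration by parts for the weight (1 - x²)^((d-1)/2). Applied to the
Wronskian of P_k and P_l it yields, by the differential equation, (l(l+d) - k(k+d)) ν(P_k P_l) = 0,
and the two eigenvalues differ. -/
theorem functional_zonal_mul {k l : ℕ} (hkl : k ≠ l) : ν (zonal d k * zonal d l) = 0 := by
  have h1 := zonal_ode d k
  have h2 := zonal_ode d l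
  have h := hν (derivative (zonal d k) * zonal d l - zonal d k * derivative (zonal d l))
  have h3 : (1 - X ^ 2) * derivative (derivative (zonal d k) * zonal d l
        - zonal d k * derivative (zonal d l))
      - C (d + 1 : ℝ) * X * (derivative (zonal d k) * zonal d l
        - zonal d k * derivative (zonal d l))
      = ((l : ℝ) * (l + d) - k * (k + d)) • (zonal d k * zonal d l) := by
    rw [smul_eq_C_mul]
    simp only [derivative_mul, derivative_sub]
    simp only [C_add, C_mul, C_sub, map_one, map_natCast] at *
    linear_combination zonal d l * h1 - zonal d k * h2
  rw [h3, map_smul, smul_eq_mul] at h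
  refine (mul_eq_zero.mp h).resolve_left fun h0 => hkl ?_
  have h4 : ((l : ℝ) - k) * (l + k + d) = 0 := by linear_combination h0
  rcases mul_eq_zero.mp h4 with h5 | h5
  · exact_mod_cast (sub_eq_zero.mp h5).symm
  · have h6 : (l : ℝ) = 0 ∧ (k : ℝ) = 0 := by
      constructor <;> linarith [k.cast_nonneg (α := ℝ), l.cast_nonneg (α := ℝ),
        d.cast_nonneg (α := ℝ)]
    exact_mod_cast h6.2.trans h6.1.symm

/-- The number ν(X P_k P_(k+1)) is computed twice, by expanding X P_k (`hA`) and by expanding X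
P_(k+1) (`hB`). The comparison gives the ratio of consecutive values of ν(P_k²), which is the
inverse of the ratio in `mult`. -/
theorem functional_zonal_sq (hd : 1 ≤ d) (h1 : ν 1 = 1) (k : ℕ) :
    ν (zonal d k * zonal d k) = (mult d k)⁻¹ := by
  have hd' : (0 : ℝ) < d := by exact_mod_cast hd
  induction k with
  | zero => simp [zonal_zero, h1, mult]
  | succ k ih =>
    have hA : (2 * k + d : ℝ) * ν (X * zonal d k * zonal d (k + 1))
        = (k + d) * ν (zonal d (k + 1) * zonal d (k + 1)) := by
      rcases k with _ | k
      · rw [← zonal_succ_of_zero]; simp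
      · have hr := zonal_add_two d k
        have h2 : (2 * k + 2 + d : ℝ) • (X * zonal d (k + 1) * zonal d (k + 2))
            = (k + 1 + d : ℝ) • (zonal d (k + 2) * zonal d (k + 2))
              + (k + 1 : ℝ) • (zonal d k * zonal d (k + 2)) := by
          simp only [smul_eq_C_mul]
          linear_combination -zonal d (k + 2) * hr
        have h3 := congrArg ν h2
        rw [map_add, map_smul, map_smul, map_smul,
          functional_zonal_mul ν hν (show k ≠ k + 2 by omega)] at h3
        simp only [smul_eq_mul] at h3
        push_cast
        rw [show k + 1 + 1 = k + 2 by ring]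
        linear_combination h3
    have hB : (2 * k + 2 + d : ℝ) * ν (X * zonal d k * zonal d (k + 1))
        = (k + 1) * ν (zonal d k * zonal d k) := by
      have hr := zonal_add_two d k
      have h2 : (2 * k + 2 + d : ℝ) • (X * zonal d k * zonal d (k + 1))
          = (k + 1 + d : ℝ) • (zonal d k * zonal d (k + 2))
            + (k + 1 : ℝ) • (zonal d k * zonal d k) := by
        simp only [smul_eq_C_mul]
        linear_combination -zonal d k * hr
      have h3 := congrArg ν h2
      rw [map_add, map_smul, map_smul, map_smul,
        functional_zonal_mul ν hν (show k ≠ k + 2 by omega)] at h3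
      simp only [smul_eq_mul] at h3
      linear_combination h3
    have hm := mult_pos hd k
    rw [ih] at hB
    rw [mult]
    have h5 : ν (X * zonal d k * zonal d (k + 1)) = (k + 1) * (mult d k)⁻¹ / (2 * k + 2 + d) := by
      field_simp; field_simp at hB; linear_combination hB
    rw [h5] at hA
    field_simp
    field_simp at hA
    linear_combination -hA

end Functional

end

/-! ### Locally uniform bounds for the derivatives of zonal polynomials -/

section

open Polynomial

/-- At 0 the recurrence reads P_(k+2)(0) = -(k+1)/(k+1+d) · P_k(0), and the left side does not
increase from k to k + 2. -/
theorem zonal_eval_zero_sq_le (d k : ℕ) :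
    (zonal d k).eval 0 ^ 2 * ((k + 1).ascFactorial d : ℝ) ≤ d.factorial := by
  induction k using Nat.twoStepInduction with
  | zero => simp [zonal_zero, Nat.one_ascFactorial]
  | one => simp [zonal_one]
  | more k h1 _ =>
    have hr := congrArg (eval 0) (zonal_add_two d k)
    simp only [eval_sub, eval_mul, eval_C, eval_X, mul_zero, zero_mul, zero_sub] at hr
    have h3 := congrArg (Nat.cast : ℕ → ℝ) (Nat.succ_ascFactorial (k + 1) d)
    have h4 := congrArg (Nat.cast : ℕ → ℝ) (Nat.succ_ascFactorial (k + 1 + 1) d)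
    push_cast at h3 h4
    rw [show (k + 1 + 1).succ = k + 2 + 1 by rfl] at h4
    set a := (zonal d (k + 2)).eval 0
    set b := (zonal d k).eval 0
    set f2 := ((k + 2 + 1).ascFactorial d : ℝ)
    set f1 := ((k + 1 + 1).ascFactorial d : ℝ)
    set f0 := ((k + 1).ascFactorial d : ℝ)
    have h5 : a = -((k + 1) * b) / (k + 1 + d) := by
      rw [eq_div_iff (by positivity)]; linear_combination hr
    have h6 : f2 = (k + 2 + d) * (k + 1 + d) / ((k + 1) * (k + 2)) * f0 := by
      have : f1 = (k + 1 + d) * f0 / (k + 1) := by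
        rw [eq_div_iff (by positivity)]; linear_combination h3
      rw [this] at h4
      field_simp at h4 ⊢
      linear_combination h4
    have h7 : a ^ 2 * f2 = ((k + 1) * (k + 2 + d)) / ((k + 2) * (k + 1 + d)) * (b ^ 2 * f0) := by
      rw [h5, h6]; field_simp
    rw [h7]
    have hf0 : 0 ≤ f0 := by positivity
    refine (mul_le_of_le_one_left (by positivity) ?_).trans h1
    rw [div_le_one (by positivity)]
    nlinarith [k.cast_nonneg (α := ℝ), d.cast_nonneg (α := ℝ)]

theorem zonal_eval_zero_sq_le' (d k : ℕ) :
    (zonal d k).eval 0 ^ 2 ≤ d.factorial / (k + 1 : ℝ) ^ d := by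
  rw [le_div_iff₀ (by positivity)]
  refine le_trans ?_ (zonal_eval_zero_sq_le d k)
  gcongr
  exact_mod_cast Nat.pow_succ_le_ascFactorial k.succ d

/-- The energy of the Gegenbauer differential equation, with the weight that makes it decrease
away from the origin. -/
noncomputable def zonalEnergy (d k : ℕ) : ℝ[X] :=
  (1 - X ^ 2) ^ d * ((1 - X ^ 2) * derivative (zonal d k) ^ 2 + C (k * (k + d) : ℝ) * zonal d k ^ 2)

/-- The exponent d in the weight is the one for which the terms with P_k'² cancel. What remains has
the sign of -x on [-1, 1], so the energy is largest at 0. -/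
theorem derivative_zonalEnergy {d : ℕ} (hd : 1 ≤ d) (k : ℕ) :
    derivative (zonalEnergy d k)
      = -(C (2 * d * (k * (k + d)) : ℝ) * X * (1 - X ^ 2) ^ (d - 1) * zonal d k ^ 2) := by
  obtain ⟨d, rfl⟩ := Nat.exists_eq_add_of_le' hd
  have h := zonal_ode (d + 1) k
  rw [zonalEnergy]
  simp only [derivative_mul, derivative_sub, derivative_add, derivative_C,
    derivative_X, derivative_pow, derivative_one, add_tsub_cancel_right]
  push_cast at h ⊢
  have hC : (C 2 : ℝ[X]) = 2 := rfl
  simp only [C_add, C_mul, map_one, map_natCast, hC] at *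
  norm_num at h ⊢
  linear_combination 2 * (1 - X ^ 2) ^ (d + 1) * derivative (zonal (d + 1) k) * h

theorem zonalEnergy_eval_le {d : ℕ} (hd : 1 ≤ d) (k : ℕ) {x : ℝ} (hx : |x| ≤ 1) :
    (zonalEnergy d k).eval x ≤ (zonalEnergy d k).eval 0 := by
  have hder : ∀ y, deriv (fun y => (zonalEnergy d k).eval y) y
      = -(2 * d * (k * (k + d)) * (1 - y ^ 2) ^ (d - 1) * (zonal d k).eval y ^ 2) * y := by
    intro y
    rw [Polynomial.deriv, derivative_zonalEnergy hd]
    simp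
    ring
  have hnn : ∀ y : ℝ, |y| ≤ 1 →
      0 ≤ 2 * d * (k * (k + d)) * (1 - y ^ 2) ^ (d - 1) * (zonal d k).eval y ^ 2 := by
    intro y hy
    have : 0 ≤ 1 - y ^ 2 := by nlinarith [abs_nonneg y, sq_abs y]
    positivity
  obtain ⟨hx1, hx2⟩ := abs_le.mp hx
  rcases le_total 0 x with h0 | h0
  · have : AntitoneOn (fun y => (zonalEnergy d k).eval y) (Icc 0 1) := by
      refine antitoneOn_of_deriv_nonpos (convex_Icc 0 1) (Polynomial.continuous _).continuousOn
        (Polynomial.differentiable _).differentiableOn fun y hy => ?_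
      rw [interior_Icc] at hy
      rw [hder]
      have := hnn y (abs_le.mpr ⟨by linarith [hy.1], hy.2.le⟩)
      nlinarith [hy.1]
    exact this ⟨le_rfl, zero_le_one⟩ ⟨h0, hx2⟩ h0
  · have : MonotoneOn (fun y => (zonalEnergy d k).eval y) (Icc (-1) 0) := by
      refine monotoneOn_of_deriv_nonneg (convex_Icc _ _) (Polynomial.continuous _).continuousOn
        (Polynomial.differentiable _).differentiableOn fun y hy => ?_
      rw [interior_Icc] at hy
      rw [hder]
      have := hnn y (abs_le.mpr ⟨hy.1.le, by linarith [hy.2]⟩)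
      nlinarith [hy.2]
    exact this ⟨hx1, h0⟩ ⟨by norm_num, le_rfl⟩ h0

/-- At 0 the energy is P_k'(0)² + k(k+d) P_k(0)², and P_(k+1)'(0) = (k+1) P_k(0), so the decay of
the values at 0 controls both terms. -/
theorem zonalEnergy_eval_zero_le (d k : ℕ) :
    (zonalEnergy d k).eval 0
      ≤ d.factorial * (2 ^ d + (d + 1)) * ((k + 1 : ℝ) ^ 2 / (k + 1) ^ d) := by
  have hE : (zonalEnergy d k).eval 0
      = (derivative (zonal d k)).eval 0 ^ 2 + k * (k + d) * (zonal d k).eval 0 ^ 2 := by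
    simp [zonalEnergy]
  rw [hE]
  have h1 : (derivative (zonal d k)).eval 0 ^ 2
      ≤ d.factorial * 2 ^ d * ((k + 1 : ℝ) ^ 2 / (k + 1) ^ d) := by
    rcases k with _ | k
    · simp [zonal_zero]
    · have h := congrArg (eval 0) (zonal_derivative_succ d k)
      simp only [eval_sub, eval_mul, eval_C, eval_X, eval_one, eval_pow] at h
      have h' : (derivative (zonal d (k + 1))).eval 0 = (k + 1) * (zonal d k).eval 0 := by
        linear_combination h
      rw [h', mul_pow]
      push_cast
      have h3 : ((k + 1 + 1 : ℝ)) ^ d ≤ 2 ^ d * (k + 1) ^ d := by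
        rw [← mul_pow]; gcongr; linarith [k.cast_nonneg (α := ℝ)]
      have h4 : ((k + 1 : ℝ)) ^ 2 ≤ (k + 1 + 1) ^ 2 := by gcongr; linarith
      calc (k + 1 : ℝ) ^ 2 * (zonal d k).eval 0 ^ 2
          ≤ (k + 1 + 1) ^ 2 * (d.factorial / (k + 1 : ℝ) ^ d) :=
            mul_le_mul h4 (zonal_eval_zero_sq_le' d k) (by positivity) (by positivity)
        _ ≤ (k + 1 + 1) ^ 2 * (d.factorial * 2 ^ d / (k + 1 + 1 : ℝ) ^ d) := by
            gcongr ?_ * ?_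
            rw [div_le_div_iff₀ (by positivity) (by positivity), mul_assoc]
            gcongr
        _ = _ := by ring
  have h2 : (k * (k + d) : ℝ) * (zonal d k).eval 0 ^ 2
      ≤ d.factorial * (d + 1) * ((k + 1 : ℝ) ^ 2 / (k + 1) ^ d) := by
    have h3 : (k * (k + d) : ℝ) ≤ (d + 1) * (k + 1) ^ 2 := by
      nlinarith [k.cast_nonneg (α := ℝ), d.cast_nonneg (α := ℝ),
        mul_nonneg (k.cast_nonneg (α := ℝ)) (d.cast_nonneg (α := ℝ)),
        mul_nonneg (mul_nonneg (k.cast_nonneg (α := ℝ)) (d.cast_nonneg (α := ℝ)))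
          (k.cast_nonneg (α := ℝ))]
    calc (k * (k + d) : ℝ) * (zonal d k).eval 0 ^ 2
        ≤ ((d + 1) * (k + 1) ^ 2) * (d.factorial / (k + 1 : ℝ) ^ d) :=
          mul_le_mul h3 (zonal_eval_zero_sq_le' d k) (by positivity) (by positivity)
      _ = _ := by ring
  linarith

theorem zonal_iterate_ode (d k j : ℕ) :
    (1 - X ^ 2) * derivative^[j + 2] (zonal d k)
      = C (2 * j + d + 1 : ℝ) * X * derivative^[j + 1] (zonal d k)
        - C (k * (k + d) - j * (j + d) : ℝ) * derivative^[j] (zonal d k) := by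
  induction j with
  | zero => simpa using zonal_ode d k
  | succ j ih =>
    have h := congrArg derivative ih
    simp only [derivative_mul, derivative_sub, derivative_C, derivative_X, derivative_one,
      derivative_X_pow, ← Function.iterate_succ_apply' (derivative : ℝ[X] → ℝ[X])] at h
    push_cast
    simp only [C_add, C_mul, C_sub, map_one, map_natCast, map_ofNat] at *
    norm_num at h ⊢
    linear_combination h

theorem abs_le_rpow_of_sq_le {d k j : ℕ} {y A : ℝ} (hA : 0 ≤ A)
    (h : y ^ 2 ≤ A * ((k + 1 : ℝ) ^ (2 * j) / (k + 1) ^ d)) :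
    |y| ≤ √A * (k + 1 : ℝ) ^ ((j : ℝ) - d / 2) := by
  have hk : (0 : ℝ) < k + 1 := by positivity
  refine abs_le_of_sq_le_sq (h.trans (le_of_eq ?_)) (by positivity)
  rw [mul_pow, Real.sq_sqrt hA, ← Real.rpow_natCast _ 2, ← Real.rpow_mul hk.le,
    ← Real.rpow_natCast, ← Real.rpow_natCast, ← Real.rpow_sub hk]
  congr 2
  push_cast
  ring

/-- The cases j = 0 and j = 1 are read off from the two terms of the energy, whose weight is bounded
below on [-r, r]. Higher orders follow from the differentiated equation after division by 1 - x²;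
its coefficient k(k+d) accounts for the two powers of k gained. -/
theorem zonal_iterate_derivative_bound {d : ℕ} (hd : 1 ≤ d) {r : ℝ} (hr0 : 0 ≤ r) (hr : r < 1)
    (j : ℕ) :
    ∃ A : ℝ, 0 ≤ A ∧ ∀ k : ℕ, ∀ x : ℝ, |x| ≤ r →
      |(derivative^[j] (zonal d k)).eval x| ≤ A * (k + 1 : ℝ) ^ ((j : ℝ) - d / 2) := by
  have hr2 : 0 < 1 - r ^ 2 := by nlinarith
  set B : ℝ := d.factorial * (2 ^ d + (d + 1)) with hB
  have hB0 : 0 ≤ B := by positivity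
  have hB1 : 1 ≤ B := by
    have h1 : (1 : ℝ) ≤ d.factorial := by exact_mod_cast d.factorial_pos
    have h2 : (1 : ℝ) ≤ 2 ^ d + (d + 1) := by
      have : (0 : ℝ) < 2 ^ d := by positivity
      linarith [d.cast_nonneg (α := ℝ)]
    nlinarith
  have hx2 : ∀ x : ℝ, |x| ≤ r → 1 - r ^ 2 ≤ 1 - x ^ 2 := by
    intro x hx
    nlinarith [abs_nonneg x, sq_abs x]
  have hE : ∀ k : ℕ, ∀ x : ℝ, |x| ≤ r →
      (1 - r ^ 2) ^ d * ((1 - r ^ 2) * (derivative (zonal d k)).eval x ^ 2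
        + k * (k + d) * (zonal d k).eval x ^ 2) ≤ B * ((k + 1 : ℝ) ^ 2 / (k + 1) ^ d) := by
    intro k x hx
    refine le_trans ?_ ((zonalEnergy_eval_le hd k (hx.trans hr.le)).trans
      (zonalEnergy_eval_zero_le d k))
    simp only [zonalEnergy, eval_mul, eval_pow, eval_sub, eval_one, eval_X, eval_add, eval_C]
    have := hx2 x hx
    have : 0 ≤ 1 - x ^ 2 := by linarith
    gcongr
  induction j using Nat.twoStepInduction with
  | zero =>
    refine ⟨√(4 * B / (1 - r ^ 2) ^ d), by positivity, fun k x hx => ?_⟩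
    refine abs_le_rpow_of_sq_le (by positivity) ?_
    simp only [Function.iterate_zero, id, mul_zero, pow_zero]
    -- The energy says nothing about P_0, because the factor k(k+d) vanishes there.
    rcases k with _ | k
    · simp only [zonal_zero, eval_one, Nat.cast_zero, zero_add, one_pow, div_one, mul_one]
      rw [le_div_iff₀ (by positivity), one_mul]
      have : (1 - r ^ 2) ^ d ≤ 1 := pow_le_one₀ hr2.le (by nlinarith)
      linarith
    · have h := hE (k + 1) x hx
      -- For positive degree l, (l+1)²/4 ≤ l(l+d); this is the source of the 4 in the constant.
      have h1 : (1 - r ^ 2) ^ d * (((k + 1 : ℕ) + 1 : ℝ) ^ 2 / 4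
          * (zonal d (k + 1)).eval x ^ 2)
          ≤ B * (((k + 1 : ℕ) + 1 : ℝ) ^ 2 / ((k + 1 : ℕ) + 1) ^ d) := by
        refine le_trans ?_ h
        gcongr
        have h3 : (((k + 1 : ℕ) : ℝ) + 1) ^ 2 / 4 ≤ ((k + 1 : ℕ) : ℝ) * ((k + 1 : ℕ) + d) := by
          push_cast
          nlinarith [k.cast_nonneg (α := ℝ), d.cast_nonneg (α := ℝ),
            mul_nonneg (k.cast_nonneg (α := ℝ)) (d.cast_nonneg (α := ℝ))]
        have : 0 ≤ (1 - r ^ 2) * (derivative (zonal d (k + 1))).eval x ^ 2 := by positivity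
        nlinarith [sq_nonneg ((zonal d (k + 1)).eval x)]
      have hp : (0 : ℝ) < (1 - r ^ 2) ^ d := by positivity
      have hk : (0 : ℝ) < ((k + 1 : ℕ) + 1 : ℝ) := by positivity
      set z : ℝ := ((k + 1 : ℕ) + 1 : ℝ)
      set y := (zonal d (k + 1)).eval x
      rw [div_mul_div_comm, le_div_iff₀ (by positivity), mul_one]
      rw [← mul_div_assoc, le_div_iff₀ (by positivity)] at h1
      have hz2 : 0 < z ^ 2 := by positivity
      refine le_of_mul_le_mul_left ?_ hz2
      linarith
  | one =>
    refine ⟨√(B / (1 - r ^ 2) ^ (d + 1)), by positivity, fun k x hx => ?_⟩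
    refine abs_le_rpow_of_sq_le (by positivity) ?_
    have h := hE k x hx
    simp only [Function.iterate_one, mul_one]
    have h2 : 0 ≤ (1 - r ^ 2) ^ d * (k * (k + d) * (zonal d k).eval x ^ 2) := by positivity
    rw [div_mul_eq_mul_div, le_div_iff₀ (by positivity), pow_succ (1 - r ^ 2)]
    linarith
  | more j h0 h1 =>
    obtain ⟨A0, hA0, h0⟩ := h0
    obtain ⟨A1, hA1, h1⟩ := h1
    refine ⟨((2 * j + d + 1) * A1 + ((d + 1) + j * (j + d)) * A0) / (1 - r ^ 2), by positivity,
      fun k x hx => ?_⟩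
    have hk : (1 : ℝ) ≤ k + 1 := by linarith [k.cast_nonneg (α := ℝ)]
    have hode := congrArg (eval x) (zonal_iterate_ode d k j)
    simp only [eval_sub, eval_mul, eval_C, eval_X, eval_one, eval_pow] at hode
    set y2 := (derivative^[j + 2] (zonal d k)).eval x
    set y1 := (derivative^[j + 1] (zonal d k)).eval x
    set y0 := (derivative^[j] (zonal d k)).eval x
    set P := (k + 1 : ℝ) ^ (((j + 2 : ℕ) : ℝ) - d / 2) with hP
    have hP0 : 0 ≤ P := by positivity
    have hy1 : |y1| ≤ A1 * P := by
      refine (h1 k x hx).trans ?_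
      refine mul_le_mul_of_nonneg_left (Real.rpow_le_rpow_of_exponent_le hk ?_) hA1
      push_cast; linarith
    have hP' : P = (k + 1 : ℝ) ^ 2 * (k + 1 : ℝ) ^ ((j : ℝ) - d / 2) := by
      rw [hP, ← Real.rpow_natCast _ 2, ← Real.rpow_add (by positivity)]
      congr 1; push_cast; ring
    have hy0 : (k + 1 : ℝ) ^ 2 * |y0| ≤ A0 * P := by
      rw [hP', mul_left_comm]
      gcongr
      exact h0 k x hx
    have hc : |(k * (k + d) - j * (j + d) : ℝ)| ≤ ((d + 1) + j * (j + d)) * (k + 1) ^ 2 := by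
      have h3 : (k * (k + d) : ℝ) ≤ (d + 1) * (k + 1) ^ 2 := by
        nlinarith [k.cast_nonneg (α := ℝ), d.cast_nonneg (α := ℝ),
          mul_nonneg (k.cast_nonneg (α := ℝ)) (d.cast_nonneg (α := ℝ)),
          mul_nonneg (mul_nonneg (k.cast_nonneg (α := ℝ)) (d.cast_nonneg (α := ℝ)))
            (k.cast_nonneg (α := ℝ))]
      have h4 : (0 : ℝ) ≤ k * (k + d) := by positivity
      have h5 : (0 : ℝ) ≤ j * (j + d) := by positivity
      have h6 : (j * (j + d) : ℝ) ≤ j * (j + d) * (k + 1) ^ 2 :=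
        le_mul_of_one_le_right h5 (one_le_pow₀ hk)
      rw [abs_le]
      constructor <;> nlinarith [sq_nonneg (k + 1 : ℝ)]
    have hx1 : |x| ≤ 1 := hx.trans hr.le
    have hmain : (1 - x ^ 2) * |y2|
        ≤ (2 * j + d + 1) * (A1 * P) + ((d + 1) + j * (j + d)) * (A0 * P) := by
      have h7 : (1 - x ^ 2) * |y2| = |(1 - x ^ 2) * y2| := by
        rw [abs_mul, abs_of_nonneg (hr2.le.trans (hx2 x hx))]
      rw [h7, hode]
      refine (abs_sub _ _).trans (add_le_add ?_ ?_)
      · rw [abs_mul, abs_mul, abs_of_nonneg (by positivity : (0 : ℝ) ≤ 2 * j + d + 1)]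
        calc (2 * j + d + 1 : ℝ) * |x| * |y1| ≤ (2 * j + d + 1 : ℝ) * 1 * (A1 * P) := by
              gcongr
          _ = _ := by ring
      · rw [abs_mul]
        calc _ ≤ (((d + 1) + j * (j + d)) * (k + 1) ^ 2) * |y0| := by gcongr
          _ = ((d + 1) + j * (j + d)) * ((k + 1) ^ 2 * |y0|) := by ring
          _ ≤ _ := by gcongr
    rw [div_mul_eq_mul_div, le_div_iff₀ hr2, mul_comm]
    calc (1 - r ^ 2) * |y2| ≤ (1 - x ^ 2) * |y2| := mul_le_mul_of_nonneg_right (hx2 x hx) (abs_nonneg _)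
      _ ≤ _ := hmain
      _ = _ := by ring

/-- The `j`-th derivative of the `k`-th zonal polynomial. -/
noncomputable def zonalDeriv (d j k : ℕ) (x : ℝ) : ℝ := (derivative^[j] (zonal d k)).eval x

theorem hasDerivAt_zonalDeriv (d j k : ℕ) (x : ℝ) :
    HasDerivAt (zonalDeriv d j k) (zonalDeriv d (j + 1) k x) x := by
  have := (derivative^[j] (zonal d k)).hasDerivAt x
  rwa [← Function.iterate_succ_apply' (derivative : ℝ[X] → ℝ[X])] at this

/-- Two bounds compete: the size of both values, and the mean value inequality, which costs one
factor k + 1. Keeping their minimum is what later produces the sharp Hölder exponent. -/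
theorem zonalDeriv_sub_bound {d : ℕ} (hd : 1 ≤ d) {r : ℝ} (hr0 : 0 ≤ r) (hr : r < 1) (j : ℕ) :
    ∃ A : ℝ, 0 ≤ A ∧ ∀ k : ℕ, ∀ x y : ℝ, |x| ≤ r → |y| ≤ r →
      |zonalDeriv d j k y - zonalDeriv d j k x|
        ≤ A * ((k + 1 : ℝ) ^ ((j : ℝ) - d / 2) * min 1 ((k + 1) * |y - x|)) := by
  obtain ⟨A0, hA0, h0⟩ := zonal_iterate_derivative_bound hd hr0 hr j
  obtain ⟨A1, hA1, h1⟩ := zonal_iterate_derivative_bound hd hr0 hr (j + 1)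
  refine ⟨2 * A0 + A1, by positivity, fun k x y hx hy => ?_⟩
  have hk : (0 : ℝ) < k + 1 := by positivity
  set P := (k + 1 : ℝ) ^ ((j : ℝ) - d / 2) with hP
  have hP0 : 0 ≤ P := by positivity
  have e1 : |zonalDeriv d j k y - zonalDeriv d j k x| ≤ 2 * A0 * P :=
    (abs_sub _ _).trans (by
      have e3 : |zonalDeriv d j k x| ≤ A0 * P := h0 k x hx
      have e4 : |zonalDeriv d j k y| ≤ A0 * P := h0 k y hy
      linarith)
  have e2 : |zonalDeriv d j k y - zonalDeriv d j k x| ≤ A1 * (P * ((k + 1) * |y - x|)) := by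
    have := Convex.norm_image_sub_le_of_norm_hasDerivWithin_le (s := Icc (-r) r)
      (f := zonalDeriv d j k) (f' := zonalDeriv d (j + 1) k)
      (C := A1 * (k + 1 : ℝ) ^ (((j + 1 : ℕ) : ℝ) - d / 2))
      (fun t _ => (hasDerivAt_zonalDeriv d j k t).hasDerivWithinAt)
      (fun t ht => h1 k t (abs_le.mpr ht)) (convex_Icc _ _) (abs_le.mp hx) (abs_le.mp hy)
    rw [Real.norm_eq_abs, Real.norm_eq_abs] at this
    refine this.trans (le_of_eq ?_)
    have : (k + 1 : ℝ) ^ (((j + 1 : ℕ) : ℝ) - d / 2) = P * (k + 1) := by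
      rw [hP, ← Real.rpow_add_one hk.ne']; congr 1; push_cast; ring
    rw [this]; ring
  rcases le_total 1 ((k + 1) * |y - x|) with h | h
  · rw [min_eq_left h, mul_one]
    nlinarith [mul_nonneg hA1 hP0]
  · rw [min_eq_right h]
    refine e2.trans ?_
    gcongr
    linarith

/-- Mean value inequality for f(t) - t f'(x), whose derivative f'(t) - f'(x) is controlled by the
increment bound of order j + 1. -/
theorem zonalDeriv_slope_bound {d : ℕ} (hd : 1 ≤ d) {r : ℝ} (hr0 : 0 ≤ r) (hr : r < 1) (j : ℕ) :
    ∃ A : ℝ, 0 ≤ A ∧ ∀ k : ℕ, ∀ x y : ℝ, |x| ≤ r → |y| ≤ r → y ≠ x →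
      |(y - x)⁻¹ * (zonalDeriv d j k y - zonalDeriv d j k x) - zonalDeriv d (j + 1) k x|
        ≤ A * ((k + 1 : ℝ) ^ (((j + 1 : ℕ) : ℝ) - d / 2) * min 1 ((k + 1) * |y - x|)) := by
  obtain ⟨A, hA, h⟩ := zonalDeriv_sub_bound hd hr0 hr (j + 1)
  refine ⟨A, hA, fun k x y hx hy hxy => ?_⟩
  have hne : y - x ≠ 0 := sub_ne_zero.mpr hxy
  have := Convex.norm_image_sub_le_of_norm_hasDerivWithin_le (s := uIcc x y)
      (f := fun t => zonalDeriv d j k t - t * zonalDeriv d (j + 1) k x)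
      (f' := fun t => zonalDeriv d (j + 1) k t - zonalDeriv d (j + 1) k x)
      (C := A * ((k + 1 : ℝ) ^ (((j + 1 : ℕ) : ℝ) - d / 2) * min 1 ((k + 1) * |y - x|)))
      (fun t _ => ((hasDerivAt_zonalDeriv d j k t).sub
        (by simpa using (hasDerivAt_id t).mul_const (zonalDeriv d (j + 1) k x))).hasDerivWithinAt)
      (fun t ht => by
        have ht' : |t| ≤ r := by
          have := uIcc_subset_Icc (abs_le.mp hx) (abs_le.mp hy) ht
          exact abs_le.mpr this
        refine (h k x t hx ht').trans ?_
        have := abs_sub_left_of_mem_uIcc ht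
        gcongr) (convex_uIcc _ _) left_mem_uIcc right_mem_uIcc
  have e : (y - x)⁻¹ * (zonalDeriv d j k y - zonalDeriv d j k x) - zonalDeriv d (j + 1) k x
      = (y - x)⁻¹ * ((zonalDeriv d j k y - y * zonalDeriv d (j + 1) k x)
        - (zonalDeriv d j k x - x * zonalDeriv d (j + 1) k x)) := by
    field_simp; ring
  rw [e, abs_mul, abs_inv, inv_mul_le_iff₀ (abs_pos.mpr hne), mul_comm |y - x|]
  exact this

theorem zonalDeriv_bound {d : ℕ} (hd : 1 ≤ d) {r : ℝ} (hr0 : 0 ≤ r) (hr : r < 1) (j : ℕ) :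
    ∃ A : ℝ, 0 ≤ A ∧ ∀ k : ℕ, ∀ x : ℝ, |x| ≤ r →
      |zonalDeriv d j k x| ≤ A * (k + 1 : ℝ) ^ ((j : ℝ) - d / 2) :=
  zonal_iterate_derivative_bound hd hr0 hr j

end

/-! ### Summation over the degree in weighted ℓ_p -/

section

theorem one_add_rpow_ge {a x : ℝ} (ha : 0 < a) (hx0 : 0 ≤ x) (hx1 : x ≤ 1) :
    1 + a * x / 2 ≤ (1 + x) ^ a := by
  have hx : 0 < 1 + x := by linarith
  rw [Real.rpow_def_of_pos hx]
  have h1 := Real.one_sub_inv_le_log_of_pos hx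
  have h2 : x / 2 ≤ 1 - (1 + x)⁻¹ := by
    rw [le_sub_iff_add_le, ← le_sub_iff_add_le', inv_le_iff_one_le_mul₀ hx]
    nlinarith
  have h3 := Real.add_one_le_exp (Real.log (1 + x) * a)
  nlinarith

/-- Up to the factor a, t^a/(1+t^a) is a bounded primitive of t⁻¹ · t^a/(1+t^a)². For t = z h the
step from t to (1+1/z)t is the step from z to z + 1, so that telescoping can replace comparison with
an integral. -/
theorem rpow_logistic_increment {a t z : ℝ} (ha : 0 < a) (ht : 0 < t) (hz : 1 ≤ z) :
    a / 2 ^ (a + 1) * z⁻¹ * (t ^ a / (1 + t ^ a) ^ 2)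
      ≤ ((1 + z⁻¹) * t) ^ a / (1 + ((1 + z⁻¹) * t) ^ a) - t ^ a / (1 + t ^ a) := by
  have hz0 : 0 < z := by linarith
  have hzi : z⁻¹ ≤ 1 := inv_le_one_of_one_le₀ hz
  have hzi0 : 0 < z⁻¹ := inv_pos.mpr hz0
  have h1 := one_add_rpow_ge ha hzi0.le hzi
  have h2 : (1 + z⁻¹) ^ a ≤ 2 ^ a := by gcongr; linarith
  have h3 : (1 : ℝ) ≤ 2 ^ a := Real.one_le_rpow one_le_two ha.le
  rw [Real.mul_rpow (by positivity) ht.le, Real.rpow_add_one two_ne_zero]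
  have hu : 0 < t ^ a := by positivity
  set u := t ^ a
  set q := (1 + z⁻¹) ^ a
  set T := (2 : ℝ) ^ a
  have hT : 0 < T := by positivity
  have hq : 0 < q := by positivity
  have e1 : q * u / (1 + q * u) - u / (1 + u) = (q - 1) * u / ((1 + u) * (1 + q * u)) := by
    field_simp; ring
  have e2 : a / (T * 2) * z⁻¹ * (u / (1 + u) ^ 2) = (a * z⁻¹ / 2) * u / ((1 + u) * (T * (1 + u))) := by
    field_simp
  rw [e1, e2]
  have hq1 : 0 ≤ q - 1 := by
    have : 0 < a * z⁻¹ := by positivity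
    linarith
  gcongr
  · linarith
  · nlinarith

/-- The conditions on a make the left side at most t^a for t ≤ 1 and at most t^(-a) for t ≥ 1, which
is the behaviour of t^a/(1+t^a)² at both ends. -/
theorem rpow_mul_min_le {a s P t : ℝ} (ha : 0 < a) (h1 : a ≤ P * (1 - s))
    (h2 : a ≤ P * s) (ht : 0 < t) :
    t ^ (-(s * P)) * min 1 t ^ P ≤ 4 * (t ^ a / (1 + t ^ a) ^ 2) := by
  have hu : 0 < t ^ a := by positivity
  rw [← mul_div_assoc, le_div_iff₀ (by positivity)]
  rcases le_total t 1 with h | h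
  · rw [min_eq_right h, ← Real.rpow_add ht]
    have e1 : t ^ (-(s * P) + P) ≤ t ^ a := Real.rpow_le_rpow_of_exponent_ge ht h (by linarith)
    have e2 : t ^ a ≤ 1 := Real.rpow_le_one ht.le h ha.le
    calc t ^ (-(s * P) + P) * (1 + t ^ a) ^ 2 ≤ t ^ a * (1 + 1) ^ 2 := by gcongr
      _ = 4 * t ^ a := by ring
  · rw [min_eq_left h, Real.one_rpow, mul_one]
    have e1 : t ^ (-(s * P)) ≤ (t ^ a)⁻¹ := by
      rw [← Real.rpow_neg ht.le]
      exact Real.rpow_le_rpow_of_exponent_le h (by linarith)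
    have e2 : 1 ≤ t ^ a := Real.one_le_rpow h ha.le
    calc t ^ (-(s * P)) * (1 + t ^ a) ^ 2 ≤ (t ^ a)⁻¹ * (t ^ a + t ^ a) ^ 2 := by gcongr
      _ = 4 * t ^ a := by field_simp; ring

/-- For s > 0 this is the convergence of ∫ t^(-1-sP) min(1, t)^P dt at 0 and at ∞, with t = (k+1)h,
a substitution that releases the factor h^(sP). The value s = γ is allowed, which gives the exact
Hölder exponent. For s = 0 the series without the minimum converges, as γ > 0. -/
theorem exists_sum_rpow_mul_min_le {P s γ : ℝ} (hP : 0 < P) (hs0 : 0 ≤ s) (hs1 : s < 1)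
    (hγ : 0 < γ) (hsγ : s ≤ γ) :
    ∃ M : ℝ, 0 ≤ M ∧ ∀ h : ℝ, 0 ≤ h → ∀ n : ℕ,
      ∑ k ∈ Finset.range n, (k + 1 : ℝ) ^ (-1 - γ * P) * min 1 ((k + 1) * h) ^ P
        ≤ M * (h ^ s) ^ P := by
  rcases hs0.eq_or_lt with rfl | hs
  · have hsum : Summable fun k : ℕ => (k + 1 : ℝ) ^ (-1 - γ * P) := by
      have := (summable_nat_add_iff 1).mpr (Real.summable_nat_rpow (p := -1 - γ * P)
        |>.mpr (by nlinarith))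
      simpa using this
    refine ⟨∑' k : ℕ, (k + 1 : ℝ) ^ (-1 - γ * P), tsum_nonneg fun k => by positivity,
      fun h hh n => ?_⟩
    rw [Real.rpow_zero, Real.one_rpow, mul_one]
    refine le_trans (Finset.sum_le_sum fun k _ => ?_) (hsum.sum_le_tsum (Finset.range n)
      fun k _ => by positivity)
    refine mul_le_of_le_one_right (by positivity) (Real.rpow_le_one ?_ (min_le_left _ _) hP.le)
    positivity
  · set a := min (P * (1 - s)) (P * s) with ha'
    have ha : 0 < a := lt_min (mul_pos hP (by linarith)) (mul_pos hP hs)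
    refine ⟨4 * (2 ^ (a + 1) / a), by positivity, fun h hh n => ?_⟩
    rcases hh.eq_or_lt with rfl | hh
    · simp [Real.zero_rpow hP.ne', Real.zero_rpow hs.ne']
    -- Each term of the sum is dominated by a constant multiple of an increment of G, and G takes
    -- values in [0, 1].
    set G : ℕ → ℝ := fun k => ((k + 1 : ℝ) * h) ^ a / (1 + ((k + 1 : ℝ) * h) ^ a) with hG
    have hterm : ∀ k : ℕ, (k + 1 : ℝ) ^ (-1 - γ * P) * min 1 ((k + 1) * h) ^ P
        ≤ 4 * (2 ^ (a + 1) / a) * (h ^ s) ^ P * (G (k + 1) - G k) := by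
      intro k
      have hz : (1 : ℝ) ≤ k + 1 := by linarith [k.cast_nonneg (α := ℝ)]
      have hz0 : (0 : ℝ) < k + 1 := by positivity
      set z : ℝ := k + 1 with hzdef
      have ht : 0 < z * h := by positivity
      have e1 := rpow_logistic_increment ha ht hz
      have e2 := rpow_mul_min_le (s := s) ha (min_le_left _ _) (min_le_right _ _) ht
      have e3 : (1 + z⁻¹) * (z * h) = ((k + 1 : ℕ) + 1 : ℝ) * h := by
        push_cast; rw [← hzdef]; field_simp
      rw [e3] at e1
      have e4 : z ^ (-1 - γ * P) ≤ z ^ (-1 - s * P) :=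
        Real.rpow_le_rpow_of_exponent_le hz (by nlinarith)
      have e5 : z ^ (-1 - s * P) = (h ^ s) ^ P * z⁻¹ * (z * h) ^ (-(s * P)) := by
        rw [Real.mul_rpow hz0.le hh.le, ← Real.rpow_mul hh.le, sub_eq_add_neg,
          Real.rpow_add hz0, Real.rpow_neg_one, Real.rpow_neg hh.le]
        field_simp
      have hm : 0 ≤ min 1 (z * h) ^ P := by positivity
      calc z ^ (-1 - γ * P) * min 1 (z * h) ^ P
          ≤ (h ^ s) ^ P * z⁻¹ * (z * h) ^ (-(s * P)) * min 1 (z * h) ^ P := by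
            rw [← e5]; gcongr
        _ = (h ^ s) ^ P * z⁻¹ * ((z * h) ^ (-(s * P)) * min 1 (z * h) ^ P) := by ring
        _ ≤ (h ^ s) ^ P * z⁻¹ * (4 * ((z * h) ^ a / (1 + (z * h) ^ a) ^ 2)) := by gcongr
        _ = 4 * (2 ^ (a + 1) / a) * (h ^ s) ^ P
            * (a / 2 ^ (a + 1) * z⁻¹ * ((z * h) ^ a / (1 + (z * h) ^ a) ^ 2)) := by
            have : (0 : ℝ) < 2 ^ (a + 1) := by positivity
            field_simp
        _ ≤ _ := by
            refine mul_le_mul_of_nonneg_left e1 (by positivity)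
    refine (Finset.sum_le_sum fun k _ => hterm k).trans ?_
    rw [← Finset.mul_sum, Finset.sum_range_sub]
    have hGn : G n ≤ 1 := by
      simp only [hG]
      have : (0 : ℝ) ≤ ((n + 1 : ℝ) * h) ^ a := by positivity
      rw [div_le_one (by positivity)]
      linarith
    have hG0 : 0 ≤ G 0 := by simp only [hG]; positivity
    refine mul_le_of_le_one_right (by positivity) (by linarith)

open Classical in
/-- The norm of a sequence in the weighted `ℓ_p`-space with weight `w`; for `p = ∞` the weight
plays no role. -/
noncomputable def weightedNorm (w : ℕ → ℝ) (p : ℝ≥0∞) (c : ℕ → ℂ) : ℝ≥0∞ :=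
  if p = ∞ then ⨆ k, ‖c k‖ₑ
  else (∑' k, ENNReal.ofReal (w k) * ‖c k‖ₑ ^ p.toReal) ^ (1 / p.toReal)

/-- With γ = β - (d+1)/p and `mult` of order k^d, the exponent of k + 1 in the p-th power of the
norm is d - βp = -1 - γp. For p = ∞ it is enough that min(1, t) ≤ t^s. -/
theorem exists_weightedNorm_mult_le {d : ℕ} (hd : 1 ≤ d) {p : ℝ≥0∞} (hp : p ≠ 0) {β s : ℝ}
    (hβ : 0 < β - (d + 1) * (p⁻¹).toReal) (hs0 : 0 ≤ s) (hs1 : s < 1)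
    (hs : s ≤ β - (d + 1) * (p⁻¹).toReal) {A : ℝ} (hA : 0 ≤ A) :
    ∃ M : ℝ≥0, ∀ h : ℝ, 0 ≤ h → ∀ c : ℕ → ℂ,
      (∀ k : ℕ, ‖c k‖ ≤ A * ((k + 1 : ℝ) ^ (-β) * min 1 ((k + 1) * h))) →
        weightedNorm (mult d) p c ≤ M * ENNReal.ofReal (h ^ s) := by
  by_cases htop : p = ∞
  · subst htop
    simp only [ENNReal.inv_top, ENNReal.toReal_zero, mul_zero, sub_zero] at hβ hs
    refine ⟨A.toNNReal, fun h hh c hc => ?_⟩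
    rw [weightedNorm, if_pos rfl]
    refine iSup_le fun k => ?_
    have hk : (1 : ℝ) ≤ k + 1 := by linarith [k.cast_nonneg (α := ℝ)]
    have hk0 : (0 : ℝ) < k + 1 := by positivity
    have h1 : (k + 1 : ℝ) ^ (-β) * min 1 ((k + 1) * h) ≤ h ^ s := by
      have e1 : min 1 ((k + 1) * h) ≤ ((k + 1) * h) ^ s := by
        rcases le_total 1 ((k + 1) * h) with h3 | h3
        · rw [min_eq_left h3]; exact Real.one_le_rpow h3 hs0
        · rw [min_eq_right h3]
          exact Real.self_le_rpow_of_le_one (by positivity) h3 hs1.le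
      calc (k + 1 : ℝ) ^ (-β) * min 1 ((k + 1) * h)
          ≤ (k + 1 : ℝ) ^ (-s) * ((k + 1) * h) ^ s := by
            gcongr
        _ = h ^ s := by
            rw [Real.mul_rpow hk0.le hh, ← mul_assoc, ← Real.rpow_add hk0]; simp
    have h2 : ‖c k‖ₑ = ENNReal.ofReal ‖c k‖ := (ofReal_norm _).symm
    have h3 : (A.toNNReal : ℝ≥0∞) = ENNReal.ofReal A := rfl
    rw [h2, h3, ← ENNReal.ofReal_mul hA]
    refine ENNReal.ofReal_le_ofReal ((hc k).trans ?_)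
    gcongr
  · have hP : 0 < p.toReal := ENNReal.toReal_pos hp htop
    set P := p.toReal with hPdef
    rw [ENNReal.toReal_inv] at hβ hs
    set γ := β - (d + 1) * P⁻¹ with hγ
    obtain ⟨M, hM, hsum⟩ := exists_sum_rpow_mul_min_le hP hs0 hs1 hβ hs
    refine ⟨((2 * A ^ P * M) ^ (1 / P)).toNNReal, fun h hh c hc => ?_⟩
    rw [weightedNorm, if_neg htop, ← hPdef]
    have hterm : ∀ k : ℕ, ENNReal.ofReal (mult d k) * ‖c k‖ₑ ^ P ≤ ENNReal.ofReal
        (2 * A ^ P * ((k + 1 : ℝ) ^ (-1 - γ * P) * min 1 ((k + 1) * h) ^ P)) := by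
      intro k
      have hk0 : (0 : ℝ) < k + 1 := by positivity
      rw [← ofReal_norm, ENNReal.ofReal_rpow_of_nonneg (norm_nonneg _) hP.le,
        ← ENNReal.ofReal_mul (mult_pos hd k).le]
      refine ENNReal.ofReal_le_ofReal ?_
      have hm : 0 ≤ min 1 ((k + 1 : ℝ) * h) := by positivity
      calc mult d k * ‖c k‖ ^ P
          ≤ (2 * (k + 1) ^ d) * (A * ((k + 1 : ℝ) ^ (-β) * min 1 ((k + 1) * h))) ^ P := by
            gcongr
            · exact mult_le hd k
            · exact hc k
        _ = _ := by
            rw [Real.mul_rpow hA (by positivity), Real.mul_rpow (by positivity) hm,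
              ← Real.rpow_mul hk0.le, ← Real.rpow_natCast (k + 1 : ℝ) d]
            have : (k + 1 : ℝ) ^ (-1 - γ * P) = (k + 1 : ℝ) ^ (d : ℝ) * (k + 1 : ℝ) ^ (-β * P) := by
              rw [← Real.rpow_add hk0]; congr 1; rw [hγ]; field_simp; ring
            rw [this]; ring
    have htot : ∑' k, ENNReal.ofReal (mult d k) * ‖c k‖ₑ ^ P
        ≤ ENNReal.ofReal (2 * A ^ P * (M * (h ^ s) ^ P)) := by
      refine (ENNReal.tsum_le_tsum hterm).trans (ENNReal.tsum_le_of_sum_range_le fun n => ?_)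
      rw [← ENNReal.ofReal_sum_of_nonneg fun k _ => by positivity, ← Finset.mul_sum]
      refine ENNReal.ofReal_le_ofReal ?_
      gcongr
      exact hsum h hh n
    refine (ENNReal.rpow_le_rpow htot (by positivity)).trans (le_of_eq ?_)
    have h3 : (((2 * A ^ P * M) ^ (1 / P)).toNNReal : ℝ≥0∞)
        = ENNReal.ofReal ((2 * A ^ P * M) ^ (1 / P)) := rfl
    rw [h3, ← ENNReal.ofReal_mul (by positivity),
      ENNReal.ofReal_rpow_of_nonneg (by positivity) (by positivity)]
    congr 1
    rw [← mul_assoc, Real.mul_rpow (by positivity) (by positivity), ← Real.rpow_mul (by positivity),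
      mul_one_div_cancel hP.ne', Real.rpow_one]

end

/-! ### Schatten norms of combinations of orthogonal projections -/

section

section Diagonal

variable {H : Type*} [NormedAddCommGroup H] [InnerProductSpace ℂ H]

theorem singularNumber_le_enorm (A : H →L[ℂ] H) (k : ℕ) : singularNumber A k ≤ ‖A‖ₑ := by
  refine (iInf_le _ ⟨0, by simp⟩).trans ?_
  simp

theorem finite_lt_norm_of_tendsto_zero {c : ℕ → ℂ} (hc : Tendsto c cofinite (𝓝 0)) {t : ℝ} (ht : 0 < t) :
    {k | t < ‖c k‖}.Finite := by
  have h := (tendsto_zero_iff_norm_tendsto_zero.mp hc).eventually (gt_mem_nhds ht)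
  rw [eventually_cofinite] at h
  exact h.subset fun k hk => by simpa using le_of_lt hk

/-- A sequence of pairwise orthogonal finite-rank orthogonal projections, with bounds `r k` for the
ranks. -/
structure IsProjFamily (E : ℕ → H →L[ℂ] H) (r : ℕ → ℕ) : Prop where
  idem : ∀ k f, E k (E k f) = E k f
  orth : ∀ k l, k ≠ l → ∀ f, E k (E l f) = 0
  symm : ∀ k f g, inner ℂ (E k f) g = inner ℂ f (E k g)
  rank_le : ∀ k, LinearMap.rank (E k : H →ₗ[ℂ] H) ≤ (r k : Cardinal)

namespace IsProjFamily

variable {E : ℕ → H →L[ℂ] H} {r : ℕ → ℕ} (hE : IsProjFamily E r)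
include hE

theorem inner_eq_zero {k l : ℕ} (h : k ≠ l) (f g : H) : inner ℂ (E k f) (E l g) = 0 := by
  rw [hE.symm, hE.orth k l h, inner_zero_right]

theorem norm_sum_sq (F : Finset ℕ) (c : ℕ → ℂ) (f : H) :
    ‖∑ k ∈ F, c k • E k f‖ ^ 2 = ∑ k ∈ F, ‖c k‖ ^ 2 * ‖E k f‖ ^ 2 := by
  classical
  induction F using Finset.induction_on with
  | empty => simp
  | insert a F ha ih =>
    rw [Finset.sum_insert ha, Finset.sum_insert ha, ← ih, pow_two, pow_two ‖∑ k ∈ F, _‖,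
      norm_add_sq_eq_norm_sq_add_norm_sq_of_inner_eq_zero (𝕜 := ℂ), norm_smul]
    · ring
    · rw [inner_sum]
      refine Finset.sum_eq_zero fun k hk => ?_
      rw [inner_smul_left, inner_smul_right, hE.inner_eq_zero (by rintro rfl; exact ha hk)]
      simp

/-- Bessel's inequality: the left side is the inner product of Σ E_k f with f, and it is also the
squared norm of Σ E_k f. -/
theorem sum_norm_sq_le (F : Finset ℕ) (f : H) : ∑ k ∈ F, ‖E k f‖ ^ 2 ≤ ‖f‖ ^ 2 := by
  have h1 := hE.norm_sum_sq F (fun _ => 1) f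
  simp only [one_smul, norm_one, one_pow, one_mul] at h1
  have h2 : ((∑ k ∈ F, ‖E k f‖ ^ 2 : ℝ) : ℂ) = inner ℂ (∑ k ∈ F, E k f) f := by
    rw [sum_inner]
    push_cast
    refine Finset.sum_congr rfl fun k _ => ?_
    rw [← hE.idem k f, hE.symm k (E k f) f, inner_self_eq_norm_sq_to_K, hE.idem]
    rfl
  have h3 : ∑ k ∈ F, ‖E k f‖ ^ 2 ≤ ‖∑ k ∈ F, E k f‖ * ‖f‖ := by
    refine le_trans ?_ (norm_inner_le_norm (𝕜 := ℂ) _ _)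
    rw [← h2, Complex.norm_real]
    exact le_abs_self _
  rw [← h1] at h3 ⊢
  have : ‖∑ k ∈ F, E k f‖ ≤ ‖f‖ := by
    rcases (norm_nonneg (∑ k ∈ F, E k f)).eq_or_lt with h | h
    · rw [← h]; exact norm_nonneg f
    · rw [pow_two] at h3; exact le_of_mul_le_mul_left h3 h
  gcongr

theorem norm_sum_le (F : Finset ℕ) {c : ℕ → ℂ} {M : ℝ} (hM : 0 ≤ M) (hc : ∀ k ∈ F, ‖c k‖ ≤ M) :
    ‖∑ k ∈ F, c k • E k‖ ≤ M := by
  refine ContinuousLinearMap.opNorm_le_bound _ hM fun f => ?_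
  refine abs_le_of_sq_le_sq' ?_ (by positivity) |>.2
  have : (∑ k ∈ F, c k • E k) f = ∑ k ∈ F, c k • E k f := by simp
  rw [this, hE.norm_sum_sq, mul_pow]
  calc ∑ k ∈ F, ‖c k‖ ^ 2 * ‖E k f‖ ^ 2 ≤ ∑ k ∈ F, M ^ 2 * ‖E k f‖ ^ 2 :=
        Finset.sum_le_sum fun k hk => by have := hc k hk; gcongr
    _ = M ^ 2 * ∑ k ∈ F, ‖E k f‖ ^ 2 := by rw [Finset.mul_sum]
    _ ≤ _ := by gcongr; exact hE.sum_norm_sq_le F f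

theorem summable_apply [CompleteSpace H] (f : H) : Summable fun k => E k f := by
  rw [summable_iff_vanishing_norm]
  intro ε hε
  have hs : Summable fun k => ‖E k f‖ ^ 2 :=
    summable_of_sum_le (fun k => by positivity) (fun F => hE.sum_norm_sq_le F f)
  obtain ⟨s, hs⟩ := summable_iff_vanishing_norm.mp hs (ε ^ 2) (by positivity)
  refine ⟨s, fun t ht => ?_⟩
  have h1 := hs t ht
  have h2 := hE.norm_sum_sq t (fun _ => 1) f
  simp only [one_smul, norm_one, one_pow, one_mul] at h2
  rw [← h2, Real.norm_of_nonneg (by positivity)] at h1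
  exact lt_of_pow_lt_pow_left₀ 2 hε.le h1

theorem rank_sum_le (F : Finset ℕ) (c : ℕ → ℂ) :
    LinearMap.rank ((∑ k ∈ F, c k • E k : H →L[ℂ] H) : H →ₗ[ℂ] H)
      ≤ ((∑ k ∈ F, r k : ℕ) : Cardinal) := by
  have h : ((∑ k ∈ F, c k • E k : H →L[ℂ] H) : H →ₗ[ℂ] H)
      = ∑ k ∈ F, (c k • E k : H →L[ℂ] H).toLinearMap := by
    ext f; simp
  rw [h]
  refine (LinearMap.rank_finsetSum_le _ _).trans ?_
  push_cast
  refine Finset.sum_le_sum fun k _ => le_trans ?_ (hE.rank_le k)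
  refine Submodule.rank_mono ?_
  rintro _ ⟨f, rfl⟩
  exact ⟨c k • f, by simp⟩

variable [CompleteSpace H]

theorem summable_smul {c : ℕ → ℂ} (hc : Tendsto c cofinite (𝓝 0)) :
    Summable fun k => c k • E k := by
  rw [summable_iff_vanishing_norm]
  intro ε hε
  have h := (tendsto_zero_iff_norm_tendsto_zero.mp hc).eventually (gt_mem_nhds (half_pos hε))
  rw [eventually_cofinite] at h
  refine ⟨h.toFinset, fun t ht => lt_of_le_of_lt (hE.norm_sum_le t (half_pos hε).le fun k hk => ?_)
    (half_lt_self hε)⟩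
  have h1 := Finset.disjoint_left.mp ht hk
  rw [Finite.mem_toFinset] at h1
  exact (not_not.mp h1).le

theorem norm_tsum_le {c : ℕ → ℂ} (hc : Tendsto c cofinite (𝓝 0)) {M : ℝ} (hM : 0 ≤ M)
    (hcM : ∀ k, ‖c k‖ ≤ M) : ‖∑' k, c k • E k‖ ≤ M :=
  le_of_tendsto ((hE.summable_smul hc).hasSum.norm)
    (Eventually.of_forall fun F => hE.norm_sum_le F hM fun k _ => hcM k)

/-- The partial sum over F is an admissible approximant of rank at most m, and the remainder has all
its coefficients bounded by t. -/
theorem singularNumber_tsum_le {c : ℕ → ℂ} (hc : Tendsto c cofinite (𝓝 0)) {t : ℝ} (ht : 0 ≤ t)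
    (F : Finset ℕ) (hF : ∀ k ∉ F, ‖c k‖ ≤ t) {m : ℕ} (hm : ∑ k ∈ F, r k ≤ m) :
    singularNumber (∑' k, c k • E k) m ≤ ENNReal.ofReal t := by
  refine (iInf_le _ ⟨∑ k ∈ F, c k • E k, (hE.rank_sum_le F c).trans (by exact_mod_cast hm)⟩).trans ?_
  classical
  have hs := hE.summable_smul hc
  have h2 : ∑' k, c k • E k - ∑ k ∈ F, c k • E k
      = ∑' k, (if k ∈ F then 0 else c k) • E k := by
    have h3 : HasSum (fun k => (if k ∈ F then c k else 0) • E k) (∑ k ∈ F, c k • E k) := by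
      have : HasSum (fun k => (if k ∈ F then c k else 0) • E k)
          (∑ k ∈ F, (if k ∈ F then c k else 0) • E k) :=
        hasSum_sum_of_ne_finset_zero fun k hk => by simp [hk]
      rwa [Finset.sum_congr rfl (fun k hk => by rw [if_pos hk])] at this
    rw [← (hs.hasSum.sub h3).tsum_eq]
    congr 1
    ext1 k
    split_ifs <;> simp
  rw [← ofReal_norm]
  refine ENNReal.ofReal_le_ofReal ?_
  simp only
  rw [h2]
  refine hE.norm_tsum_le ?_ ht fun k => ?_
  · refine squeeze_zero_norm (fun k => ?_) (tendsto_zero_iff_norm_tendsto_zero.mp hc)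
    split_ifs <;> simp
  · split_ifs with h
    · simpa using ht
    · exact hF k h

/-- With F the set where |c_k| > t, all singular numbers of index at least Σ_F r_k are at most t. -/
theorem count_singularNumber_le {c : ℕ → ℂ} (hc : Tendsto c cofinite (𝓝 0)) {w : ℕ → ℝ}
    (hw : ∀ k, (r k : ℝ) ≤ w k) {t : ℝ} (ht : 0 < t) :
    Measure.count {m | t < (singularNumber (∑' k, c k • E k) m).toReal}
      ≤ (Measure.count.withDensity fun k => ENNReal.ofReal (w k)) {k | t < ‖c k‖} := by
  have hfin := finite_lt_norm_of_tendsto_zero hc ht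
  set F := hfin.toFinset with hF
  have h1 : {m | t < (singularNumber (∑' k, c k • E k) m).toReal}
      ⊆ (Finset.range (∑ k ∈ F, r k) : Set ℕ) := by
    intro m hm
    simp only [Finset.coe_range, mem_Iio]
    by_contra! hcon
    have := hE.singularNumber_tsum_le hc ht.le F (fun k hk => by simpa [hF] using hk) hcon
    exact absurd (ENNReal.toReal_le_of_le_ofReal ht.le this) (not_le.mpr hm)
  refine (measure_mono h1).trans ?_
  rw [Measure.count_apply_finset, withDensity_apply _ (by measurability), Finset.card_range,
    ← hfin.coe_toFinset, lintegral_finset]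
  simp only [Measure.count_singleton, mul_one]
  push_cast
  refine Finset.sum_le_sum fun k _ => ?_
  rw [← ENNReal.ofReal_natCast]
  exact ENNReal.ofReal_le_ofReal (hw k)

/-- For finite p, the layer-cake formula writes both sides through distribution functions, which the
preceding count compares. No decreasing rearrangement of the |c_k| is needed. -/
theorem schattenNorm_tsum_le {c : ℕ → ℂ} (hc : Tendsto c cofinite (𝓝 0)) {w : ℕ → ℝ}
    (hw : ∀ k, (r k : ℝ) ≤ w k) {p : ℝ≥0∞} (hp : p ≠ 0) :
    schattenNorm p (∑' k, c k • E k) ≤ weightedNorm w p c := by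
  rw [schattenNorm, weightedNorm]
  split_ifs with htop
  · refine iSup_le fun m => (singularNumber_le_enorm _ m).trans ?_
    by_cases hinf : ⨆ k, ‖c k‖ₑ = ∞
    · rw [hinf]; exact le_top
    · rw [← ENNReal.ofReal_toReal hinf, ← ofReal_norm]
      refine ENNReal.ofReal_le_ofReal (hE.norm_tsum_le hc ENNReal.toReal_nonneg fun k => ?_)
      rw [← toReal_enorm]
      exact ENNReal.toReal_mono hinf (le_iSup (fun k => ‖c k‖ₑ) k)
  · have hP : 0 < p.toReal := ENNReal.toReal_pos hp htop
    refine ENNReal.rpow_le_rpow ?_ (by positivity)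
    set A := ∑' k, c k • E k with hA
    have h1 := lintegral_rpow_eq_lintegral_meas_lt_mul (Measure.count (α := ℕ))
      (f := fun m => (singularNumber A m).toReal)
      (Eventually.of_forall fun m => ENNReal.toReal_nonneg)
      (measurable_of_countable _).aemeasurable hP
    have h2 := lintegral_rpow_eq_lintegral_meas_lt_mul
      ((Measure.count (α := ℕ)).withDensity fun k => ENNReal.ofReal (w k))
      (f := fun k => ‖c k‖) (Eventually.of_forall fun m => norm_nonneg _)
      (measurable_of_countable _).aemeasurable hP
    rw [lintegral_count] at h1
    rw [lintegral_withDensity_eq_lintegral_mul _ (measurable_of_countable _)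
      (measurable_of_countable _), lintegral_count] at h2
    have e1 : ∑' m, singularNumber A m ^ p.toReal
        = ∑' m, ENNReal.ofReal ((singularNumber A m).toReal ^ p.toReal) := by
      congr 1; ext1 m
      have : singularNumber A m ≠ ∞ := ((singularNumber_le_enorm A m).trans_lt enorm_lt_top).ne
      rw [← ENNReal.ofReal_rpow_of_nonneg ENNReal.toReal_nonneg hP.le, ENNReal.ofReal_toReal this]
    have e2 : ∑' k, ENNReal.ofReal (w k) * ‖c k‖ₑ ^ p.toReal
        = ∑' k, ((fun k => ENNReal.ofReal (w k)) * fun k => ENNReal.ofReal (‖c k‖ ^ p.toReal)) k := by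
      congr 1; ext1 k
      rw [Pi.mul_apply, ← ENNReal.ofReal_rpow_of_nonneg (norm_nonneg _) hP.le, ofReal_norm]
    rw [e1, e2, h1, h2]
    gcongr ENNReal.ofReal _ * ?_
    refine setLIntegral_mono' measurableSet_Ioi fun t ht => ?_
    exact mul_le_mul_left (hE.count_singularNumber_le hc hw ht) _

theorem isCompactOperator_tsum {c : ℕ → ℂ} (hc : Tendsto c cofinite (𝓝 0)) :
    IsCompactOperator (∑' k, c k • E k : H →L[ℂ] H) := by
  have hcomp : ∀ k, IsCompactOperator (E k) := by
    intro k
    have hfd : FiniteDimensional ℂ (LinearMap.range (E k : H →ₗ[ℂ] H)) :=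
      Module.rank_lt_aleph0_iff.mp ((hE.rank_le k).trans_lt (Cardinal.natCast_lt_aleph0))
    have h1 : IsCompactOperator (id : LinearMap.range (E k : H →ₗ[ℂ] H) → _) :=
      (isCompactOperator_id_iff_finiteDimensional (𝕜 := ℂ)).mpr hfd
    have h2 := (h1.comp_clm ((E k).codRestrict (LinearMap.range (E k : H →ₗ[ℂ] H))
      fun f => ⟨f, rfl⟩)).clm_comp (Submodule.subtypeL _)
    exact h2
  refine isCompactOperator_of_tendsto (hE.summable_smul hc).hasSum
    (Eventually.of_forall fun F => ?_)
  refine Submodule.sum_mem (compactOperator (RingHom.id ℂ) H H) (t := F)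
    (f := fun k => c k • E k) fun k _ => Submodule.smul_mem _ _ (hcomp k)

end IsProjFamily

/-- Only the zero operator has rank 0, so the singular number of index 0 is the operator norm. -/
theorem enorm_le_schattenNorm {p : ℝ≥0∞} (hp : p ≠ 0) (B : H →L[ℂ] H) :
    ‖B‖ₑ ≤ schattenNorm p B := by
  have h0 : ‖B‖ₑ ≤ singularNumber B 0 := by
    refine le_iInf fun ⟨F, hF⟩ => ?_
    have h1 : LinearMap.range (F : H →ₗ[ℂ] H) = ⊥ := by
      rw [← Submodule.rank_eq_zero]
      simpa using hF
    have h2 : F = 0 := by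
      ext f
      have : F f ∈ LinearMap.range (F : H →ₗ[ℂ] H) := ⟨f, rfl⟩
      rw [h1] at this
      simpa using this
    simp [h2]
  rw [schattenNorm]
  split_ifs with htop
  · exact h0.trans (le_iSup (singularNumber B) 0)
  · have hP : 0 < p.toReal := ENNReal.toReal_pos hp htop
    rw [one_div, ENNReal.le_rpow_inv_iff hP]
    refine le_trans ?_ (ENNReal.le_tsum 0)
    exact ENNReal.rpow_le_rpow h0 hP.le

end Diagonal

end

/-! ### Reflections, rotations and the double cosets of SO(n-1) -/

section

section Householder

variable {n : ℕ}

/-- The matrix of the reflection in the hyperplane orthogonal to the unit vector `v`. -/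
def householder (v : Fin n → ℝ) : Matrix (Fin n) (Fin n) ℝ := 1 - (2 : ℝ) • Matrix.vecMulVec v v

theorem householder_mulVec (v w : Fin n → ℝ) :
    householder v *ᵥ w = w - (2 * (v ⬝ᵥ w)) • v := by
  rw [householder, Matrix.sub_mulVec, Matrix.one_mulVec, Matrix.smul_mulVec,
    Matrix.vecMulVec_mulVec]
  ext i
  simp
  ring

theorem householder_transpose (v : Fin n → ℝ) : (householder v)ᵀ = householder v := by
  rw [householder, Matrix.transpose_sub, Matrix.transpose_one, Matrix.transpose_smul,
    Matrix.transpose_vecMulVec]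

theorem householder_mul_self {v : Fin n → ℝ} (hv : v ⬝ᵥ v = 1) :
    householder v * householder v = 1 := by
  refine Matrix.ext_of_mulVec_single fun i => ?_
  rw [← Matrix.mulVec_mulVec, householder_mulVec, householder_mulVec, Matrix.one_mulVec,
    dotProduct_sub, dotProduct_smul, hv]
  ext j
  simp
  ring

theorem householder_det {v : Fin n → ℝ} (hv : v ⬝ᵥ v = 1) : (householder v).det = -1 := by
  have h : householder v = 1 + Matrix.replicateCol Unit ((-2 : ℝ) • v) * Matrix.replicateRow Unit v := by
    rw [householder, sub_eq_add_neg, ← Matrix.vecMulVec_eq, Matrix.smul_vecMulVec, neg_smul]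
  rw [h, Matrix.det_one_add_replicateCol_mul_replicateRow, dotProduct_smul, hv]
  norm_num

/-- The product of two reflections. -/
def reflPair (v w : Fin n → ℝ) (hv : v ⬝ᵥ v = 1) (hw : w ⬝ᵥ w = 1) : SO n :=
  ⟨householder v * householder w, by
    rw [Matrix.mem_specialOrthogonalGroup_iff, Matrix.mem_orthogonalGroup_iff, Matrix.det_mul,
      householder_det hv, householder_det hw, Matrix.transpose_mul, householder_transpose,
      householder_transpose, Matrix.mul_assoc, ← Matrix.mul_assoc (householder w),
      householder_mul_self hw, Matrix.one_mul, householder_mul_self hv]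
    norm_num⟩

theorem reflPair_mulVec (v w : Fin n → ℝ) (hv : v ⬝ᵥ v = 1) (hw : w ⬝ᵥ w = 1) (x : Fin n → ℝ) :
    (reflPair v w hv hw).1 *ᵥ x = householder v *ᵥ (householder w *ᵥ x) := by
  rw [Matrix.mulVec_mulVec]; rfl

theorem householder_mulVec_of_orthogonal {v x : Fin n → ℝ} (h : v ⬝ᵥ x = 0) :
    householder v *ᵥ x = x := by
  rw [householder_mulVec, h]; simp

theorem SO_mulVec_dotProduct (g : SO n) (x y : Fin n → ℝ) :
    (g.1 *ᵥ x) ⬝ᵥ (g.1 *ᵥ y) = x ⬝ᵥ y := by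
  have h := (Matrix.mem_orthogonalGroup_iff' (Fin n) ℝ).mp
    (Matrix.mem_specialOrthogonalGroup_iff.mp g.2).1
  rw [Matrix.dotProduct_mulVec, Matrix.vecMul_mulVec, h, Matrix.vecMul_one]

theorem SO_inv_val (g : SO n) : (g⁻¹).1 = (g.1)ᵀ := rfl

theorem SO_inv_apply (g : SO n) (i j : Fin n) : (g⁻¹).1 i j = g.1 j i := rfl

theorem SO_col_sum_sq (g : SO n) (j : Fin n) : ∑ i, g.1 i j ^ 2 = 1 := by
  have h := SO_mulVec_dotProduct g (Pi.single j 1) (Pi.single j 1)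
  simp only [Matrix.mulVec_single_one, single_one_dotProduct, Pi.single_eq_same] at h
  rw [← h]
  simp [dotProduct, pow_two]

theorem SO_abs_apply_le_one (g : SO n) (i j : Fin n) : |g.1 i j| ≤ 1 := by
  rw [abs_le_one_iff_mul_self_le_one, ← pow_two, ← SO_col_sum_sq g j]
  exact Finset.single_le_sum (f := fun i => g.1 i j ^ 2) (fun i _ => sq_nonneg _)
    (Finset.mem_univ i)

/-- Reflection along a - b. The explicit form of v shows that the first coordinate vector is fixed
when a and b agree in the first coordinate. -/
theorem exists_householder_mulVec_eq {a b : Fin n → ℝ} (hab : a ≠ b) (h : a ⬝ᵥ a = b ⬝ᵥ b) :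
    ∃ v : Fin n → ℝ, v ⬝ᵥ v = 1 ∧ householder v *ᵥ a = b ∧ ∃ t : ℝ, v = t • (a - b) := by
  have hne : a - b ≠ 0 := sub_ne_zero.mpr hab
  have hpos : 0 < (a - b) ⬝ᵥ (a - b) :=
    lt_of_le_of_ne (Finset.sum_nonneg fun i _ => mul_self_nonneg _)
      (Ne.symm (mt dotProduct_self_eq_zero.mp hne))
  set q := (a - b) ⬝ᵥ (a - b) with hq
  have hs : √q * √q = q := Real.mul_self_sqrt hpos.le
  have hs0 : √q ≠ 0 := (Real.sqrt_pos.mpr hpos).ne'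
  have hq2 : 2 * ((a - b) ⬝ᵥ a) = q := by
    rw [hq, sub_dotProduct, sub_dotProduct, dotProduct_sub, dotProduct_sub, h,
      dotProduct_comm a b]; ring
  refine ⟨(√q)⁻¹ • (a - b), ?_, ?_, _, rfl⟩
  · rw [smul_dotProduct, dotProduct_smul, ← hq, smul_eq_mul, smul_eq_mul]
    field_simp
    rw [pow_two, hs]
  · rw [householder_mulVec, smul_dotProduct, smul_smul]
    have : 2 * (√q)⁻¹ • ((a - b) ⬝ᵥ a) * (√q)⁻¹ = 1 := by
      rw [smul_eq_mul]
      field_simp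
      rw [pow_two, hs, hq2]
    rw [this]
    simp

/-- A unit vector orthogonal to two given ones, in dimension at least three. -/
theorem exists_unit_orthogonal (hn : 3 ≤ n) (a b : Fin n → ℝ) :
    ∃ v : Fin n → ℝ, v ⬝ᵥ v = 1 ∧ v ⬝ᵥ a = 0 ∧ v ⬝ᵥ b = 0 := by
  have hker := LinearMap.ker_ne_bot_of_finrank_lt (f := (Matrix.of ![a, b]).mulVecLin)
    (by simp; omega)
  obtain ⟨x, hx, hx0⟩ := Submodule.exists_mem_ne_zero_of_ne_bot hker
  have h : Matrix.of ![a, b] *ᵥ x = 0 := hx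
  have ha : a ⬝ᵥ x = 0 := congrFun h 0
  have hb : b ⬝ᵥ x = 0 := congrFun h 1
  have hpos : 0 < x ⬝ᵥ x :=
    lt_of_le_of_ne (Finset.sum_nonneg fun i _ => mul_self_nonneg _)
      (Ne.symm (mt dotProduct_self_eq_zero.mp hx0))
  have hs : √(x ⬝ᵥ x) * √(x ⬝ᵥ x) = x ⬝ᵥ x := Real.mul_self_sqrt hpos.le
  have hs0 : √(x ⬝ᵥ x) ≠ 0 := (Real.sqrt_pos.mpr hpos).ne'
  refine ⟨(√(x ⬝ᵥ x))⁻¹ • x, ?_, ?_, ?_⟩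
  · rw [smul_dotProduct, dotProduct_smul, smul_eq_mul, smul_eq_mul]
    field_simp
    rw [pow_two, hs]
  · rw [smul_dotProduct, dotProduct_comm x a, ha, smul_zero]
  · rw [smul_dotProduct, dotProduct_comm x b, hb, smul_zero]

end Householder

section Coset

variable {n : ℕ} [NeZero n]

theorem mem_SOsub_iff {u : SO n} : u ∈ SOsub n ↔ u.1 *ᵥ Pi.single 0 1 = Pi.single 0 1 := Iff.rfl

theorem mul_SOsub_apply (g : SO n) {u : SO n} (hu : u ∈ SOsub n) (i : Fin n) :
    (g * u).1 i 0 = g.1 i 0 := by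
  have h : (g * u).1 *ᵥ Pi.single 0 1 = g.1 *ᵥ Pi.single 0 1 := by
    rw [Submonoid.coe_mul, ← Matrix.mulVec_mulVec, mem_SOsub_iff.mp hu]
  simpa [Matrix.mulVec_single_one] using congrFun h i

theorem SOsub_row {u : SO n} (hu : u ∈ SOsub n) (j : Fin n) :
    u.1 0 j = (Pi.single 0 1 : Fin n → ℝ) j := by
  have h := mem_SOsub_iff.mp ((SOsub n).inv_mem hu)
  rw [SO_inv_val] at h
  have := congrFun h j
  rwa [Matrix.mulVec_single_one] at this

theorem SOsub_mul_apply {u : SO n} (hu : u ∈ SOsub n) (g : SO n) (j : Fin n) :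
    (u * g).1 0 j = g.1 0 j := by
  rw [Submonoid.coe_mul, Matrix.mul_apply, Finset.sum_congr rfl fun i _ => by rw [SOsub_row hu i]]
  simp [Pi.single_apply]

/-- The reflection that takes a to b fixes the first coordinate vector but has determinant -1. A
second reflection, along a unit vector orthogonal to that vector and to b, restores the determinant;
such a unit vector exists because n ≥ 3. -/
theorem SOsub_transitive (hn : 3 ≤ n) {a b : Fin n → ℝ} (h : a ⬝ᵥ a = b ⬝ᵥ b)
    (h0 : a 0 = b 0) : ∃ u ∈ SOsub n, u.1 *ᵥ a = b := by
  by_cases hab : a = b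
  · exact ⟨1, one_mem _, by rw [hab]; exact Matrix.one_mulVec b⟩
  obtain ⟨v, hv, hva, t, ht⟩ := exists_householder_mulVec_eq hab h
  obtain ⟨w, hw, hw0, hwb⟩ := exists_unit_orthogonal hn (Pi.single 0 1) b
  refine ⟨reflPair w v hw hv, ?_, ?_⟩
  · have hv0 : v ⬝ᵥ Pi.single 0 1 = 0 := by
      rw [ht, dotProduct_single_one]; simp [h0]
    rw [mem_SOsub_iff, reflPair_mulVec, householder_mulVec_of_orthogonal hv0,
      householder_mulVec_of_orthogonal hw0]
  · rw [reflPair_mulVec, hva, householder_mulVec_of_orthogonal hwb]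

/-- The first columns of g and h are unit vectors with the same first entry, so some u in SO(n-1)
moves one to the other, and (u h)⁻¹ g fixes the first coordinate vector. -/
theorem exists_eq_mul_mul_of_apply_eq (hn : 3 ≤ n) {g h : SO n} (hgh : g.1 0 0 = h.1 0 0) :
    ∃ u ∈ SOsub n, ∃ v ∈ SOsub n, g = u * h * v := by
  obtain ⟨u, hu, huh⟩ := SOsub_transitive hn (a := h.1 *ᵥ Pi.single 0 1)
    (b := g.1 *ᵥ Pi.single 0 1) (by rw [SO_mulVec_dotProduct, SO_mulVec_dotProduct])
    (by simp [hgh])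
  refine ⟨u, hu, (u * h)⁻¹ * g, ?_, by group⟩
  rw [mem_SOsub_iff, Submonoid.coe_mul, ← Matrix.mulVec_mulVec, ← huh, Matrix.mulVec_mulVec _ u.1,
    Matrix.mulVec_mulVec]
  have : ((u * h)⁻¹).1 * (u.1 * h.1) = 1 := by
    rw [← Submonoid.coe_mul (SO n) u h, ← Submonoid.coe_mul, inv_mul_cancel]; rfl
  rw [this, Matrix.one_mulVec]

/-- The rotation by the angle `θ` in the plane of the coordinates `0` and `i`. -/
noncomputable def rot (i : Fin n) (hi : i ≠ 0) (θ : ℝ) : SO n :=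
  reflPair (Real.cos (θ / 2) • Pi.single 0 1 + Real.sin (θ / 2) • Pi.single i 1) (Pi.single 0 1)
    (by
      simp only [dotProduct_add, dotProduct_smul, dotProduct_single_one, Pi.add_apply,
        Pi.smul_apply, Pi.single_eq_same, Pi.single_eq_of_ne hi, Pi.single_eq_of_ne hi.symm,
        smul_eq_mul]
      linear_combination Real.cos_sq_add_sin_sq (θ / 2))
    (by simp)

theorem rot_mulVec (i : Fin n) (hi : i ≠ 0) (θ : ℝ) (x : Fin n → ℝ) :
    ((rot i hi θ).1 *ᵥ x) 0 = Real.cos θ * x 0 - Real.sin θ * x i ∧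
    ((rot i hi θ).1 *ᵥ x) i = Real.sin θ * x 0 + Real.cos θ * x i := by
  have hc : Real.cos θ = 2 * Real.cos (θ / 2) ^ 2 - 1 := by
    rw [← Real.cos_two_mul]; ring_nf
  have hs : Real.sin θ = 2 * Real.sin (θ / 2) * Real.cos (θ / 2) := by
    rw [← Real.sin_two_mul]; ring_nf
  have hcs := Real.cos_sq_add_sin_sq (θ / 2)
  rw [rot, reflPair_mulVec, householder_mulVec, householder_mulVec]
  simp only [add_dotProduct, smul_dotProduct, single_one_dotProduct, Pi.sub_apply, Pi.smul_apply,
    Pi.add_apply, Pi.single_eq_same, Pi.single_eq_of_ne hi, Pi.single_eq_of_ne hi.symm,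
    smul_eq_mul, hc, hs]
  constructor
  · ring
  · linear_combination (-2 * x i) * hcs

theorem rot_mul_apply (i : Fin n) (hi : i ≠ 0) (θ : ℝ) (g : SO n) :
    (rot i hi θ * g).1 0 0 = Real.cos θ * g.1 0 0 - Real.sin θ * g.1 i 0 ∧
    (rot i hi θ * g).1 i 0 = Real.sin θ * g.1 0 0 + Real.cos θ * g.1 i 0 := by
  have h := rot_mulVec i hi θ (g.1 *ᵥ Pi.single 0 1)
  rw [Matrix.mulVec_mulVec, ← Submonoid.coe_mul] at h
  simpa [Matrix.mulVec_single_one] using h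

theorem rot_apply (i : Fin n) (hi : i ≠ 0) (θ : ℝ) : (rot i hi θ).1 0 0 = Real.cos θ := by
  have h := (rot_mul_apply i hi θ 1).1
  simpa [hi] using h

theorem continuous_rot (i : Fin n) (hi : i ≠ 0) : Continuous (rot i hi) := by
  refine Continuous.subtype_mk ?_ _
  unfold householder
  fun_prop

/-- An element of `SO(n)` with given entry `δ ∈ [-1, 1]` at `(0, 0)`, depending continuously
on `δ`. -/
noncomputable def cosetRep (hn : 3 ≤ n) (δ : ℝ) : SO n :=
  rot ⟨1, by omega⟩ (by simp [Fin.ext_iff]) (Real.arccos δ)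

theorem cosetRep_apply (hn : 3 ≤ n) {δ : ℝ} (h1 : -1 ≤ δ) (h2 : δ ≤ 1) :
    (cosetRep hn δ).1 0 0 = δ := by
  rw [cosetRep, rot_apply, Real.cos_arccos h1 h2]

theorem continuous_cosetRep (hn : 3 ≤ n) : Continuous (cosetRep (n := n) hn) :=
  (continuous_rot _ _).comp Real.continuous_arccos

theorem exists_eq_mul_cosetRep_mul (hn : 3 ≤ n) (g : SO n) :
    ∃ u ∈ SOsub n, ∃ v ∈ SOsub n, g = u * cosetRep hn (g.1 0 0) * v :=
  exists_eq_mul_mul_of_apply_eq hn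
    (cosetRep_apply hn (abs_le.mp (SO_abs_apply_le_one g 0 0)).1
      (abs_le.mp (SO_abs_apply_le_one g 0 0)).2).symm

/-- The reflection along the i-th coordinate vector changes the sign; a reflection along a vector
orthogonal to coordinates 0 and i corrects the determinant. It makes the odd moments in the product
formula vanish. -/
theorem exists_mem_SOsub_neg (hn : 3 ≤ n) (i : Fin n) (hi : i ≠ 0) :
    ∃ s ∈ SOsub n, ∀ g : SO n, (s * g).1 i 0 = -g.1 i 0 := by
  obtain ⟨w, hw, hw0, hwi⟩ := exists_unit_orthogonal hn (Pi.single 0 1) (Pi.single i 1)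
  have hi1 : (Pi.single i 1 : Fin n → ℝ) ⬝ᵥ Pi.single i 1 = 1 := by simp
  refine ⟨reflPair (Pi.single i 1) w hi1 hw, ?_, fun g => ?_⟩
  · rw [mem_SOsub_iff, reflPair_mulVec, householder_mulVec_of_orthogonal hw0,
      householder_mulVec_of_orthogonal (by simp [hi.symm])]
  · have h : (reflPair (Pi.single i 1) w hi1 hw * g).1 *ᵥ Pi.single 0 1
        = householder (Pi.single i 1) *ᵥ (householder w *ᵥ (g.1 *ᵥ Pi.single 0 1)) := by
      rw [Submonoid.coe_mul, ← Matrix.mulVec_mulVec, reflPair_mulVec]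
    have h' := congrFun h i
    rw [dotProduct_single_one] at hwi
    rw [householder_mulVec, householder_mulVec] at h'
    simp only [Matrix.mulVec_single_one, single_one_dotProduct, Pi.sub_apply, Pi.smul_apply, hwi,
      Pi.single_eq_same, smul_eq_mul, Matrix.col_apply] at h'
    rw [h']
    ring

end Coset

/-! ### Invariance properties of the Haar probability measure -/

section Haar

variable (G : Type*) [Group G] [TopologicalSpace G] [IsTopologicalGroup G] [CompactSpace G]
    [MeasurableSpace G] [BorelSpace G]

instance : IsProbabilityMeasure (haarProb G) :=
  ⟨by simpa using Measure.haarMeasure_self (K₀ := (⊤ : TopologicalSpace.PositiveCompacts G))⟩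

/-- Uniqueness of Haar measure. Right invariance and invariance under inversion follow, since the
transported measures are again left invariant probability measures. -/
theorem eq_haarProb_of_isMulLeftInvariant (μ : Measure G) [IsProbabilityMeasure μ]
    [μ.IsMulLeftInvariant] : μ = haarProb G := by
  have h := Measure.isMulInvariant_eq_smul_of_compactSpace μ (haarProb G)
  have h1 := congrArg (fun m : Measure G => m univ) h
  simp only [Measure.smul_apply, measure_univ] at h1
  rw [h, Measure.ext_iff]
  intro s _
  simp only [Measure.smul_apply]
  rw [ENNReal.smul_def, smul_eq_mul, mul_one] at h1
  rw [ENNReal.smul_def, ← h1, one_smul]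

instance : (haarProb G).IsMulRightInvariant where
  map_mul_right_eq_self g := by
    have : IsProbabilityMeasure (Measure.map (· * g) (haarProb G)) :=
      Measure.isProbabilityMeasure_map (measurable_mul_const g).aemeasurable
    exact eq_haarProb_of_isMulLeftInvariant G _

instance : (haarProb G).IsInvInvariant where
  inv_eq_self := by
    have : IsProbabilityMeasure (haarProb G).inv :=
      Measure.isProbabilityMeasure_map measurable_inv.aemeasurable
    exact eq_haarProb_of_isMulLeftInvariant G _

end Haar

end

/-! ### Integration of zonal functions over SO(n) -/

section

open Polynomial

variable {n : ℕ} [NeZero n]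

/-- The entries of the first column. -/
def ent (i : Fin n) (g : SO n) : ℝ := g.1 i 0

@[fun_prop]
theorem continuous_ent (i : Fin n) : Continuous (ent i) :=
  (continuous_apply_apply i 0).comp continuous_subtype_val

@[fun_prop]
theorem continuous_polynomial_eval {Y : Type*} [TopologicalSpace Y] (q : ℝ[X]) {f : Y → ℝ}
    (hf : Continuous f) : Continuous fun x => q.eval (f x) :=
  q.continuous.comp hf

theorem ent_mul_SOsub (i : Fin n) (g : SO n) {u : SO n} (hu : u ∈ SOsub n) :
    ent i (g * u) = ent i g := mul_SOsub_apply g hu i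

theorem ent_SOsub_mul {u : SO n} (hu : u ∈ SOsub n) (g : SO n) : ent 0 (u * g) = ent 0 g :=
  SOsub_mul_apply hu g 0

theorem ent_inv (g : SO n) : ent 0 g⁻¹ = ent 0 g := SO_inv_apply g 0 0

theorem ent_one : ent 0 (1 : SO n) = 1 := by simp [ent]

theorem ent_zero_rot_mul (i : Fin n) (hi : i ≠ 0) (θ : ℝ) (g : SO n) :
    ent 0 (rot i hi θ * g) = Real.cos θ * ent 0 g - Real.sin θ * ent i g :=
  (rot_mul_apply i hi θ g).1

theorem ent_rot_mul (i : Fin n) (hi : i ≠ 0) (θ : ℝ) (g : SO n) :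
    ent i (rot i hi θ * g) = Real.sin θ * ent 0 g + Real.cos θ * ent i g :=
  (rot_mul_apply i hi θ g).2

theorem abs_ent_le_one (i : Fin n) (g : SO n) : |ent i g| ≤ 1 := SO_abs_apply_le_one g i 0

theorem sum_ent_sq (g : SO n) : ∑ i, ent i g ^ 2 = 1 := SO_col_sum_sq g 0

theorem ent_cosetRep (hn : 3 ≤ n) {δ : ℝ} (h1 : -1 ≤ δ) (h2 : δ ≤ 1) :
    ent 0 (cosetRep hn δ) = δ := cosetRep_apply hn h1 h2

@[fun_prop]
theorem continuous_SOsub_coe : Continuous fun u : SOsub n => (u : SO n) := continuous_subtype_val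

theorem integrable_haarProb {G E : Type*} [Group G] [TopologicalSpace G] [IsTopologicalGroup G]
    [CompactSpace G] [MeasurableSpace G] [BorelSpace G] [NormedAddCommGroup E]
    [SecondCountableTopologyEither G E] {f : G → E} (hf : Continuous f) :
    Integrable f (haarProb G) :=
  hf.integrable_of_hasCompactSupport (HasCompactSupport.of_compactSpace _)

variable (n) in
/-- The integral of a polynomial in the `(0, 0)` entry over `SO(n)`. -/
noncomputable def zonalFunctional : ℝ[X] →ₗ[ℝ] ℝ where
  toFun q := ∫ g : SO n, q.eval (ent 0 g) ∂haarProb (SO n)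
  map_add' q r := by
    simp only [eval_add]
    exact integral_add (integrable_haarProb (by fun_prop))
      (integrable_haarProb (by fun_prop))
  map_smul' a q := by
    simp only [eval_smul, RingHom.id_apply]
    exact integral_smul a _

theorem zonalFunctional_apply (q : ℝ[X]) :
    zonalFunctional n q = ∫ g : SO n, q.eval (ent 0 g) ∂haarProb (SO n) := rfl

theorem zonalFunctional_one : zonalFunctional n 1 = 1 := by
  simp [zonalFunctional_apply]

/-- Write x_i for `ent i g`. By left invariance, ∫ Q(x_0) x_i does not change under the rotation by
θ in the coordinates 0 and i; the identity is the vanishing of its derivative at θ = 0. -/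
theorem integral_derivative_mul_sq (Q : ℝ[X]) {i : Fin n} (hi : i ≠ 0) :
    ∫ g : SO n, (derivative Q).eval (ent 0 g) * ent i g ^ 2 ∂haarProb (SO n)
      = ∫ g : SO n, ent 0 g * Q.eval (ent 0 g) ∂haarProb (SO n) := by
  set f : ℝ → SO n → ℝ := fun θ g => Q.eval (Real.cos θ * ent 0 g - Real.sin θ * ent i g)
    * (Real.sin θ * ent 0 g + Real.cos θ * ent i g) with hf
  set f' : ℝ → SO n → ℝ := fun θ g =>
    (derivative Q).eval (Real.cos θ * ent 0 g - Real.sin θ * ent i g)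
      * (-Real.sin θ * ent 0 g - Real.cos θ * ent i g)
      * (Real.sin θ * ent 0 g + Real.cos θ * ent i g)
    + Q.eval (Real.cos θ * ent 0 g - Real.sin θ * ent i g)
      * (Real.cos θ * ent 0 g + -Real.sin θ * ent i g) with hf'
  have hconst : ∀ θ, ∫ g, f θ g ∂haarProb (SO n) = ∫ g, f 0 g ∂haarProb (SO n) := by
    intro θ
    have h := integral_mul_left_eq_self (μ := haarProb (SO n))
      (fun g : SO n => Q.eval (ent 0 g) * ent i g) (rot i hi θ)
    simp only [ent_zero_rot_mul, ent_rot_mul] at h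
    simp only [hf, Real.cos_zero, Real.sin_zero, one_mul, zero_mul, sub_zero, zero_add]
    exact h
  have hf'c : Continuous fun w : ℝ × SO n => f' w.1 w.2 := by
    simp only [hf']
    fun_prop
  obtain ⟨B, hB⟩ := ((isCompact_Icc (a := (-1 : ℝ)) (b := 1)).prod
    (isCompact_univ (X := SO n))).exists_bound_of_continuousOn hf'c.continuousOn
  have hfc : ∀ θ, Continuous (f θ) := by
    intro θ
    simp only [hf]
    fun_prop
  have hder := (hasDerivAt_integral_of_dominated_loc_of_deriv_le (μ := haarProb (SO n)) (F := f)
    (F' := f') (x₀ := 0) (s := Ioo (-1) 1) (bound := fun _ => B)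
    (Ioo_mem_nhds (by norm_num) (by norm_num))
    (Eventually.of_forall fun θ => (hfc θ).aestronglyMeasurable)
    (integrable_haarProb (hfc 0))
    (hf'c.comp (Continuous.prodMk_right (0 : ℝ))).aestronglyMeasurable
    (Eventually.of_forall fun g θ hθ => hB (θ, g) ⟨Ioo_subset_Icc_self hθ, mem_univ _⟩)
    (integrable_const _)
    (Eventually.of_forall fun g θ _ => by
      have h1 : HasDerivAt (fun θ => Real.cos θ * ent 0 g - Real.sin θ * ent i g)
          (-Real.sin θ * ent 0 g - Real.cos θ * ent i g) θ :=
        ((Real.hasDerivAt_cos θ).mul_const _).sub ((Real.hasDerivAt_sin θ).mul_const _)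
      have h2 : HasDerivAt (fun θ => Real.sin θ * ent 0 g + Real.cos θ * ent i g)
          (Real.cos θ * ent 0 g + -Real.sin θ * ent i g) θ :=
        ((Real.hasDerivAt_sin θ).mul_const _).add ((Real.hasDerivAt_cos θ).mul_const _)
      exact ((Q.hasDerivAt _).comp θ h1).mul h2)).2
  have h0 : ∫ g, f' 0 g ∂haarProb (SO n) = 0 := by
    have h1 : (fun θ => ∫ g, f θ g ∂haarProb (SO n)) = fun _ => ∫ g, f 0 g ∂haarProb (SO n) :=
      funext hconst
    rw [h1] at hder
    exact hder.unique (hasDerivAt_const _ _)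
  have e : ∀ g, f' 0 g = ent 0 g * Q.eval (ent 0 g)
      - (derivative Q).eval (ent 0 g) * ent i g ^ 2 := by
    intro g
    simp only [hf', Real.cos_zero, Real.sin_zero]
    ring_nf
  simp only [e] at h0
  rw [integral_sub (integrable_haarProb (by fun_prop)) (integrable_haarProb (by fun_prop))] at h0
  linarith

/-- Sum the preceding identity over the n - 1 = d + 1 coordinates i ≠ 0, whose squares add up to 1 -
x_0². -/
theorem zonalFunctional_ibp (hn : 3 ≤ n) (Q : ℝ[X]) :
    zonalFunctional n ((1 - X ^ 2) * derivative Q - C (((n - 2 : ℕ) : ℝ) + 1) * X * Q) = 0 := by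
  have h1 : ∀ g : SO n, (1 - ent 0 g ^ 2) * (derivative Q).eval (ent 0 g)
      = ∑ i ∈ Finset.univ.erase (0 : Fin n), (derivative Q).eval (ent 0 g) * ent i g ^ 2 := by
    intro g
    have h := sum_ent_sq g
    rw [← Finset.add_sum_erase _ _ (Finset.mem_univ (0 : Fin n))] at h
    rw [← Finset.mul_sum, ← h]
    ring
  have hcard : ((n - 2 : ℕ) : ℝ) + 1 = ((Finset.univ.erase (0 : Fin n)).card : ℝ) := by
    rw [Finset.card_erase_of_mem (Finset.mem_univ _), Finset.card_univ, Fintype.card_fin]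
    have : n - 1 = n - 2 + 1 := by omega
    rw [this]; push_cast; ring
  rw [zonalFunctional_apply]
  simp only [eval_sub, eval_mul, eval_one, eval_pow, eval_X, eval_C, h1]
  rw [integral_sub, integral_finsetSum]
  · rw [Finset.sum_congr rfl fun i hi => integral_derivative_mul_sq Q (Finset.ne_of_mem_erase hi)]
    simp only [mul_assoc]
    rw [integral_const_mul, Finset.sum_const, hcard, nsmul_eq_mul, sub_self]
  · intro i _
    exact integrable_haarProb (by fun_prop)
  · refine integrable_haarProb (continuous_finsetSum _ fun i _ => ?_)
    fun_prop
  · exact integrable_haarProb (by fun_prop)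

theorem integral_zonal_mul_zonal (hn : 3 ≤ n) (k l : ℕ) :
    ∫ g : SO n, (zonal (n - 2) k).eval (ent 0 g) * (zonal (n - 2) l).eval (ent 0 g)
      ∂haarProb (SO n) = if k = l then (mult (n - 2) k)⁻¹ else 0 := by
  have h : ∫ g : SO n, (zonal (n - 2) k).eval (ent 0 g) * (zonal (n - 2) l).eval (ent 0 g)
      ∂haarProb (SO n) = zonalFunctional n (zonal (n - 2) k * zonal (n - 2) l) := by
    simp [zonalFunctional_apply]
  rw [h]
  split_ifs with hkl
  · subst hkl
    exact functional_zonal_sq _ (zonalFunctional_ibp hn) (by omega) zonalFunctional_one k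
  · exact functional_zonal_mul _ (zonalFunctional_ibp hn) hkl

/-! ### The product formula -/

/-- If g is a rotation with entry x up to SO(n-1) on both sides, the entry of g u h is x h_00 -
√(1-x²) y, where y is a coordinate with symmetric distribution in u. The odd moments of y vanish, so
only even powers of √(1-x²) survive the binomial expansion. -/
theorem exists_polynomial_average_pow (hn : 3 ≤ n) (h : SO n) (m : ℕ) :
    ∃ Q : ℝ[X], Q.natDegree ≤ m ∧ ∀ g : SO n,
      ∫ u : SOsub n, (ent 0 (g * (u : SO n) * h)) ^ m ∂haarProb (SOsub n) = Q.eval (ent 0 g) := by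
  classical
  set i : Fin n := ⟨1, by omega⟩ with hi_def
  have hi : i ≠ 0 := by simp [hi_def, Fin.ext_iff]
  set I : ℕ → ℝ := fun j => ∫ u : SOsub n, ent i ((u : SO n) * h) ^ j ∂haarProb (SOsub n) with hI
  have hodd : ∀ j, ¬ Even j → I j = 0 := by
    intro j hj
    obtain ⟨s, hs, hsneg⟩ := exists_mem_SOsub_neg hn i hi
    have := integral_mul_left_eq_self (μ := haarProb (SOsub n))
      (fun u : SOsub n => ent i ((u : SO n) * h) ^ j) ⟨s, hs⟩
    have hsneg' : ∀ g, ent i (s * g) = -ent i g := hsneg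
    simp only [Subgroup.coe_mul, mul_assoc, hsneg', (Nat.not_even_iff_odd.mp hj).neg_pow] at this
    rw [integral_neg] at this
    simp only [hI]
    linarith
  refine ⟨∑ j ∈ Finset.range (m + 1), if Even j then
    C ((m.choose j : ℝ) * ent 0 h ^ (m - j) * I j) * (X ^ (m - j) * (1 - X ^ 2) ^ (j / 2)) else 0,
    ?_, fun g => ?_⟩
  · refine natDegree_sum_le_of_forall_le _ _ fun j hj => ?_
    rw [Finset.mem_range] at hj
    split_ifs with hev
    · refine (natDegree_C_mul_le _ _).trans (natDegree_mul_le.trans ?_)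
      have h1 : ((1 - X ^ 2 : ℝ[X]) ^ (j / 2)).natDegree ≤ j / 2 * 2 := by
        refine natDegree_pow_le.trans (Nat.mul_le_mul_left _ ?_)
        compute_degree
      rw [natDegree_X_pow]
      omega
    · simp
  · obtain ⟨u1, hu1, v1, hv1, hg⟩ := exists_eq_mul_cosetRep_mul hn g
    change g = u1 * cosetRep hn (ent 0 g) * v1 at hg
    have hx := abs_le.mp (abs_ent_le_one 0 g)
    set x := ent 0 g with hxdef
    have hsin : Real.sin (Real.arccos x) = √(1 - x ^ 2) := Real.sin_arccos x
    have hcos : Real.cos (Real.arccos x) = x := Real.cos_arccos hx.1 hx.2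
    have hx2 : 0 ≤ 1 - x ^ 2 := by nlinarith [hx.1, hx.2]
    have e1 : ∀ u : SOsub n, ent 0 (g * (u : SO n) * h)
        = x * ent 0 h - √(1 - x ^ 2) * ent i (((⟨v1, hv1⟩ * u : SOsub n) : SO n) * h) := by
      intro u
      have e2 : g * (u : SO n) * h
          = u1 * (cosetRep hn x * (((⟨v1, hv1⟩ * u : SOsub n) : SO n) * h)) := by
        rw [hg]; simp only [Subgroup.coe_mul]; group
      rw [e2, ent_SOsub_mul hu1, cosetRep, ent_zero_rot_mul i hi, hcos, hsin,
        ent_SOsub_mul (⟨v1, hv1⟩ * u : SOsub n).2]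
    simp only [e1]
    rw [integral_mul_left_eq_self (μ := haarProb (SOsub n))
      (fun u : SOsub n => (x * ent 0 h - √(1 - x ^ 2) * ent i ((u : SO n) * h)) ^ m) ⟨v1, hv1⟩]
    have cont : Continuous fun u : SOsub n => ent i ((u : SO n) * h) := by fun_prop
    have e3 : ∀ u : SOsub n, (x * ent 0 h - √(1 - x ^ 2) * ent i ((u : SO n) * h)) ^ m
        = ∑ j ∈ Finset.range (m + 1), ((-√(1 - x ^ 2)) ^ j * (x * ent 0 h) ^ (m - j)
          * (m.choose j)) * ent i ((u : SO n) * h) ^ j := by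
      intro u
      rw [sub_eq_neg_add, ← neg_mul, add_pow]
      refine Finset.sum_congr rfl fun j _ => ?_
      rw [mul_pow]; ring
    simp only [e3]
    rw [integral_finsetSum _ fun j _ => integrable_haarProb (continuous_const.fun_mul (cont.fun_pow j)),
      eval_finsetSum]
    refine Finset.sum_congr rfl fun j _ => ?_
    rw [integral_const_mul]
    change _ * I j = _
    split_ifs with hev
    · obtain ⟨l, rfl⟩ := hev
      have h5 : (-√(1 - x ^ 2)) ^ (l + l) = (1 - x ^ 2) ^ l := by
        rw [← two_mul, pow_mul, neg_sq, Real.sq_sqrt hx2]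
      have h6 : (l + l) / 2 = l := by omega
      simp only [eval_mul, eval_C, eval_pow, eval_X, eval_sub, eval_one, h5, h6, mul_pow]
      ring
    · rw [hodd j hev]; simp

theorem exists_polynomial_average (hn : 3 ≤ n) (h : SO n) {k : ℕ} {q : ℝ[X]}
    (hq : q.natDegree ≤ k) :
    ∃ Q : ℝ[X], Q.natDegree ≤ k ∧ ∀ g : SO n,
      ∫ u : SOsub n, q.eval (ent 0 (g * (u : SO n) * h)) ∂haarProb (SOsub n)
        = Q.eval (ent 0 g) := by
  choose R hR1 hR2 using exists_polynomial_average_pow hn h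
  refine ⟨∑ m ∈ Finset.range (k + 1), C (q.coeff m) * R m, ?_, fun g => ?_⟩
  · refine natDegree_sum_le_of_forall_le _ _ fun j hj => ?_
    rw [Finset.mem_range] at hj
    exact (natDegree_C_mul_le _ _).trans ((hR1 j).trans (by omega))
  · have cont : Continuous fun u : SOsub n => ent 0 (g * (u : SO n) * h) := by fun_prop
    simp only [eval_eq_sum_range' (Nat.lt_succ_of_le hq)]
    rw [integral_finsetSum _ fun j _ => integrable_haarProb (continuous_const.fun_mul (cont.fun_pow j)),
      eval_finsetSum]
    refine Finset.sum_congr rfl fun j _ => ?_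
    rw [integral_const_mul, hR2, eval_mul, eval_C]

theorem integral_integral_haarProb_swap {G K : Type*} [Group G] [TopologicalSpace G]
    [IsTopologicalGroup G] [CompactSpace G] [MeasurableSpace G] [BorelSpace G]
    [SecondCountableTopology G] [Group K] [TopologicalSpace K]
    [IsTopologicalGroup K] [CompactSpace K] [MeasurableSpace K] [BorelSpace K]
    [SecondCountableTopology K] {E : Type*} [NormedAddCommGroup E] [NormedSpace ℝ E]
    {f : G → K → E} (hf : Continuous (Function.uncurry f)) :
    ∫ g, ∫ u, f g u ∂haarProb K ∂haarProb G = ∫ u, ∫ g, f g u ∂haarProb G ∂haarProb K :=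
  integral_integral_swap (hf.integrable_of_hasCompactSupport (HasCompactSupport.of_compactSpace _))

/-- The averages for h and for h⁻¹ are adjoint: right translations, by u h and by u, bring both
sides to ∫ q(g) r(g h⁻¹) dg. -/
theorem integral_average_mul (q r : ℝ[X]) (h : SO n) :
    ∫ g : SO n, (∫ u : SOsub n, q.eval (ent 0 (g * (u : SO n) * h)) ∂haarProb (SOsub n))
        * r.eval (ent 0 g) ∂haarProb (SO n)
      = ∫ g : SO n, q.eval (ent 0 g)
        * (∫ u : SOsub n, r.eval (ent 0 (g * (u : SO n) * h⁻¹)) ∂haarProb (SOsub n))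
          ∂haarProb (SO n) := by
  have e1 : ∀ u : SOsub n, ∫ g : SO n, q.eval (ent 0 (g * (u : SO n) * h)) * r.eval (ent 0 g)
      ∂haarProb (SO n) = ∫ g : SO n, q.eval (ent 0 g) * r.eval (ent 0 (g * h⁻¹))
        ∂haarProb (SO n) := by
    intro u
    rw [← integral_mul_right_eq_self (μ := haarProb (SO n)) (fun g : SO n =>
      q.eval (ent 0 g) * r.eval (ent 0 (g * h⁻¹))) ((u : SO n) * h)]
    refine integral_congr_ae (Eventually.of_forall fun g => ?_)
    simp only
    rw [← mul_assoc, mul_inv_cancel_right, ent_mul_SOsub 0 g u.2]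
  have e2 : ∀ u : SOsub n, ∫ g : SO n, q.eval (ent 0 g) * r.eval (ent 0 (g * (u : SO n) * h⁻¹))
      ∂haarProb (SO n) = ∫ g : SO n, q.eval (ent 0 g) * r.eval (ent 0 (g * h⁻¹))
        ∂haarProb (SO n) := by
    intro u
    rw [← integral_mul_right_eq_self (μ := haarProb (SO n)) (fun g : SO n =>
      q.eval (ent 0 g) * r.eval (ent 0 (g * h⁻¹))) (u : SO n)]
    refine integral_congr_ae (Eventually.of_forall fun g => ?_)
    simp only
    rw [ent_mul_SOsub 0 g u.2]
  simp only [← integral_const_mul, ← integral_mul_const]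
  conv_lhs => rw [integral_integral_haarProb_swap (by simp only [Function.uncurry_def]; fun_prop)]
  conv_rhs => rw [integral_integral_haarProb_swap (by simp only [Function.uncurry_def]; fun_prop)]
  simp only [e1, e2]

/-- The product formula for zonal spherical functions. -/
theorem integral_zonal_product (hn : 3 ≤ n) (k : ℕ) (g h : SO n) :
    ∫ u : SOsub n, (zonal (n - 2) k).eval (ent 0 (g * (u : SO n) * h)) ∂haarProb (SOsub n)
      = (zonal (n - 2) k).eval (ent 0 g) * (zonal (n - 2) k).eval (ent 0 h) := by
  set d := n - 2 with hd
  obtain ⟨Q, hQ1, hQ2⟩ := exists_polynomial_average hn h (natDegree_zonal_le d k)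
  obtain ⟨b, hb⟩ := exists_eq_sum_zonal d hQ1
  have hev : ∀ x, Q.eval x = ∑ i ∈ Finset.range (k + 1), b i * (zonal d i).eval x := by
    intro x
    rw [hb, eval_finsetSum]
    simp
  have cz : ∀ i, Continuous fun g : SO n => (zonal d i).eval (ent 0 g) := by fun_prop
  have hzz : ∀ i j, ∫ g : SO n, (zonal d i).eval (ent 0 g) * (zonal d j).eval (ent 0 g)
      ∂haarProb (SO n) = if i = j then (mult d i)⁻¹ else 0 := integral_zonal_mul_zonal hn
  have hcoef : ∀ (B : ℕ → ℝ) (m : ℕ) (j : ℕ), j ≤ m → ∫ g : SO n,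
      (∑ i ∈ Finset.range (m + 1), B i * (zonal d i).eval (ent 0 g)) * (zonal d j).eval (ent 0 g)
        ∂haarProb (SO n) = B j * (mult d j)⁻¹ := by
    intro B m j hj
    simp only [Finset.sum_mul, mul_assoc]
    rw [integral_finsetSum _ fun i _ => integrable_haarProb
      (continuous_const.fun_mul ((cz i).fun_mul (cz j)))]
    simp only [integral_const_mul, hzz]
    rw [Finset.sum_eq_single j]
    · simp
    · intro i _ hij; simp [hij]
    · intro h; exact absurd (Finset.mem_range.mpr (Nat.lt_succ_of_le hj)) h
  -- By adjointness b_j is, up to a nonzero factor, the pairing of P_k with an average of P_j. That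
  -- average has degree at most j < k, so it is orthogonal to P_k.
  have hzero : ∀ j < k, b j = 0 := by
    intro j hj
    have h1 := integral_average_mul (zonal d k) (zonal d j) h
    obtain ⟨R, hR1, hR2⟩ := exists_polynomial_average hn h⁻¹ (natDegree_zonal_le d j)
    obtain ⟨c, hc⟩ := exists_eq_sum_zonal d hR1
    simp only [hQ2, hR2, hev] at h1
    rw [hcoef b k j hj.le] at h1
    have h2 : ∀ g : SO n, (zonal d k).eval (ent 0 g) * R.eval (ent 0 g)
        = ∑ i ∈ Finset.range (j + 1), c i * ((zonal d k).eval (ent 0 g)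
          * (zonal d i).eval (ent 0 g)) := by
      intro g
      rw [hc, eval_finsetSum, Finset.mul_sum]
      refine Finset.sum_congr rfl fun i _ => ?_
      simp
      ring
    simp only [h2] at h1
    rw [integral_finsetSum _ fun i _ => integrable_haarProb
      (continuous_const.fun_mul ((cz k).fun_mul (cz i)))] at h1
    rw [Finset.sum_eq_zero] at h1
    · exact (mul_eq_zero.mp h1).resolve_right (inv_ne_zero (mult_pos (by omega) j).ne')
    · intro i hi
      rw [Finset.mem_range] at hi
      rw [integral_const_mul, integral_zonal_mul_zonal hn, if_neg (by omega), mul_zero]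
  have hQk : ∀ x, Q.eval x = b k * (zonal d k).eval x := by
    intro x
    rw [hev, Finset.sum_range_succ, Finset.sum_eq_zero, zero_add]
    intro i hi
    rw [hzero i (Finset.mem_range.mp hi), zero_mul]
  have hbk : b k = (zonal d k).eval (ent 0 h) := by
    have h1 := hQ2 1
    rw [hQk] at h1
    simp only [one_mul, ent_one, zonal_eval_one, mul_one] at h1
    rw [← h1]
    simp only [ent_SOsub_mul (Subtype.coe_prop _)]
    simp
  rw [hQ2, hQk, hbk, mul_comm]

end

section

open Polynomial

variable {n : ℕ}

/-! ### The left regular representation -/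

theorem leftReg_add (g : SO n) (f h : L2SO n) : leftReg g (f + h) = leftReg g f + leftReg g h :=
  DomMulAct.smul_Lp_add _ f h

theorem leftReg_smul (g : SO n) (c : ℂ) (f : L2SO n) : leftReg g (c • f) = c • leftReg g f := by
  simp only [leftReg, smul_comm c]

theorem norm_leftReg (g : SO n) (f : L2SO n) : ‖leftReg g f‖ = ‖f‖ :=
  DomMulAct.norm_smul_Lp _ f

theorem leftReg_one (f : L2SO n) : leftReg 1 f = f := by
  simp [leftReg]

theorem leftReg_mul (g h : SO n) (f : L2SO n) : leftReg (g * h) f = leftReg g (leftReg h f) := by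
  simp [leftReg, mul_smul]

theorem coeFn_leftReg (g : SO n) (f : L2SO n) :
    leftReg g f =ᵐ[haarProb (SO n)] fun x => f (g⁻¹ * x) :=
  DomMulAct.smul_Lp_ae_eq _ f

@[fun_prop]
theorem continuous_leftReg_comp {Y : Type*} [TopologicalSpace Y] {a : Y → SO n} (ha : Continuous a)
    (f : L2SO n) : Continuous fun y => leftReg (a y) f := by
  unfold leftReg
  have : Fact ((2 : ℝ≥0∞) ≠ ∞) := ⟨by simp⟩
  exact (DomMulAct.continuous_mk.comp ha.inv).smul continuous_const

/-- Left translation as a linear isometry. -/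
noncomputable def leftRegIsometry (g : SO n) : L2SO n →ₗᵢ[ℂ] L2SO n where
  toFun := leftReg g
  map_add' := leftReg_add g
  map_smul' := leftReg_smul g
  norm_map' := norm_leftReg g

theorem inner_leftReg (g : SO n) (f h : L2SO n) :
    inner ℂ (leftReg g f) (leftReg g h) = inner ℂ f h :=
  (leftRegIsometry g).inner_map_map f h

theorem inner_leftReg_left (g : SO n) (f h : L2SO n) :
    inner ℂ (leftReg g f) h = inner ℂ f (leftReg g⁻¹ h) := by
  rw [← inner_leftReg g⁻¹, ← leftReg_mul, inv_mul_cancel, leftReg_one]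

theorem leftReg_integral {Y : Type*} [MeasurableSpace Y] {μ : Measure Y} {F : Y → L2SO n}
    (hF : Integrable F μ) (g : SO n) : leftReg g (∫ y, F y ∂μ) = ∫ y, leftReg g (F y) ∂μ :=
  ((leftRegIsometry g).toContinuousLinearMap.integral_comp_comm hF).symm

/-- The operator `∫ w(g) λ(g) dg`, i.e. the convolution by `w` from the left. -/
noncomputable def convOp (w : C(SO n, ℂ)) : L2SO n →L[ℂ] L2SO n :=
  LinearMap.mkContinuous
    { toFun := fun f => ∫ g, w g • leftReg g f ∂haarProb (SO n)
      map_add' := fun f h => by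
        rw [← integral_add (integrable_haarProb (by fun_prop)) (integrable_haarProb (by fun_prop))]
        simp only [leftReg_add, smul_add]
      map_smul' := fun c f => by
        rw [RingHom.id_apply, ← integral_smul]
        simp only [leftReg_smul, smul_comm c] }
    ‖w‖
    (fun f => by
      refine (norm_integral_le_of_norm_le_const (C := ‖w‖ * ‖f‖)
        (Eventually.of_forall fun g => ?_)).trans (by simp)
      rw [norm_smul, norm_leftReg]
      gcongr
      exact w.norm_coe_le_norm g)

theorem convOp_apply (w : C(SO n, ℂ)) (f : L2SO n) :
    convOp w f = ∫ g, w g • leftReg g f ∂haarProb (SO n) := rfl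

theorem inner_convOp (w : C(SO n, ℂ)) (f h : L2SO n) :
    inner ℂ h (convOp w f) = ∫ g, w g * inner ℂ h (leftReg g f) ∂haarProb (SO n) := by
  rw [convOp_apply, ← integral_inner (integrable_haarProb (by fun_prop))]
  simp only [inner_smul_right]

theorem convOp_leftReg (w : C(SO n, ℂ)) (h : SO n) (f : L2SO n) :
    convOp w (leftReg h f) = ∫ g, w (g * h⁻¹) • leftReg g f ∂haarProb (SO n) := by
  rw [convOp_apply]
  conv_rhs => rw [← integral_mul_right_eq_self _ h]
  simp only [mul_inv_cancel_right, leftReg_mul]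

theorem leftReg_convOp (w : C(SO n, ℂ)) (h : SO n) (f : L2SO n) :
    leftReg h (convOp w f) = ∫ g, w (h⁻¹ * g) • leftReg g f ∂haarProb (SO n) := by
  have hint : Integrable (fun g => w g • leftReg g f) (haarProb (SO n)) :=
    integrable_haarProb (by fun_prop)
  rw [convOp_apply, leftReg_integral hint]
  conv_rhs => rw [← integral_mul_left_eq_self (μ := haarProb (SO n)) _ h]
  simp only [inv_mul_cancel_left, leftReg_mul, leftReg_smul]

/-! ### The projections onto the spaces of spherical harmonics -/

variable [NeZero n]

/-- The `k`-th zonal spherical function on `SO(n)`. -/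
noncomputable def zonalFun (k : ℕ) (g : SO n) : ℝ := (zonal (n - 2) k).eval (ent 0 g)

@[fun_prop]
theorem continuous_zonalFun (k : ℕ) : Continuous (zonalFun (n := n) k) := by
  unfold zonalFun; fun_prop

theorem zonalFun_mul_SOsub (k : ℕ) (g : SO n) {u : SO n} (hu : u ∈ SOsub n) :
    zonalFun k (g * u) = zonalFun k g := by
  rw [zonalFun, ent_mul_SOsub 0 g hu, zonalFun]

theorem zonalFun_SOsub_mul (k : ℕ) {u : SO n} (hu : u ∈ SOsub n) (g : SO n) :
    zonalFun k (u * g) = zonalFun k g := by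
  rw [zonalFun, ent_SOsub_mul hu, zonalFun]

theorem zonalFun_inv (k : ℕ) (g : SO n) : zonalFun k g⁻¹ = zonalFun k g := by
  rw [zonalFun, ent_inv, zonalFun]

theorem integral_zonalFun_product (hn : 3 ≤ n) (k : ℕ) (g h : SO n) :
    ∫ u : SOsub n, zonalFun k (g * (u : SO n) * h) ∂haarProb (SOsub n)
      = zonalFun k g * zonalFun k h := integral_zonal_product hn k g h

theorem integral_zonalFun_mul (hn : 3 ≤ n) (k l : ℕ) :
    ∫ g : SO n, zonalFun k g * zonalFun l g ∂haarProb (SO n)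
      = if k = l then (mult (n - 2) k)⁻¹ else 0 := integral_zonal_mul_zonal hn k l

/-- Inserting u between g⁻¹ and h does not change the integral. Averaging over u splits the second
factor by the product formula, and orthogonality remains. -/
theorem integral_zonalFun_convolution (hn : 3 ≤ n) (k l : ℕ) (h : SO n) :
    ∫ g : SO n, zonalFun k g * zonalFun l (g⁻¹ * h) ∂haarProb (SO n)
      = (if k = l then (mult (n - 2) k)⁻¹ else 0) * zonalFun l h := by
  have h1 : ∀ u : SOsub n, ∫ g : SO n, zonalFun k g * zonalFun l (g⁻¹ * (u : SO n) * h)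
      ∂haarProb (SO n) = ∫ g : SO n, zonalFun k g * zonalFun l (g⁻¹ * h) ∂haarProb (SO n) := by
    intro u
    rw [← integral_mul_left_eq_self (μ := haarProb (SO n)) _ (u : SO n)]
    refine integral_congr_ae (Eventually.of_forall fun g => ?_)
    simp only [zonalFun_SOsub_mul k u.2, mul_inv_rev]
    group
  have h2 : ∫ u : SOsub n, ∫ g : SO n, zonalFun k g * zonalFun l (g⁻¹ * (u : SO n) * h)
      ∂haarProb (SO n) ∂haarProb (SOsub n)
      = ∫ g : SO n, zonalFun k g * zonalFun l (g⁻¹ * h) ∂haarProb (SO n) := by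
    simp only [h1]; simp
  rw [← h2, integral_integral_haarProb_swap (by simp only [Function.uncurry_def]; fun_prop)]
  simp only [integral_const_mul, integral_zonalFun_product hn, zonalFun_inv, ← mul_assoc]
  rw [integral_mul_const, integral_zonalFun_mul hn]

/-- The zonal spherical functions, as continuous complex-valued functions. -/
noncomputable def zonalMap (k : ℕ) : C(SO n, ℂ) := ⟨fun g => (zonalFun k g : ℂ), by fun_prop⟩

theorem zonalMap_apply (k : ℕ) (g : SO n) : zonalMap k g = (zonalFun k g : ℂ) := rfl

variable (n) in
/-- The projection of `L_2(SO(n))` onto the left `SO(n-1)`-invariant functions that are spherical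
harmonics of degree `k`. -/
noncomputable def harmProj (k : ℕ) : L2SO n →L[ℂ] L2SO n :=
  (mult (n - 2) k : ℂ) • convOp (zonalMap k)

theorem harmProj_apply (k : ℕ) (f : L2SO n) :
    harmProj n k f = (mult (n - 2) k : ℂ) • convOp (zonalMap k) f := rfl

theorem convOp_zonalMap_comp (hn : 3 ≤ n) (k l : ℕ) (f : L2SO n) :
    convOp (zonalMap k) (convOp (zonalMap l) f)
      = (if k = l then ((mult (n - 2) k)⁻¹ : ℂ) else 0) • convOp (zonalMap l) f := by
  rw [convOp_apply (zonalMap k)]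
  simp only [leftReg_convOp, ← integral_smul, smul_smul]
  rw [integral_integral_haarProb_swap (by simp only [Function.uncurry_def]; fun_prop),
    convOp_apply, ← integral_smul]
  refine integral_congr_ae (Eventually.of_forall fun h => ?_)
  simp only [zonalMap_apply]
  rw [integral_smul_const]
  have h1 := congrArg (Complex.ofReal) (integral_zonalFun_convolution hn k l h)
  rw [← integral_complex_ofReal] at h1
  push_cast at h1
  rw [h1, smul_smul]
  split_ifs <;> simp

theorem harmProj_comp (hn : 3 ≤ n) (k l : ℕ) (f : L2SO n) :
    harmProj n k (harmProj n l f) = if k = l then harmProj n l f else 0 := by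
  rw [harmProj_apply, harmProj_apply, map_smul, convOp_zonalMap_comp hn]
  split_ifs with h
  · subst h
    have : (mult (n - 2) k : ℂ) ≠ 0 := by exact_mod_cast (mult_pos (by omega) k).ne'
    rw [smul_smul, smul_smul]
    congr 1
    field_simp
  · simp

/-- P_k is real and P_k(g⁻¹) = P_k(g). -/
theorem inner_harmProj (k : ℕ) (f h : L2SO n) :
    inner ℂ (harmProj n k f) h = inner ℂ f (harmProj n k h) := by
  rw [harmProj_apply, harmProj_apply, inner_smul_left, inner_smul_right, Complex.conj_ofReal,
    ← inner_conj_symm, inner_convOp, inner_convOp, ← integral_conj,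
    ← integral_inv_eq_self (fun g => zonalMap k g * inner ℂ f (leftReg g h)) (haarProb (SO n))]
  congr 1
  refine integral_congr_ae (Eventually.of_forall fun g => ?_)
  simp only [map_mul, zonalMap_apply, Complex.conj_ofReal, inner_conj_symm, zonalFun_inv,
    inner_leftReg_left]

theorem leftReg_harmProj {u : SO n} (hu : u ∈ SOsub n) (k : ℕ) (f : L2SO n) :
    leftReg u (harmProj n k f) = harmProj n k f := by
  rw [harmProj_apply, leftReg_smul, leftReg_convOp]
  simp only [zonalMap_apply, zonalFun_SOsub_mul k ((SOsub n).inv_mem hu)]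
  rfl

theorem doubleAverage_apply (g : SO n) (f : L2SO n) :
    doubleAverage g f = ∫ w : SOsub n × SOsub n, leftReg ((w.1 : SO n) * g * (w.2 : SO n)) f
        ∂((haarProb (SOsub n)).prod (haarProb (SOsub n))) := rfl

theorem leftReg_doubleAverage {u : SO n} (hu : u ∈ SOsub n) (g : SO n) (f : L2SO n) :
    leftReg u (doubleAverage g f) = doubleAverage g f := by
  rw [doubleAverage_apply, leftReg_integral (integrable_leftReg g f)]
  conv_rhs => rw [← integral_mul_left_eq_self _ ((⟨u, hu⟩, 1) : SOsub n × SOsub n)]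
  refine integral_congr_ae (Eventually.of_forall fun w => ?_)
  simp only [← leftReg_mul, Prod.fst_mul, Prod.snd_mul, Subgroup.coe_mul, one_mul, mul_assoc]

theorem doubleAverage_mul_mul (g : SO n) {u v : SO n} (hu : u ∈ SOsub n) (hv : v ∈ SOsub n) :
    doubleAverage (u * g * v) = doubleAverage g := by
  ext1 f
  rw [doubleAverage_apply, doubleAverage_apply]
  have hmp : MeasurePreserving (Prod.map (· * (⟨u, hu⟩ : SOsub n)) ((⟨v, hv⟩ : SOsub n) * ·))
      ((haarProb (SOsub n)).prod (haarProb (SOsub n)))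
      ((haarProb (SOsub n)).prod (haarProb (SOsub n))) :=
    (measurePreserving_mul_right _ _).prod (measurePreserving_mul_left _ _)
  have hme : MeasurableEmbedding
      (Prod.map (· * (⟨u, hu⟩ : SOsub n)) ((⟨v, hv⟩ : SOsub n) * ·)) :=
    (measurableEmbedding_mulRight _).prodMap (measurableEmbedding_mulLeft _)
  conv_rhs => rw [← hmp.integral_comp hme]
  refine integral_congr_ae (Eventually.of_forall fun w => ?_)
  simp only [Prod.map_fst, Prod.map_snd, Subgroup.coe_mul, mul_assoc]

/-- Absorbing λ(u g u') by right translation turns the weight P_k(h) into P_k(h u'⁻¹ g⁻¹ u⁻¹), whose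
mean over u and u' is P_k(h) P_k(g) by the product formula. -/
theorem harmProj_doubleAverage (hn : 3 ≤ n) (k : ℕ) (g : SO n) (f : L2SO n) :
    harmProj n k (doubleAverage g f) = (zonalFun k g : ℂ) • harmProj n k f := by
  rw [harmProj_apply, harmProj_apply, smul_comm]
  congr 1
  rw [doubleAverage_apply, ← ContinuousLinearMap.integral_comp_comm _ (integrable_leftReg g f)]
  simp only [convOp_leftReg]
  rw [integral_integral_swap]
  swap
  · refine Continuous.integrable_of_hasCompactSupport ?_ (HasCompactSupport.of_compactSpace _)
    simp only [Function.uncurry_def]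
    fun_prop
  rw [convOp_apply, ← integral_smul]
  refine integral_congr_ae (Eventually.of_forall fun h => ?_)
  simp only [zonalMap_apply]
  rw [integral_smul_const, smul_smul]
  congr 1
  have h1 : ∀ w : SOsub n × SOsub n, zonalFun k (h * ((w.1 : SO n) * g * (w.2 : SO n))⁻¹)
      = zonalFun k (h * ((w.2⁻¹ : SOsub n) : SO n) * g⁻¹) := by
    intro w
    rw [← zonalFun_mul_SOsub k (h * ((w.2⁻¹ : SOsub n) : SO n) * g⁻¹)
      ((SOsub n).inv_mem w.1.2)]
    simp only [Subgroup.coe_inv]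
    group
  simp only [h1]
  rw [integral_fun_snd (fun u : SOsub n => ((zonalFun k (h * ((u⁻¹ : SOsub n) : SO n) * g⁻¹) : ℝ) : ℂ)),
    integral_inv_eq_self (fun u : SOsub n => ((zonalFun k (h * (u : SO n) * g⁻¹) : ℝ) : ℂ)),
    integral_complex_ofReal, integral_zonalFun_product hn, zonalFun_inv]
  simp [mul_comm]

/-! ### Completeness -/

/-- By Weierstrass, Φ is a uniform limit of polynomials on [-1, 1], to which it is orthogonal; hence
∫ Φ² = 0, and Haar measure charges open sets. -/
theorem eq_zero_of_integral_polynomial {Φ : ℝ → ℝ} (hΦ : Continuous Φ)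
    (h : ∀ q : ℝ[X], ∫ g : SO n, q.eval (ent 0 g) * Φ (ent 0 g) ∂haarProb (SO n) = 0) (g : SO n) :
    Φ (ent 0 g) = 0 := by
  have hle : ∀ ε > 0, ∫ g : SO n, Φ (ent 0 g) ^ 2 ∂haarProb (SO n)
      ≤ ε * ∫ g : SO n, |Φ (ent 0 g)| ∂haarProb (SO n) := by
    intro ε hε
    obtain ⟨q, hq⟩ := exists_polynomial_near_of_continuousOn (-1) 1 Φ hΦ.continuousOn ε hε
    have e1 : ∫ g : SO n, Φ (ent 0 g) ^ 2 ∂haarProb (SO n)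
        = ∫ g : SO n, (Φ (ent 0 g) - q.eval (ent 0 g)) * Φ (ent 0 g) ∂haarProb (SO n) := by
      simp only [sub_mul, ← pow_two]
      rw [integral_sub (integrable_haarProb (by fun_prop)) (integrable_haarProb (by fun_prop)), h q,
        sub_zero]
    rw [e1, ← integral_const_mul]
    refine integral_mono (integrable_haarProb (by fun_prop)) (integrable_haarProb (by fun_prop))
      fun g => ?_
    refine (le_abs_self _).trans ?_
    rw [abs_mul, abs_sub_comm]
    gcongr
    exact (hq _ (abs_le.mp (abs_ent_le_one 0 g))).le
  have h0 : ∫ g : SO n, Φ (ent 0 g) ^ 2 ∂haarProb (SO n) ≤ 0 := by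
    set B := ∫ g : SO n, |Φ (ent 0 g)| ∂haarProb (SO n) with hB
    have hB0 : 0 ≤ B := integral_nonneg fun g => abs_nonneg _
    refine le_of_forall_pos_le_add fun ε hε => ?_
    have := hle (ε / (B + 1)) (by positivity)
    refine this.trans ?_
    rw [zero_add, div_mul_eq_mul_div, div_le_iff₀ (by positivity)]
    nlinarith
  have h1 : ∫ g : SO n, Φ (ent 0 g) ^ 2 ∂haarProb (SO n) = 0 :=
    le_antisymm h0 (integral_nonneg fun g => sq_nonneg _)
  have hint : Integrable (fun g : SO n => Φ (ent 0 g) ^ 2) (haarProb (SO n)) :=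
    integrable_haarProb (by fun_prop)
  rw [integral_eq_zero_iff_of_nonneg (fun g => sq_nonneg _) hint] at h1
  have h2 : (fun g : SO n => Φ (ent 0 g) ^ 2) = 0 :=
    (Continuous.ae_eq_iff_eq (haarProb (SO n)) ((hΦ.comp (continuous_ent 0)).pow 2)
      continuous_zero).mp h1
  exact pow_eq_zero_iff two_ne_zero |>.mp (congrFun h2 g)

/-- A continuous bi-invariant function that is orthogonal to all zonal spherical functions
vanishes. -/
theorem eq_zero_of_integral_zonalFun (hn : 3 ≤ n) {F : SO n → ℂ} (hF : Continuous F)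
    (hinv : IsBiinvariant F)
    (h : ∀ k, ∫ g : SO n, (zonalFun k g : ℂ) * F g ∂haarProb (SO n) = 0) (g : SO n) : F g = 0 := by
  have hFe : ∀ g, F g = F (cosetRep hn (ent 0 g)) := by
    intro g
    obtain ⟨u, hu, v, hv, hg⟩ := exists_eq_mul_cosetRep_mul hn g
    conv_lhs => rw [hg]
    exact hinv u hu v hv _
  have hc := continuous_cosetRep (n := n) hn
  have hq : ∀ q : ℝ[X], ∫ g : SO n, ((q.eval (ent 0 g) : ℝ) : ℂ) * F g ∂haarProb (SO n) = 0 := by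
    intro q
    obtain ⟨b, hb⟩ := exists_eq_sum_zonal (n - 2) (le_refl q.natDegree)
    have e : ∀ g : SO n, ((q.eval (ent 0 g) : ℝ) : ℂ) * F g
        = ∑ j ∈ Finset.range (q.natDegree + 1), (b j : ℂ) * ((zonalFun j g : ℂ) * F g) := by
      intro g
      conv_lhs => rw [hb]
      rw [eval_finsetSum]
      push_cast
      rw [Finset.sum_mul]
      refine Finset.sum_congr rfl fun j _ => ?_
      simp only [eval_smul, smul_eq_mul, zonalFun]
      push_cast
      ring
    simp only [e]
    rw [integral_finsetSum _ fun j _ => integrable_haarProb (by fun_prop)]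
    simp only [integral_const_mul, h, mul_zero, Finset.sum_const_zero]
  have hre : (F (cosetRep hn (ent 0 g))).re = 0 := by
    refine eq_zero_of_integral_polynomial (n := n) (Φ := fun δ => (F (cosetRep hn δ)).re)
      (by fun_prop) (fun q => ?_) g
    have h1 := congrArg Complex.re (hq q)
    rw [← RCLike.re_eq_complex_re, ← integral_re (integrable_haarProb (by fun_prop))] at h1
    simp only [RCLike.re_eq_complex_re, Complex.re_ofReal_mul, Complex.zero_re, ← hFe] at h1 ⊢
    exact h1
  have him : (F (cosetRep hn (ent 0 g))).im = 0 := by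
    refine eq_zero_of_integral_polynomial (n := n) (Φ := fun δ => (F (cosetRep hn δ)).im)
      (by fun_prop) (fun q => ?_) g
    have h1 := congrArg Complex.im (hq q)
    rw [← RCLike.im_eq_complex_im, ← integral_im (integrable_haarProb (by fun_prop))] at h1
    simp only [RCLike.im_eq_complex_im, Complex.im_ofReal_mul, Complex.zero_im, ← hFe] at h1 ⊢
    exact h1
  rw [hFe]
  exact Complex.ext hre him

/-- The matrix coefficient g ↦ ⟨v, λ(g) v⟩ is continuous, biinvariant and orthogonal to every P_k,
so it vanishes; its value at 1 is ‖v‖². -/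
theorem eq_zero_of_harmProj_eq_zero (hn : 3 ≤ n) {v : L2SO n}
    (hinv : ∀ u ∈ SOsub n, leftReg u v = v) (h : ∀ k, harmProj n k v = 0) : v = 0 := by
  have h1 := eq_zero_of_integral_zonalFun hn (F := fun g => inner ℂ v (leftReg g v))
    (by fun_prop) (fun u hu w hw g => by
      simp only
      rw [leftReg_mul, hinv w hw, leftReg_mul, ← inner_conj_symm, inner_leftReg_left,
        hinv u⁻¹ ((SOsub n).inv_mem hu), inner_conj_symm]) (fun k => by
      have h2 := h k
      rw [harmProj_apply, smul_eq_zero] at h2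
      have h3 := h2.resolve_left (by exact_mod_cast (mult_pos (by omega) k).ne')
      have h4 := inner_convOp (zonalMap k) v v
      rw [h3, inner_zero_right] at h4
      exact h4.symm) 1
  simp only [leftReg_one] at h1
  exact inner_self_eq_zero.mp h1

end

section

open Polynomial

variable {n : ℕ}

/-! ### Kernels -/

theorem integrable_coe_L2SO (f : L2SO n) : Integrable f (haarProb (SO n)) :=
  (Lp.memLp f).integrable one_le_two

theorem integrable_continuous_mul_L2SO {w : SO n → ℂ} (hw : Continuous w) (f : L2SO n) :
    Integrable (fun y => w y * f y) (haarProb (SO n)) := by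
  have hb := ContinuousMap.norm_coe_le_norm (⟨w, hw⟩ : C(SO n, ℂ))
  exact (integrable_coe_L2SO f).bdd_mul hw.aestronglyMeasurable (Eventually.of_forall hb)

theorem integrable_inner_translate (w : C(SO n, ℂ)) (f h : L2SO n) :
    Integrable (fun z : SO n × SO n => w z.1 * inner ℂ (h z.2) (f (z.1⁻¹ * z.2)))
      ((haarProb (SO n)).prod (haarProb (SO n))) := by
  have h1 : Integrable (fun z : SO n × SO n => inner ℂ (h z.1) (f z.2))
      ((haarProb (SO n)).prod (haarProb (SO n))) := by
    have h0 : Integrable (fun x => (starRingEnd ℂ) (h x)) (haarProb (SO n)) :=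
      (Complex.conjCLE : ℂ →L[ℝ] ℂ).integrable_comp (integrable_coe_L2SO h)
    refine (h0.mul_prod (integrable_coe_L2SO f)).congr (Eventually.of_forall fun z => ?_)
    simp [mul_comm]
  have hmp : MeasurePreserving (fun z : SO n × SO n => (z.2, z.1⁻¹ * z.2))
      ((haarProb (SO n)).prod (haarProb (SO n))) ((haarProb (SO n)).prod (haarProb (SO n))) := by
    have := ((MeasurePreserving.id (haarProb (SO n))).prod
      (Measure.measurePreserving_inv (haarProb (SO n)))).comp
      ((measurePreserving_prod_inv_mul (haarProb (SO n)) (haarProb (SO n))).comp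
        Measure.measurePreserving_swap)
    convert this using 1
    ext1 z
    simp
  have h2 := hmp.integrable_comp_of_integrable h1
  exact h2.bdd_mul (by fun_prop : Continuous fun z : SO n × SO n => w z.1).aestronglyMeasurable
    (Eventually.of_forall fun z => w.norm_coe_le_norm z.1)

theorem memLp_kernel_integral (w : C(SO n, ℂ)) (f : L2SO n) :
    MemLp (fun x => ∫ y, w (x * y⁻¹) * f y ∂haarProb (SO n)) 2 (haarProb (SO n)) := by
  refine MemLp.of_bound (C := ‖w‖ * ∫ y, ‖f y‖ ∂haarProb (SO n)) ?_
    (Eventually.of_forall fun x => ?_)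
  · refine AEStronglyMeasurable.integral_prod_right'
      (f := fun z : SO n × SO n => w (z.1 * z.2⁻¹) * f z.2) ?_
    refine AEStronglyMeasurable.mul ?_ ?_
    · exact (by fun_prop : Continuous fun z : SO n × SO n => w (z.1 * z.2⁻¹)).aestronglyMeasurable
    · exact (integrable_coe_L2SO f).aestronglyMeasurable.comp_snd
  · rw [← integral_const_mul]
    refine norm_integral_le_of_norm_le ((integrable_coe_L2SO f).norm.const_mul _)
      (Eventually.of_forall fun y => ?_)
    rw [norm_mul]
    gcongr
    exact w.norm_coe_le_norm _

/-- The operator `convOp w` has the kernel `w(x y⁻¹)`. -/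
theorem hasKernel_convOp (w : C(SO n, ℂ)) :
    HasKernel (haarProb (SO n)) (convOp w) fun x y => w (x * y⁻¹) := by
  intro f
  have hk := memLp_kernel_integral w f
  -- An L_2-valued integral cannot be evaluated pointwise, so the identity is tested against all h
  -- in L_2 and Fubini is applied.
  suffices h : convOp w f = hk.toLp _ by rw [h]; exact hk.coeFn_toLp
  refine ext_inner_left ℂ fun h => ?_
  rw [inner_convOp, L2.inner_def]
  have e1 : ∫ g, w g * inner ℂ h (leftReg g f) ∂haarProb (SO n)
      = ∫ g, ∫ x, w g * inner ℂ (h x) (f (g⁻¹ * x)) ∂haarProb (SO n) ∂haarProb (SO n) := by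
    refine integral_congr_ae (Eventually.of_forall fun g => ?_)
    simp only
    rw [L2.inner_def, integral_const_mul]
    congr 1
    refine integral_congr_ae ?_
    filter_upwards [coeFn_leftReg g f] with x hx
    rw [hx]
  rw [e1, integral_integral_swap (integrable_inner_translate w f h)]
  refine integral_congr_ae ?_
  filter_upwards [hk.coeFn_toLp] with x hx
  rw [hx, ← integral_div_left_eq_self _ (haarProb (SO n)) x, ← integral_inner]
  · refine integral_congr_ae (Eventually.of_forall fun y => ?_)
    simp only [div_eq_mul_inv, mul_inv_rev, inv_inv, inv_mul_cancel_right]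
    simp only [RCLike.inner_apply]
    ring
  · exact integrable_continuous_mul_L2SO (by fun_prop) f

theorem integral_norm_sq_L2SO (f : L2SO n) : ∫ x, ‖f x‖ ^ 2 ∂haarProb (SO n) = ‖f‖ ^ 2 := by
  have h := L2.inner_def (𝕜 := ℂ) f f
  simp only [inner_self_eq_norm_sq_to_K] at h
  have h2 : ((‖f‖ ^ 2 : ℝ) : ℂ) = ((∫ x, ‖f x‖ ^ 2 ∂haarProb (SO n) : ℝ) : ℂ) := by
    rw [← integral_complex_ofReal]
    push_cast
    exact h
  exact_mod_cast h2.symm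

theorem floor_mult_le (hn : 3 ≤ n) (k : ℕ) : ((⌊mult (n - 2) k⌋₊ : ℕ) : ℝ) ≤ mult (n - 2) k :=
  Nat.floor_le (mult_pos (by omega) k).le

theorem tendsto_of_norm_le_rpow {c : ℕ → ℂ} {A β : ℝ} (hβ : 0 < β)
    (hc : ∀ k : ℕ, ‖c k‖ ≤ A * (k + 1 : ℝ) ^ (-β)) : Tendsto c cofinite (𝓝 0) := by
  rw [Nat.cofinite_eq_atTop]
  refine squeeze_zero_norm hc ?_
  have h1 : Tendsto (fun k : ℕ => ((k : ℝ) + 1)) atTop atTop :=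
    tendsto_atTop_add_const_right _ _ tendsto_natCast_atTop_atTop
  simpa using ((tendsto_rpow_neg_atTop hβ).comp h1).const_mul A

variable [NeZero n]

theorem hasKernel_harmProj (k : ℕ) :
    HasKernel (haarProb (SO n)) (harmProj n k)
      fun x y => (mult (n - 2) k : ℂ) * zonalFun k (x * y⁻¹) := by
  intro f
  rw [harmProj_apply]
  filter_upwards [Lp.coeFn_smul (mult (n - 2) k : ℂ) (convOp (zonalMap k) f),
    hasKernel_convOp (zonalMap k) f] with x h1 h2
  rw [h1, Pi.smul_apply, h2, smul_eq_mul, ← integral_const_mul]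
  simp only [zonalMap_apply, mul_assoc]

/-- The range of E_k has the reproducing kernel K_x(y) = m_k P_k(x y⁻¹), with ‖K_x‖² = m_k. Bessel's
inequality gives Σ |e_i(x)|² ≤ m_k for almost every x, and integration over the probability space
gives r ≤ m_k. -/
theorem card_orthonormal_le (hn : 3 ≤ n) {k r : ℕ} {e : Fin r → L2SO n} (he : Orthonormal ℂ e)
    (hr : ∀ i, harmProj n k (e i) = e i) : (r : ℝ) ≤ mult (n - 2) k := by
  set m := mult (n - 2) k with hm
  have hm0 : 0 < m := mult_pos (by omega) k
  set κ : SO n → C(SO n, ℂ) := fun x => ⟨fun y => (m : ℂ) * zonalFun k (x * y⁻¹), by fun_prop⟩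
    with hκ
  set K : SO n → L2SO n := fun x => ContinuousMap.toLp 2 (haarProb (SO n)) ℂ (κ x) with hK
  have hKae : ∀ x, K x =ᵐ[haarProb (SO n)] κ x := fun x => ContinuousMap.coeFn_toLp _ _
  have hKnorm : ∀ x, ‖K x‖ ^ 2 = m := by
    intro x
    rw [← integral_norm_sq_L2SO]
    have e1 : ∫ y, ‖K x y‖ ^ 2 ∂haarProb (SO n)
        = ∫ y, m ^ 2 * (zonalFun k (x / y) * zonalFun k (x / y)) ∂haarProb (SO n) := by
      refine integral_congr_ae ?_
      filter_upwards [hKae x] with y hy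
      rw [hy]
      simp only [hκ, ContinuousMap.coe_mk, norm_mul, Complex.norm_real, mul_pow,
        Real.norm_eq_abs, sq_abs, div_eq_mul_inv]
      ring
    rw [e1, integral_const_mul,
      integral_div_left_eq_self (fun y => zonalFun k y * zonalFun k y) (haarProb (SO n)) x,
      integral_zonalFun_mul hn, if_pos rfl, ← hm]
    field_simp
  have hpt : ∀ i, ∀ᵐ x ∂haarProb (SO n), e i x = inner ℂ (K x) (e i) := by
    intro i
    filter_upwards [hasKernel_harmProj k (e i)] with x hx
    rw [hr i] at hx
    rw [hx, L2.inner_def]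
    refine integral_congr_ae ?_
    filter_upwards [hKae x] with y hy
    rw [hy]
    simp only [hκ, ContinuousMap.coe_mk, RCLike.inner_apply, map_mul, Complex.conj_ofReal]
    ring
  have hsum : ∀ᵐ x ∂haarProb (SO n), ∑ i, ‖e i x‖ ^ 2 ≤ m := by
    filter_upwards [ae_all_iff.mpr hpt] with x hx
    rw [← hKnorm x]
    refine le_trans (le_of_eq ?_) (he.sum_inner_products_le (K x) (s := Finset.univ))
    refine Finset.sum_congr rfl fun i _ => ?_
    rw [hx i, norm_inner_symm]
  have hint : ∀ i, Integrable (fun x => ‖e i x‖ ^ 2) (haarProb (SO n)) :=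
    fun i => (Lp.memLp (e i)).integrable_norm_pow two_ne_zero
  calc (r : ℝ) = ∑ i, ‖e i‖ ^ 2 := by simp [he.1]
    _ = ∫ x, ∑ i, ‖e i x‖ ^ 2 ∂haarProb (SO n) := by
        rw [integral_finsetSum _ fun i _ => hint i]
        simp only [integral_norm_sq_L2SO]
    _ ≤ ∫ x, m ∂haarProb (SO n) :=
        integral_mono_ae (integrable_finsetSum _ fun i _ => hint i) (integrable_const _) hsum
    _ = m := by simp

theorem rank_submodule_le_of_orthonormal {H : Type*} [NormedAddCommGroup H]
    [InnerProductSpace ℂ H] {R : Submodule ℂ H} {m : ℕ}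
    (h : ∀ (r : ℕ) (e : Fin r → H), Orthonormal ℂ e → (∀ i, e i ∈ R) → r ≤ m) :
    Module.rank ℂ R ≤ (m : Cardinal) := by
  refine rank_le fun s hs => ?_
  have hfd : FiniteDimensional ℂ (Submodule.span ℂ (s : Set R)) :=
    FiniteDimensional.span_finset ℂ s
  have b := stdOrthonormalBasis ℂ (Submodule.span ℂ (s : Set R))
  have he : Orthonormal ℂ fun i => ((b i : R) : H) :=
    (b.orthonormal.comp_linearIsometry (Submodule.span ℂ (s : Set R)).subtypeₗᵢ).comp_linearIsometry
      R.subtypeₗᵢ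
  rw [← finrank_span_finset_eq_card hs]
  exact h _ _ he fun i => (b i : R).2

/-- The floor avoids having to know that `mult` is an integer. -/
theorem rank_harmProj_le (hn : 3 ≤ n) (k : ℕ) :
    LinearMap.rank (harmProj n k : L2SO n →ₗ[ℂ] L2SO n)
      ≤ ((⌊mult (n - 2) k⌋₊ : ℕ) : Cardinal) := by
  refine rank_submodule_le_of_orthonormal fun r e he hR => Nat.le_floor ?_
  refine card_orthonormal_le hn he fun i => ?_
  obtain ⟨f, hf⟩ := hR i
  rw [← hf]
  exact (harmProj_comp hn k k f).trans (if_pos rfl)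

theorem isProjFamily_harmProj (hn : 3 ≤ n) :
    IsProjFamily (harmProj n) fun k => ⌊mult (n - 2) k⌋₊ where
  idem k f := by rw [harmProj_comp hn, if_pos rfl]
  orth k l h f := by rw [harmProj_comp hn, if_neg h]
  symm k f g := inner_harmProj k f g
  rank_le := rank_harmProj_le hn

theorem tendsto_zonalFun (hn : 3 ≤ n) {g : SO n} (hg : |ent 0 g| < 1) :
    Tendsto (fun k => (zonalFun k g : ℂ)) cofinite (𝓝 0) := by
  obtain ⟨A, -, hA⟩ := zonalDeriv_bound (d := n - 2) (by omega) (abs_nonneg _) hg 0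
  have hd : (0 : ℝ) < ((n - 2 : ℕ) : ℝ) / 2 := by
    have : 0 < n - 2 := by omega
    positivity
  refine tendsto_of_norm_le_rpow hd (A := A) fun k => ?_
  rw [Complex.norm_real, Real.norm_eq_abs]
  have := hA k (ent 0 g) le_rfl
  simpa [zonalDeriv, zonalFun] using this

/-- The spectral decomposition of the double average. -/
theorem doubleAverage_eq_tsum (hn : 3 ≤ n) {g : SO n} (hg : |ent 0 g| < 1) :
    doubleAverage g = ∑' k, (zonalFun k g : ℂ) • harmProj n k := by
  have hE := isProjFamily_harmProj (n := n) hn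
  have hs := (hE.summable_smul (tendsto_zonalFun hn hg)).hasSum
  rw [← sub_eq_zero]
  set S := ∑' k, (zonalFun k g : ℂ) • harmProj n k with hS
  ext1 f
  rw [_root_.zero_apply]
  have hsf : HasSum (fun k => (zonalFun k g : ℂ) • harmProj n k f) (S f) := by
    exact hs.mapL (ContinuousLinearMap.apply ℂ (L2SO n) f)
  -- The difference of both sides at f is left SO(n-1)-invariant, and E_l maps both terms to P_l(g)
  -- E_l f.
  refine eq_zero_of_harmProj_eq_zero hn (fun u hu => ?_) fun l => ?_
  · have h1 : leftReg u (S f) = S f := by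
      have := hsf.mapL (leftRegIsometry u).toContinuousLinearMap
      have h2 : (fun k => (leftRegIsometry u).toContinuousLinearMap
          ((zonalFun k g : ℂ) • harmProj n k f))
          = fun k => (zonalFun k g : ℂ) • harmProj n k f := by
        ext1 k
        change leftReg u _ = _
        rw [leftReg_smul, leftReg_harmProj hu]
      rw [h2] at this
      exact this.unique hsf
    rw [_root_.sub_apply, sub_eq_add_neg, leftReg_add, leftReg_doubleAverage hu,
      ← neg_one_smul ℂ (S f), leftReg_smul, h1]
  · have h1 : harmProj n l (S f) = (zonalFun l g : ℂ) • harmProj n l f := by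
      have := hsf.mapL (harmProj n l)
      refine this.unique ?_
      have h2 : (fun k => harmProj n l ((zonalFun k g : ℂ) • harmProj n k f))
          = fun k => if k = l then (zonalFun l g : ℂ) • harmProj n l f else 0 := by
        ext1 k
        rw [map_smul, harmProj_comp hn]
        by_cases hkl : k = l
        · subst hkl; simp
        · rw [if_neg (Ne.symm hkl), if_neg hkl, smul_zero]
      rw [h2]
      exact hasSum_ite_eq l _
    rw [_root_.sub_apply, map_sub, harmProj_doubleAverage hn, h1, sub_self]

end

section

/-! ### The orders of smoothness -/

section Orders

variable {n : ℕ} {p : ℝ≥0∞}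

theorem ne_zero_of_ofReal_lt {a : ℝ} (hp : ENNReal.ofReal a < p) : p ≠ 0 :=
  (pos_of_gt hp).ne'

theorem criticalOrder_eq (hn : 3 ≤ n) :
    criticalOrder n p = ((n - 2 : ℕ) : ℝ) / 2 - (((n - 2 : ℕ) : ℝ) + 1) * (p⁻¹).toReal := by
  rw [criticalOrder, Nat.cast_sub (by omega)]
  push_cast
  ring

theorem criticalOrder_le (hn : 3 ≤ n) : criticalOrder n p ≤ ((n - 2 : ℕ) : ℝ) / 2 := by
  rw [criticalOrder_eq hn]
  have : 0 ≤ (p⁻¹).toReal := ENNReal.toReal_nonneg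
  have : 0 ≤ (((n - 2 : ℕ) : ℝ) + 1) * (p⁻¹).toReal := by positivity
  linarith

/-- The threshold for p is where α₀ = 0: its inverse is (n-2)/(2(n-1)). -/
theorem criticalOrder_pos (hn : 3 ≤ n) (hp : ENNReal.ofReal (2 + 2 / ((n : ℝ) - 2)) < p) :
    0 < criticalOrder n p := by
  have hn' : (3 : ℝ) ≤ n := by exact_mod_cast hn
  have h2 : 0 < (n : ℝ) - 2 := by linarith
  have ha : 0 < 2 + 2 / ((n : ℝ) - 2) := by positivity
  have h1 : (p⁻¹).toReal < (2 + 2 / ((n : ℝ) - 2))⁻¹ := by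
    rw [← ENNReal.toReal_ofReal ha.le, ← ENNReal.toReal_inv]
    exact (ENNReal.toReal_lt_toReal (ENNReal.inv_ne_top.mpr (ne_zero_of_ofReal_lt hp))
      (ENNReal.inv_ne_top.mpr (ENNReal.ofReal_pos.mpr ha).ne')).mpr (ENNReal.inv_lt_inv.mpr hp)
  have h3 : (2 + 2 / ((n : ℝ) - 2))⁻¹ = ((n : ℝ) - 2) / (2 * ((n : ℝ) - 1)) := by
    have : (n : ℝ) - 1 ≠ 0 := by linarith
    field_simp
    ring
  rw [h3, lt_div_iff₀ (by linarith)] at h1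
  rw [criticalOrder]
  linarith

theorem smoothnessOrder_pos {ε : ℝ} (h0 : 0 < ε) (h1 : ε < criticalOrder n p) :
    0 < smoothnessOrder n p ε := by
  rw [smoothnessOrder]
  split_ifs <;> linarith

theorem smoothnessOrder_le {ε : ℝ} (h0 : 0 < ε) : smoothnessOrder n p ε ≤ criticalOrder n p := by
  rw [smoothnessOrder]
  split_ifs <;> linarith

/-- Derivatives are controlled only at orders strictly below α₀. Equality of the floor with α₀ would
make α₀ an integer, and in that case ε has been subtracted. -/
theorem floor_smoothnessOrder_lt {ε : ℝ} (h0 : 0 < ε) (h1 : ε < criticalOrder n p) :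
    (⌊smoothnessOrder n p ε⌋₊ : ℝ) < criticalOrder n p := by
  have h2 := Nat.floor_le (smoothnessOrder_pos h0 h1).le
  by_cases h : ∃ m : ℤ, criticalOrder n p = m
  · rw [smoothnessOrder, if_pos h] at h2 ⊢
    linarith
  · rw [smoothnessOrder, if_neg h] at h2 ⊢
    exact lt_of_le_of_ne h2 fun he => h ⟨⌊criticalOrder n p⌋₊, by rw [← he]; simp⟩

end Orders

theorem exists_abs_le_of_isCompact {K : Set ℝ} (hK : IsCompact K) (h : K ⊆ Ioo (-1) 1) :
    ∃ r : ℝ, 0 ≤ r ∧ r < 1 ∧ ∀ x ∈ K, |x| ≤ r := by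
  rcases K.eq_empty_or_nonempty with rfl | hne
  · exact ⟨0, le_rfl, one_pos, by simp⟩
  · obtain ⟨x, hx, hmax⟩ := hK.exists_isMaxOn hne continuous_abs.continuousOn
    exact ⟨|x|, abs_nonneg x, abs_lt.mpr (h hx), fun y hy => hmax hy⟩

theorem HolderClass.congr {α : ℝ} {J : Set ℝ} {f g : ℝ → ℂ} (hf : HolderClass α J f)
    (h : EqOn g f J) : HolderClass α J g := by
  refine ⟨hf.1.congr h, fun K hKJ hK => ?_⟩
  obtain ⟨C, hC⟩ := hf.2 K hKJ hK
  refine ⟨C, fun x hx y hy => ?_⟩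
  rw [iteratedDerivWithin_congr h (hKJ hx), iteratedDerivWithin_congr h (hKJ hy)]
  exact hC x hx y hy

theorem iteratedDerivWithin_eqOn_of_hasDerivAt {J : Set ℝ} (hJ : IsOpen J) {F : ℕ → ℝ → ℂ}
    {m : ℕ} (h : ∀ j < m, ∀ x ∈ J, HasDerivAt (F j) (F (j + 1) x) x) {j : ℕ} (hj : j ≤ m) :
    EqOn (iteratedDerivWithin j (F 0) J) (F j) J := by
  induction j with
  | zero => intro x _; simp
  | succ j ih =>
    intro x hx
    have h1 := ih (by omega)
    rw [iteratedDerivWithin_succ, derivWithin_congr h1 (h1 hx)]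
    exact ((h j (by omega) x hx).hasDerivWithinAt).derivWithin (hJ.uniqueDiffOn x hx)

theorem contDiffOn_of_hasDerivAt {J : Set ℝ} (hJ : IsOpen J) {F : ℕ → ℝ → ℂ}
    {m : ℕ} (h : ∀ j < m, ∀ x ∈ J, HasDerivAt (F j) (F (j + 1) x) x)
    (hc : ContinuousOn (F m) J) : ContDiffOn ℝ m (F 0) J := by
  refine (contDiffOn_nat_iff_continuousOn_differentiableOn_deriv hJ.uniqueDiffOn).mpr
    ⟨fun j hj => ?_, fun j hj => ?_⟩
  · refine ContinuousOn.congr ?_ (iteratedDerivWithin_eqOn_of_hasDerivAt hJ h hj)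
    rcases hj.lt_or_eq with hj | rfl
    · exact fun x hx => (h j hj x hx).continuousAt.continuousWithinAt
    · exact hc
  · refine DifferentiableOn.congr ?_ (iteratedDerivWithin_eqOn_of_hasDerivAt hJ h hj.le)
    exact fun x hx => (h j hj x hx).differentiableAt.differentiableWithinAt

/-! ### The sequences of derivatives of the zonal polynomials -/

/-- The `j`-th derivatives at `x` of the zonal polynomials for `SO(n)`. -/
noncomputable def zonalSeq (n j : ℕ) (x : ℝ) : ℕ → ℂ := fun k => (zonalDeriv (n - 2) j k x : ℂ)

section Bounds

variable {n : ℕ} {p : ℝ≥0∞}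

theorem exists_weightedNorm_zonalSeq_sub_le (hn : 3 ≤ n) (hp : p ≠ 0) {j : ℕ}
    (hj : (j : ℝ) < criticalOrder n p) {s : ℝ} (hs0 : 0 ≤ s) (hs1 : s < 1)
    (hs : s ≤ criticalOrder n p - j) {r : ℝ} (hr0 : 0 ≤ r) (hr : r < 1) :
    ∃ M : ℝ≥0, ∀ x y : ℝ, |x| ≤ r → |y| ≤ r →
      weightedNorm (mult (n - 2)) p (zonalSeq n j y - zonalSeq n j x)
        ≤ M * ENNReal.ofReal (|y - x| ^ s) := by
  obtain ⟨A, hA, h⟩ := zonalDeriv_sub_bound (d := n - 2) (by omega) hr0 hr j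
  rw [criticalOrder_eq hn] at hj hs
  obtain ⟨M, hM⟩ := exists_weightedNorm_mult_le (d := n - 2) (by omega) hp
    (β := ((n - 2 : ℕ) : ℝ) / 2 - j) (s := s) (by linarith) hs0 hs1 (by linarith) hA
  refine ⟨M, fun x y hx hy => hM _ (abs_nonneg _) _ fun k => ?_⟩
  simp only [zonalSeq, Pi.sub_apply]
  rw [← Complex.ofReal_sub, Complex.norm_real, Real.norm_eq_abs, neg_sub]
  exact h k x y hx hy

theorem exists_weightedNorm_zonalSeq_slope_le (hn : 3 ≤ n) (hp : p ≠ 0) {j : ℕ}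
    (hj : ((j + 1 : ℕ) : ℝ) < criticalOrder n p) {s : ℝ} (hs0 : 0 ≤ s) (hs1 : s < 1)
    (hs : s ≤ criticalOrder n p - (j + 1 : ℕ)) {r : ℝ} (hr0 : 0 ≤ r) (hr : r < 1) :
    ∃ M : ℝ≥0, ∀ x y : ℝ, |x| ≤ r → |y| ≤ r → y ≠ x →
      weightedNorm (mult (n - 2)) p (((y - x : ℝ) : ℂ)⁻¹ • (zonalSeq n j y - zonalSeq n j x)
        - zonalSeq n (j + 1) x) ≤ M * ENNReal.ofReal (|y - x| ^ s) := by
  obtain ⟨A, hA, h⟩ := zonalDeriv_slope_bound (d := n - 2) (by omega) hr0 hr j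
  rw [criticalOrder_eq hn] at hj hs
  obtain ⟨M, hM⟩ := exists_weightedNorm_mult_le (d := n - 2) (by omega) hp
    (β := ((n - 2 : ℕ) : ℝ) / 2 - (j + 1 : ℕ)) (s := s) (by linarith) hs0 hs1 (by linarith) hA
  refine ⟨M, fun x y hx hy hxy => hM _ (abs_nonneg _) _ fun k => ?_⟩
  simp only [zonalSeq, Pi.sub_apply, Pi.smul_apply, smul_eq_mul]
  rw [← Complex.ofReal_sub, ← Complex.ofReal_inv, ← Complex.ofReal_mul, ← Complex.ofReal_sub,
    Complex.norm_real, Real.norm_eq_abs, neg_sub]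
  exact h k x y hx hy hxy

theorem weightedNorm_zonalSeq_lt_top (hn : 3 ≤ n) (hp : p ≠ 0) {j : ℕ}
    (hj : (j : ℝ) < criticalOrder n p) {x : ℝ} (hx : |x| < 1) :
    weightedNorm (mult (n - 2)) p (zonalSeq n j x) < ∞ := by
  obtain ⟨A, hA, h⟩ := zonalDeriv_bound (d := n - 2) (by omega) (abs_nonneg x) hx j
  rw [criticalOrder_eq hn] at hj
  obtain ⟨M, hM⟩ := exists_weightedNorm_mult_le (d := n - 2) (by omega) hp
    (β := ((n - 2 : ℕ) : ℝ) / 2 - j) (s := 0) (by linarith) le_rfl one_pos (by linarith) hA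
  -- At h = 1 the minimum is 1, so the increment estimate becomes a plain bound for the norm.
  refine (hM 1 zero_le_one _ fun k => ?_).trans_lt
    (ENNReal.mul_lt_top ENNReal.coe_lt_top ENNReal.ofReal_lt_top)
  rw [mul_one, min_eq_left (by linarith [k.cast_nonneg (α := ℝ)]), mul_one, zonalSeq,
    Complex.norm_real, Real.norm_eq_abs, neg_sub]
  exact h k x le_rfl

theorem tendsto_zonalSeq (hn : 3 ≤ n) {j : ℕ} (hj : (j : ℝ) < criticalOrder n p) {x : ℝ}
    (hx : |x| < 1) : Tendsto (zonalSeq n j x) cofinite (𝓝 0) := by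
  obtain ⟨A, hA, h⟩ := zonalDeriv_bound (d := n - 2) (by omega) (abs_nonneg x) hx j
  refine tendsto_of_norm_le_rpow (A := A) (β := ((n - 2 : ℕ) : ℝ) / 2 - j)
    (by linarith [criticalOrder_le (p := p) hn]) fun k => ?_
  rw [zonalSeq, Complex.norm_real, Real.norm_eq_abs, neg_sub]
  exact h k x le_rfl

theorem exists_exponent {t : ℝ} (ht : 0 < t) : ∃ s : ℝ, 0 < s ∧ s < 1 ∧ s ≤ t :=
  ⟨min (1 / 2) t, by positivity, (min_le_left _ _).trans_lt (by norm_num), min_le_right _ _⟩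

theorem tendsto_mul_ofReal_abs_sub_rpow (M : ℝ≥0) {s : ℝ} (hs : 0 < s) (x : ℝ) :
    Tendsto (fun y : ℝ => (M : ℝ≥0∞) * ENNReal.ofReal (|y - x| ^ s)) (𝓝 x) (𝓝 0) := by
  have h1 : Tendsto (fun y : ℝ => |y - x| ^ s) (𝓝 x) (𝓝 0) := by
    have : Continuous fun y : ℝ => |y - x| ^ s :=
      (continuous_abs.comp (continuous_id.sub continuous_const)).rpow_const fun _ => Or.inr hs.le
    simpa [Real.zero_rpow hs.ne'] using this.tendsto x
  have h2 := ENNReal.Tendsto.const_mul (a := (M : ℝ≥0∞)) (ENNReal.tendsto_ofReal h1)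
    (Or.inr ENNReal.coe_ne_top)
  simpa using h2

theorem exists_radius {x : ℝ} (hx : |x| < 1) : ∃ r : ℝ, 0 ≤ r ∧ r < 1 ∧ |x| ≤ r ∧
    ∀ᶠ y in 𝓝 x, |y| ≤ r := by
  obtain ⟨r, h1, h2⟩ := exists_between hx
  exact ⟨r, (abs_nonneg x).trans h1.le, h2, h1.le,
    (continuous_abs.continuousAt.eventually_lt_const h1).mono fun _ h => h.le⟩

theorem tendsto_weightedNorm_zonalSeq_sub (hn : 3 ≤ n) (hp : p ≠ 0) {j : ℕ}
    (hj : (j : ℝ) < criticalOrder n p) {x : ℝ} (hx : |x| < 1) :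
    Tendsto (fun y => weightedNorm (mult (n - 2)) p (zonalSeq n j y - zonalSeq n j x))
      (𝓝 x) (𝓝 0) := by
  obtain ⟨s, hs0, hs1, hs⟩ := exists_exponent (sub_pos.mpr hj)
  obtain ⟨r, hr0, hr, hxr, hy⟩ := exists_radius hx
  obtain ⟨M, hM⟩ := exists_weightedNorm_zonalSeq_sub_le hn hp hj hs0.le hs1 hs hr0 hr
  exact tendsto_of_tendsto_of_tendsto_of_le_of_le' tendsto_const_nhds
    (tendsto_mul_ofReal_abs_sub_rpow M hs0 x) (Eventually.of_forall fun _ => zero_le)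
    (hy.mono fun y hy => hM x y hxr hy)

theorem tendsto_weightedNorm_zonalSeq_slope (hn : 3 ≤ n) (hp : p ≠ 0) {j : ℕ}
    (hj : ((j + 1 : ℕ) : ℝ) < criticalOrder n p) {x : ℝ} (hx : |x| < 1) :
    Tendsto (fun y => weightedNorm (mult (n - 2)) p
      (((y - x : ℝ) : ℂ)⁻¹ • (zonalSeq n j y - zonalSeq n j x) - zonalSeq n (j + 1) x))
      (𝓝[≠] x) (𝓝 0) := by
  obtain ⟨s, hs0, hs1, hs⟩ := exists_exponent (sub_pos.mpr hj)
  obtain ⟨r, hr0, hr, hxr, hy⟩ := exists_radius hx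
  obtain ⟨M, hM⟩ := exists_weightedNorm_zonalSeq_slope_le hn hp hj hs0.le hs1 hs hr0 hr
  refine tendsto_of_tendsto_of_tendsto_of_le_of_le' tendsto_const_nhds
    ((tendsto_mul_ofReal_abs_sub_rpow M hs0 x).mono_left nhdsWithin_le_nhds)
    (Eventually.of_forall fun _ => zero_le) ?_
  filter_upwards [nhdsWithin_le_nhds hy, self_mem_nhdsWithin] with y hy hne
  exact hM x y hxr hy hne

end Bounds

end

section

variable {n : ℕ} [NeZero n] {p : ℝ≥0∞}

/-! ### Smoothness of the double averages -/

/-- The operator that acts by `c k` on the range of `harmProj n k`. -/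
noncomputable def harmSeries (n : ℕ) [NeZero n] (c : ℕ → ℂ) : L2SO n →L[ℂ] L2SO n :=
  ∑' k, c k • harmProj n k

theorem harmSeries_sub (hn : 3 ≤ n) {c c' : ℕ → ℂ} (hc : Tendsto c cofinite (𝓝 0))
    (hc' : Tendsto c' cofinite (𝓝 0)) :
    harmSeries n c - harmSeries n c' = harmSeries n (c - c') := by
  have hE := isProjFamily_harmProj (n := n) hn
  rw [harmSeries, harmSeries, harmSeries,
    ← (hE.summable_smul hc).tsum_sub (hE.summable_smul hc')]
  simp only [Pi.sub_apply, sub_smul]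

theorem smul_harmSeries (hn : 3 ≤ n) {c : ℕ → ℂ} (hc : Tendsto c cofinite (𝓝 0)) (a : ℂ) :
    a • harmSeries n c = harmSeries n (a • c) := by
  have hE := isProjFamily_harmProj (n := n) hn
  rw [harmSeries, harmSeries, ← (hE.summable_smul hc).tsum_const_smul a]
  simp only [Pi.smul_apply, smul_eq_mul, smul_smul]

theorem schattenNorm_harmSeries_le (hn : 3 ≤ n) (hp : p ≠ 0) {c : ℕ → ℂ}
    (hc : Tendsto c cofinite (𝓝 0)) :
    schattenNorm p (harmSeries n c) ≤ weightedNorm (mult (n - 2)) p c :=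
  (isProjFamily_harmProj hn).schattenNorm_tsum_le hc (floor_mult_le hn) hp

theorem tendsto_sub_zero {c c' : ℕ → ℂ} (hc : Tendsto c cofinite (𝓝 0))
    (hc' : Tendsto c' cofinite (𝓝 0)) : Tendsto (c - c') cofinite (𝓝 0) := by
  have := hc.sub hc'
  rwa [sub_zero] at this

/-- On null sequences c ↦ Σ c_k E_k is linear and does not increase the norm from weighted ℓ_p to
S_p. The derivatives of T are thus the images of the sequences P_k^(j)(x), and every estimate
transfers. -/
theorem holderClassSchatten_harmSeries (hn : 3 ≤ n) (hp : p ≠ 0) {T : ℝ → L2SO n →L[ℂ] L2SO n}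
    (hT : ∀ x ∈ Ioo (-1 : ℝ) 1, harmSeries n (zonalSeq n 0 x) = T x) {α : ℝ} (hα : 0 ≤ α)
    (hα1 : α ≤ criticalOrder n p) (hα2 : (⌊α⌋₊ : ℝ) < criticalOrder n p) :
    HolderClassSchatten p α (Ioo (-1) 1) T := by
  have hlt : ∀ {j : ℕ}, j ≤ ⌊α⌋₊ → (j : ℝ) < criticalOrder n p := fun hj =>
    lt_of_le_of_lt (by exact_mod_cast hj) hα2
  have habs : ∀ {x : ℝ}, x ∈ Ioo (-1 : ℝ) 1 → |x| < 1 := fun hx => abs_lt.mpr hx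
  have hzero : ∀ {j : ℕ} {x : ℝ}, j ≤ ⌊α⌋₊ → |x| < 1 →
      Tendsto (zonalSeq n j x) cofinite (𝓝 0) := fun hj hx => tendsto_zonalSeq hn (hlt hj) hx
  have hsub : ∀ {j : ℕ} {x y : ℝ}, j ≤ ⌊α⌋₊ → |x| < 1 → |y| < 1 →
      schattenNorm p (harmSeries n (zonalSeq n j y) - harmSeries n (zonalSeq n j x))
        ≤ weightedNorm (mult (n - 2)) p (zonalSeq n j y - zonalSeq n j x) := by
    intro j x y hj hx hy
    rw [harmSeries_sub hn (hzero hj hy) (hzero hj hx)]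
    exact schattenNorm_harmSeries_le hn hp (tendsto_sub_zero (hzero hj hy) (hzero hj hx))
  refine ⟨fun j x => harmSeries n (zonalSeq n j x), hT, fun j hj x hx => ⟨⟨?_, ?_⟩, ?_⟩,
    fun j hj x hx => ?_, fun K hKJ hK => ?_⟩
  · exact (isProjFamily_harmProj hn).isCompactOperator_tsum (hzero hj (habs hx))
  · exact (schattenNorm_harmSeries_le hn hp (hzero hj (habs hx))).trans_lt
      (weightedNorm_zonalSeq_lt_top hn hp (hlt hj) (habs hx))
  · refine tendsto_of_tendsto_of_tendsto_of_le_of_le' tendsto_const_nhds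
      ((tendsto_weightedNorm_zonalSeq_sub hn hp (hlt hj) (habs hx)).mono_left nhdsWithin_le_nhds)
      (Eventually.of_forall fun _ => zero_le) ?_
    filter_upwards [self_mem_nhdsWithin] with y hy
    exact hsub hj (habs hx) (habs hy)
  · refine tendsto_of_tendsto_of_tendsto_of_le_of_le' tendsto_const_nhds
      ((tendsto_weightedNorm_zonalSeq_slope hn hp (hlt (j := j + 1) hj) (habs hx)).mono_left
        (nhdsWithin_mono x fun y hy => hy.2))
      (Eventually.of_forall fun _ => zero_le) ?_
    filter_upwards [self_mem_nhdsWithin] with y hy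
    have h1 := hzero hj.le (habs hx)
    have h2 := hzero hj.le (habs hy.1)
    have h3 : Tendsto (((y - x : ℝ) : ℂ)⁻¹ • (zonalSeq n j y - zonalSeq n j x)) cofinite (𝓝 0) := by
      have := (tendsto_sub_zero h2 h1).const_smul ((y - x : ℝ) : ℂ)⁻¹
      rwa [smul_zero] at this
    rw [harmSeries_sub hn h2 h1, smul_harmSeries hn (tendsto_sub_zero h2 h1),
      harmSeries_sub hn h3 (hzero (j := j + 1) hj (habs hx))]
    exact schattenNorm_harmSeries_le hn hp (tendsto_sub_zero h3 (hzero (j := j + 1) hj (habs hx)))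
  · obtain ⟨r, hr0, hr, hKr⟩ := exists_abs_le_of_isCompact hK hKJ
    obtain ⟨M, hM⟩ := exists_weightedNorm_zonalSeq_sub_le (s := α - ⌊α⌋₊) hn hp (hlt le_rfl)
      (sub_nonneg.mpr (Nat.floor_le hα)) (by linarith [Nat.lt_floor_add_one α])
      (by linarith) hr0 hr
    exact ⟨M, fun x hx y hy => (hsub le_rfl (habs (hKJ hy)) (habs (hKJ hx))).trans
      (hM y x (hKr y hy) (hKr x hx))⟩

theorem doubleAverage_cosetRep (hn : 3 ≤ n) (g : SO n) :
    doubleAverage (cosetRep hn (g.1 0 0)) = doubleAverage g := by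
  obtain ⟨u, hu, v, hv, h⟩ := exists_eq_mul_cosetRep_mul hn g
  conv_rhs => rw [h]
  rw [doubleAverage_mul_mul _ hu hv]

theorem holderClassSchatten_doubleAverage (hn : 3 ≤ n) (hp : p ≠ 0) {ε : ℝ} (h0 : 0 < ε)
    (h1 : ε < criticalOrder n p) :
    HolderClassSchatten p (smoothnessOrder n p ε) (Ioo (-1) 1)
      fun δ => doubleAverage (cosetRep hn δ) := by
  refine holderClassSchatten_harmSeries hn hp (fun x hx => ?_) (smoothnessOrder_pos h0 h1).le
    (smoothnessOrder_le h0) (floor_smoothnessOrder_lt h0 h1)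
  have he : ent 0 (cosetRep hn x) = x := ent_cosetRep hn hx.1.le hx.2.le
  rw [doubleAverage_eq_tsum hn (by rw [he]; exact abs_lt.mpr hx), harmSeries]
  simp only [zonalFun, he]
  rfl

end

section

variable {n : ℕ} {p : ℝ≥0∞}

/-! ### Series of zonal polynomials with coefficients in a dual space -/

theorem weightedNorm_mono {w : ℕ → ℝ} {c c' : ℕ → ℂ} (h : ∀ k, ‖c k‖ₑ ≤ ‖c' k‖ₑ) :
    weightedNorm w p c ≤ weightedNorm w p c' := by
  rw [weightedNorm, weightedNorm]
  split_ifs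
  · exact iSup_mono h
  · gcongr with k
    exact h k

/-- The coefficients `a` define a functional of norm at most `C` for the norm
`weightedNorm (mult (n - 2)) p`. -/
def DualBound (n : ℕ) (p : ℝ≥0∞) (C : ℝ≥0) (a : ℕ → ℂ) : Prop :=
  ∀ (F : Finset ℕ) (c : ℕ → ℂ),
    ∑ k ∈ F, ‖c k‖ₑ * ‖a k‖ₑ ≤ C * weightedNorm (mult (n - 2)) p c

namespace DualBound

variable {C : ℝ≥0} {a : ℕ → ℂ}

theorem tsum_enorm_le (ha : DualBound n p C a) (c : ℕ → ℂ) :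
    ∑' k, ‖c k * a k‖ₑ ≤ C * weightedNorm (mult (n - 2)) p c := by
  rw [ENNReal.tsum_eq_iSup_sum]
  refine iSup_le fun F => le_trans (le_of_eq ?_) (ha F c)
  simp only [enorm_mul]

theorem summable (ha : DualBound n p C a) {c : ℕ → ℂ}
    (hc : weightedNorm (mult (n - 2)) p c < ∞) : Summable fun k => c k * a k :=
  Summable.of_enorm
    ((ha.tsum_enorm_le c).trans_lt (ENNReal.mul_lt_top ENNReal.coe_lt_top hc)).ne

theorem enorm_tsum_le (ha : DualBound n p C a) (c : ℕ → ℂ) :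
    ‖∑' k, c k * a k‖ₑ ≤ C * weightedNorm (mult (n - 2)) p c :=
  enorm_tsum_le_tsum_enorm.trans (ha.tsum_enorm_le c)

end DualBound

/-- The `j`-th derivative of the series of zonal polynomials with coefficients `a`. -/
noncomputable def zonalSeries (n : ℕ) (a : ℕ → ℂ) (j : ℕ) (x : ℝ) : ℂ :=
  ∑' k, zonalSeq n j x k * a k

namespace DualBound

variable {C : ℝ≥0} {a : ℕ → ℂ}

theorem summable_zonalSeq (ha : DualBound n p C a) (hn : 3 ≤ n) (hp : p ≠ 0) {j : ℕ}
    (hj : (j : ℝ) < criticalOrder n p) {x : ℝ} (hx : |x| < 1) :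
    Summable fun k => zonalSeq n j x k * a k :=
  ha.summable (weightedNorm_zonalSeq_lt_top hn hp hj hx)

theorem zonalSeries_sub (ha : DualBound n p C a) (hn : 3 ≤ n) (hp : p ≠ 0) {j : ℕ}
    (hj : (j : ℝ) < criticalOrder n p) {x y : ℝ} (hx : |x| < 1) (hy : |y| < 1) :
    zonalSeries n a j y - zonalSeries n a j x = ∑' k, (zonalSeq n j y - zonalSeq n j x) k * a k := by
  rw [zonalSeries, zonalSeries, ← (ha.summable_zonalSeq hn hp hj hy).tsum_sub
    (ha.summable_zonalSeq hn hp hj hx)]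
  simp only [Pi.sub_apply, sub_mul]

theorem enorm_zonalSeries_sub_le (ha : DualBound n p C a) (hn : 3 ≤ n) (hp : p ≠ 0) {j : ℕ}
    (hj : (j : ℝ) < criticalOrder n p) {x y : ℝ} (hx : |x| < 1) (hy : |y| < 1) :
    ‖zonalSeries n a j y - zonalSeries n a j x‖ₑ
      ≤ C * weightedNorm (mult (n - 2)) p (zonalSeq n j y - zonalSeq n j x) := by
  rw [ha.zonalSeries_sub hn hp hj hx hy]
  exact ha.enorm_tsum_le _

theorem continuousAt_zonalSeries (ha : DualBound n p C a) (hn : 3 ≤ n) (hp : p ≠ 0) {j : ℕ}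
    (hj : (j : ℝ) < criticalOrder n p) {x : ℝ} (hx : |x| < 1) :
    ContinuousAt (zonalSeries n a j) x := by
  rw [ContinuousAt, tendsto_iff_edist_tendsto_0]
  simp only [edist_eq_enorm_sub]
  have h := ENNReal.Tendsto.const_mul (a := (C : ℝ≥0∞))
    (tendsto_weightedNorm_zonalSeq_sub hn hp hj hx) (Or.inr ENNReal.coe_ne_top)
  rw [mul_zero] at h
  refine tendsto_of_tendsto_of_tendsto_of_le_of_le' tendsto_const_nhds h
    (Eventually.of_forall fun _ => zero_le) ?_
  filter_upwards [continuous_abs.continuousAt.eventually_lt_const hx] with y hy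
  exact ha.enorm_zonalSeries_sub_le hn hp hj hx hy

theorem hasDerivAt_zonalSeries (ha : DualBound n p C a) (hn : 3 ≤ n) (hp : p ≠ 0) {j : ℕ}
    (hj : ((j + 1 : ℕ) : ℝ) < criticalOrder n p) {x : ℝ} (hx : |x| < 1) :
    HasDerivAt (zonalSeries n a j) (zonalSeries n a (j + 1) x) x := by
  have hj' : (j : ℝ) < criticalOrder n p := lt_trans (by exact_mod_cast j.lt_succ_self) hj
  rw [hasDerivAt_iff_tendsto_slope, tendsto_iff_edist_tendsto_0]
  simp only [edist_eq_enorm_sub]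
  have h := ENNReal.Tendsto.const_mul (a := (C : ℝ≥0∞))
    (tendsto_weightedNorm_zonalSeq_slope hn hp hj hx) (Or.inr ENNReal.coe_ne_top)
  rw [mul_zero] at h
  refine tendsto_of_tendsto_of_tendsto_of_le_of_le' tendsto_const_nhds h
    (Eventually.of_forall fun _ => zero_le) ?_
  filter_upwards [nhdsWithin_le_nhds (continuous_abs.continuousAt.eventually_lt_const hx)] with y hy
  refine le_trans (le_of_eq ?_) (ha.enorm_tsum_le _)
  have hs := (ha.summable_zonalSeq hn hp hj' hy).sub (ha.summable_zonalSeq hn hp hj' hx)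
  rw [slope_def_module, ha.zonalSeries_sub hn hp hj' hx hy, zonalSeries, ← Complex.coe_smul,
    ← (hs.congr fun k => by rw [Pi.sub_apply, sub_mul]).tsum_const_smul, ← Summable.tsum_sub]
  · simp only [Pi.sub_apply, Pi.smul_apply, smul_eq_mul, sub_mul, mul_sub, Complex.ofReal_inv,
      mul_assoc]
  · exact (hs.congr fun k => by rw [Pi.sub_apply, sub_mul]).const_smul _
  · exact ha.summable_zonalSeq hn hp hj hx

/-- The series is the bounded functional a composed with the curve x ↦ (P_k(x))_k, so it inherits
the regularity of the curve in weighted ℓ_p. -/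
theorem holderClass_zonalSeries (ha : DualBound n p C a) (hn : 3 ≤ n) (hp : p ≠ 0) {α : ℝ}
    (hα : 0 ≤ α) (hα1 : α ≤ criticalOrder n p) (hα2 : (⌊α⌋₊ : ℝ) < criticalOrder n p) :
    HolderClass α (Ioo (-1) 1) (zonalSeries n a 0) := by
  have hd : ∀ j < ⌊α⌋₊, ∀ x ∈ Ioo (-1 : ℝ) 1,
      HasDerivAt (zonalSeries n a j) (zonalSeries n a (j + 1) x) x := fun j hj x hx =>
    ha.hasDerivAt_zonalSeries hn hp (lt_of_le_of_lt (by exact_mod_cast hj) hα2) (abs_lt.mpr hx)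
  refine ⟨contDiffOn_of_hasDerivAt isOpen_Ioo hd fun x hx =>
    (ha.continuousAt_zonalSeries hn hp hα2 (abs_lt.mpr hx)).continuousWithinAt,
    fun K hKJ hK => ?_⟩
  obtain ⟨r, hr0, hr, hKr⟩ := exists_abs_le_of_isCompact hK hKJ
  obtain ⟨M, hM⟩ := exists_weightedNorm_zonalSeq_sub_le (s := α - ⌊α⌋₊) hn hp hα2
    (sub_nonneg.mpr (Nat.floor_le hα)) (by linarith [Nat.lt_floor_add_one α])
    (by linarith) hr0 hr
  refine ⟨C * M, fun x hx y hy => ?_⟩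
  have he := iteratedDerivWithin_eqOn_of_hasDerivAt isOpen_Ioo hd le_rfl
  rw [he (hKJ hx), he (hKJ hy)]
  have h1 := (ha.enorm_zonalSeries_sub_le hn hp hα2 (abs_lt.mpr (hKJ hy)) (abs_lt.mpr (hKJ hx))).trans
    (mul_le_mul_right (hM y x (hKr y hy) (hKr x hx)) _)
  rw [← ofReal_norm, ← mul_assoc, ← ENNReal.ofReal_coe_nnreal,
    ← ENNReal.ofReal_coe_nnreal, ← ENNReal.ofReal_mul (by positivity),
    ← ENNReal.ofReal_mul (by positivity), ENNReal.ofReal_le_ofReal_iff (by positivity)] at h1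
  exact h1

end DualBound

end

section

variable {n : ℕ} {p q : ℝ≥0∞}

/-! ### Multipliers define functionals -/

theorem memLp_continuous_prod {a : SO n → SO n → ℂ} (ha : Continuous (Function.uncurry a)) :
    MemLp (Function.uncurry a) 2 ((haarProb (SO n)).prod (haarProb (SO n))) := by
  have hb := ContinuousMap.norm_coe_le_norm (⟨_, ha⟩ : C(SO n × SO n, ℂ))
  exact MemLp.of_bound ha.aestronglyMeasurable _ (Eventually.of_forall hb)

variable [NeZero n]

/-- The coefficients of the expansion of `φ` into zonal functions. -/
noncomputable def zonalCoeff (φ : SO n → ℂ) (k : ℕ) : ℂ :=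
  (mult (n - 2) k : ℂ) * ∫ g, φ g * zonalFun k g ∂haarProb (SO n)

theorem hasKernel_sum_harmProj (F : Finset ℕ) (c : ℕ → ℂ) :
    HasKernel (haarProb (SO n)) (∑ k ∈ F, c k • harmProj n k)
      fun x y => ∑ k ∈ F, c k * (mult (n - 2) k * zonalFun k (x * y⁻¹)) := by
  intro f
  have h : (∑ k ∈ F, c k • harmProj n k) f = ∑ k ∈ F, c k • harmProj n k f := by simp
  rw [h]
  have h1 : ∀ᵐ x ∂haarProb (SO n), ∀ k ∈ F,
      (c k • harmProj n k f : L2SO n) x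
        = ∫ y, c k * (mult (n - 2) k * zonalFun k (x * y⁻¹)) * f y ∂haarProb (SO n) := by
    refine (ae_ball_iff F.countable_toSet).mpr fun k _ => ?_
    filter_upwards [Lp.coeFn_smul (c k) (harmProj n k f), hasKernel_harmProj k f] with x e1 e2
    rw [e1, Pi.smul_apply, e2, smul_eq_mul, ← integral_const_mul]
    simp only [mul_assoc]
  filter_upwards [Lp.coeFn_finsetSum F fun k => c k • harmProj n k f, h1] with x e1 e2
  rw [e1, Finset.sum_apply, Finset.sum_congr rfl e2, ← integral_finsetSum]
  · simp only [Finset.sum_mul]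
  · intro k _
    exact integrable_continuous_mul_L2SO (by fun_prop) f

/-- The test operator is Σ c_k E_k. The kernel of its image B is a function of x y⁻¹ with integral S
in y for every x, so B maps the constant 1 to the constant S. Thus |S| is at most the operator norm
of B, hence at most its S_q-norm for any q. -/
theorem enorm_sum_zonalCoeff_le (hn : 3 ≤ n) {φ : SO n → ℂ} (hp : p ≠ 0) (hq : q ≠ 0)
    (hint : Integrable φ (haarProb (SO n))) {C : ℝ≥0}
    (hC : ∀ (a : SO n → SO n → ℂ) (A : L2SO n →L[ℂ] L2SO n),
      MemLp (Function.uncurry a) 2 ((haarProb (SO n)).prod (haarProb (SO n))) →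
      HasKernel (haarProb (SO n)) A a →
      ∃ B : L2SO n →L[ℂ] L2SO n,
        HasKernel (haarProb (SO n)) B (fun g h => φ (g * h⁻¹) * a g h) ∧
          schattenNorm q B ≤ C * schattenNorm p A)
    (F : Finset ℕ) {c : ℕ → ℂ} (hc : ∀ k ∉ F, c k = 0) :
    ‖∑ k ∈ F, c k * zonalCoeff φ k‖ₑ ≤ C * weightedNorm (mult (n - 2)) p c := by
  obtain ⟨B, hB, hBC⟩ := hC (fun x y => ∑ k ∈ F, c k * (mult (n - 2) k * zonalFun k (x * y⁻¹)))
    (∑ k ∈ F, c k • harmProj n k) (memLp_continuous_prod (by fun_prop)) (hasKernel_sum_harmProj F c)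
  set S := ∑ k ∈ F, c k * zonalCoeff φ k with hS
  have hA : ∑ k ∈ F, c k • harmProj n k = harmSeries n c :=
    (tsum_eq_sum fun k hk => by rw [hc k hk, zero_smul]).symm
  have hc0 : Tendsto c cofinite (𝓝 0) := by
    refine tendsto_const_nhds.congr' ?_
    rw [EventuallyEq, eventually_cofinite]
    exact F.finite_toSet.subset fun k hk => by_contra fun h => hk (hc k h).symm
  have hker : ∀ x : SO n, ∫ y, φ (x * y⁻¹) * (∑ k ∈ F, c k * (mult (n - 2) k * zonalFun k (x * y⁻¹)))
      ∂haarProb (SO n) = S := by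
    intro x
    simp only [← div_eq_mul_inv]
    rw [integral_div_left_eq_self
      (fun y => φ y * (∑ k ∈ F, c k * (mult (n - 2) k * zonalFun k y))) (haarProb (SO n)) x, hS]
    simp only [Finset.mul_sum]
    rw [integral_finsetSum]
    · refine Finset.sum_congr rfl fun k _ => ?_
      rw [zonalCoeff, ← integral_const_mul, ← integral_const_mul]
      congr 1
      ext y
      ring
    · intro k _
      have hw : Continuous fun y : SO n => c k * ((mult (n - 2) k : ℂ) * zonalFun k y) := by fun_prop
      exact hint.mul_bdd hw.aestronglyMeasurable
        (Eventually.of_forall (ContinuousMap.norm_coe_le_norm (⟨_, hw⟩ : C(SO n, ℂ))))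
  have hB1 : B (Lp.const 2 (haarProb (SO n)) 1) = Lp.const 2 (haarProb (SO n)) S := by
    refine Lp.ext ?_
    filter_upwards [hB (Lp.const 2 (haarProb (SO n)) 1), Lp.coeFn_const 2 (haarProb (SO n)) S]
      with x e1 e2
    rw [e1, e2, Function.const_apply, ← hker x]
    refine integral_congr_ae ?_
    filter_upwards [Lp.coeFn_const 2 (haarProb (SO n)) (1 : ℂ)] with y hy
    rw [hy, Function.const_apply, mul_one]
  have hnorm : ∀ z : ℂ, ‖Lp.const 2 (haarProb (SO n)) z‖ = ‖z‖ := by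
    intro z
    rw [Lp.norm_const' _ _ _ (by simp) (by simp)]
    simp
  have h1 : ‖S‖ ≤ ‖B‖ := by
    have := B.le_opNorm (Lp.const 2 (haarProb (SO n)) 1)
    rwa [hB1, hnorm, hnorm, norm_one, mul_one] at this
  calc ‖S‖ₑ ≤ ‖B‖ₑ := enorm_le_iff_norm_le.mpr h1
    _ ≤ schattenNorm q B := enorm_le_schattenNorm hq B
    _ ≤ C * schattenNorm p (harmSeries n c) := hA ▸ hBC
    _ ≤ C * weightedNorm (mult (n - 2)) p c := by
        gcongr
        exact schattenNorm_harmSeries_le hn hp hc0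

theorem exists_dualBound (hn : 3 ≤ n) {φ : SO n → ℂ} (hp : p ≠ 0) (hq : q ≠ 0)
    (hφ : IsSchurMultiplier (haarProb (SO n)) p q φ) :
    ∃ C, DualBound n p C (zonalCoeff φ) := by
  classical
  obtain ⟨hmem, C, hC⟩ := hφ
  refine ⟨C, fun F c => ?_⟩
  set a := zonalCoeff φ with ha
  -- The phases are chosen so that c'_k a_k = |c_k| |a_k| on F; where a_k = 0, the division by zero
  -- makes c'_k = 0, which is harmless.
  set c' : ℕ → ℂ := fun k => if k ∈ F then ‖c k‖ * ((starRingEnd ℂ) (a k) / ‖a k‖) else 0 with hc'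
  have h1 := enorm_sum_zonalCoeff_le hn hp hq (hmem.integrable le_top) hC F (c := c')
    fun k hk => if_neg hk
  have h2 : ∑ k ∈ F, c' k * zonalCoeff φ k = ((∑ k ∈ F, ‖c k‖ * ‖a k‖ : ℝ) : ℂ) := by
    push_cast
    refine Finset.sum_congr rfl fun k hk => ?_
    rw [hc']
    simp only [if_pos hk, ← ha]
    by_cases h0 : a k = 0
    · simp [h0]
    · have : (‖a k‖ : ℂ) ≠ 0 := by simpa using h0
      have h3 : (starRingEnd ℂ) (a k) * a k = (‖a k‖ : ℂ) ^ 2 := by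
        rw [mul_comm, Complex.mul_conj, Complex.normSq_eq_norm_sq]
        push_cast; rfl
      field_simp
      linear_combination (‖c k‖ : ℂ) * h3
  have h3 : ∑ k ∈ F, ‖c k‖ₑ * ‖a k‖ₑ = ‖∑ k ∈ F, c' k * zonalCoeff φ k‖ₑ := by
    rw [h2, ← ofReal_norm, Complex.norm_real, Real.norm_eq_abs,
      abs_of_nonneg (by positivity), ENNReal.ofReal_sum_of_nonneg fun k _ => by positivity]
    refine Finset.sum_congr rfl fun k _ => ?_
    rw [ENNReal.ofReal_mul (by positivity), ofReal_norm, ofReal_norm]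
  rw [h3]
  refine h1.trans ?_
  gcongr
  refine weightedNorm_mono fun k => enorm_le_iff_norm_le.mpr ?_
  rw [hc']
  simp only
  split_ifs
  · rw [norm_mul, norm_div, Complex.norm_real, Complex.norm_real, norm_norm, norm_norm,
      RCLike.norm_conj]
    exact mul_le_of_le_one_right (norm_nonneg _) (div_self_le_one _)
  · simp

end

section

variable {n : ℕ} [NeZero n] {p q : ℝ≥0∞}

/-! ### The expansion of biinvariant functions -/

theorem hasSum_harmProj (hn : 3 ≤ n) {v : L2SO n} (hinv : ∀ u ∈ SOsub n, leftReg u v = v) :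
    HasSum (fun k => harmProj n k v) v := by
  have hs := ((isProjFamily_harmProj (n := n) hn).summable_apply v).hasSum
  set S := ∑' k, harmProj n k v with hS
  suffices h : S - v = 0 by rwa [sub_eq_zero.mp h] at hs
  refine eq_zero_of_harmProj_eq_zero hn (fun u hu => ?_) fun l => ?_
  · have h1 : leftReg u S = S := by
      have := hs.mapL (leftRegIsometry u).toContinuousLinearMap
      have h2 : (fun k => (leftRegIsometry u).toContinuousLinearMap (harmProj n k v))
          = fun k => harmProj n k v := funext fun k => leftReg_harmProj hu k v
      rw [h2] at this
      exact this.unique hs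
    rw [sub_eq_add_neg, leftReg_add, h1, ← neg_one_smul ℂ v, leftReg_smul, hinv u hu]
  · have h1 : harmProj n l S = harmProj n l v := by
      refine (hs.mapL (harmProj n l)).unique ?_
      have h2 : (fun k => harmProj n l (harmProj n k v))
          = fun k => if k = l then harmProj n l v else 0 := by
        ext1 k
        rw [harmProj_comp hn]
        by_cases hkl : k = l
        · subst hkl; simp
        · rw [if_neg (Ne.symm hkl), if_neg hkl]
      rw [h2]
      exact hasSum_ite_eq l _
    rw [map_sub, h1, sub_self]

/-- Right invariance of φ allows u in SO(n-1) to be inserted between x and y⁻¹; the average over u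
is given by the product formula. -/
theorem integral_zonalFun_mul_inv (hn : 3 ≤ n) (k : ℕ) {φ : SO n → ℂ} (hφ : IsBiinvariant φ)
    (hint : Integrable φ (haarProb (SO n))) (x : SO n) :
    ∫ y, (zonalFun k (x * y⁻¹) : ℂ) * φ y ∂haarProb (SO n)
      = zonalFun k x * ∫ y, φ y * zonalFun k y ∂haarProb (SO n) := by
  have h1 : ∀ u : SOsub n, ∫ y, (zonalFun k (x * (u : SO n) * y⁻¹) : ℂ) * φ y ∂haarProb (SO n)
      = ∫ y, (zonalFun k (x * y⁻¹) : ℂ) * φ y ∂haarProb (SO n) := by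
    intro u
    rw [← integral_mul_right_eq_self (fun y => (zonalFun k (x * (u : SO n) * y⁻¹) : ℂ) * φ y) (u : SO n)]
    refine integral_congr_ae (Eventually.of_forall fun y => ?_)
    have := hφ 1 (one_mem _) u u.2 y
    rw [one_mul] at this
    simp only [this, mul_inv_rev, mul_assoc, mul_inv_cancel_left]
  have hint2 : Integrable (fun z : SOsub n × SO n => (zonalFun k (x * (z.1 : SO n) * z.2⁻¹) : ℂ) * φ z.2)
      ((haarProb (SOsub n)).prod (haarProb (SO n))) := by
    have hw : Continuous fun z : SOsub n × SO n => (zonalFun k (x * (z.1 : SO n) * z.2⁻¹) : ℂ) := by fun_prop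
    exact (hint.comp_snd _).bdd_mul hw.aestronglyMeasurable
      (Eventually.of_forall (ContinuousMap.norm_coe_le_norm (⟨_, hw⟩ : C(SOsub n × SO n, ℂ))))
  calc ∫ y, (zonalFun k (x * y⁻¹) : ℂ) * φ y ∂haarProb (SO n)
      = ∫ u : SOsub n, ∫ y, (zonalFun k (x * (u : SO n) * y⁻¹) : ℂ) * φ y ∂haarProb (SO n)
          ∂haarProb (SOsub n) := by simp only [h1]; simp
    _ = ∫ y, ∫ u : SOsub n, (zonalFun k (x * (u : SO n) * y⁻¹) : ℂ) * φ y ∂haarProb (SOsub n)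
          ∂haarProb (SO n) := integral_integral_swap hint2
    _ = ∫ y, (zonalFun k x : ℂ) * (φ y * zonalFun k y) ∂haarProb (SO n) := by
        congr 1
        ext y
        rw [integral_mul_const, integral_complex_ofReal, integral_zonalFun_product hn,
          zonalFun_inv]
        push_cast
        ring
    _ = _ := integral_const_mul _ _

theorem harmProj_toLp (hn : 3 ≤ n) (k : ℕ) {φ : SO n → ℂ} (hφ : IsBiinvariant φ)
    (hmem : MemLp φ 2 (haarProb (SO n))) :
    harmProj n k (hmem.toLp φ) =ᵐ[haarProb (SO n)] fun x => zonalCoeff φ k * zonalFun k x := by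
  filter_upwards [hasKernel_harmProj k (hmem.toLp φ)] with x hx
  have h1 : ∫ y, (mult (n - 2) k : ℂ) * zonalFun k (x * y⁻¹) * hmem.toLp φ y ∂haarProb (SO n)
      = ∫ y, (mult (n - 2) k : ℂ) * (zonalFun k (x * y⁻¹) * φ y) ∂haarProb (SO n) := by
    refine integral_congr_ae ?_
    filter_upwards [hmem.coeFn_toLp] with y hy
    rw [hy, mul_assoc]
  rw [hx, h1, integral_const_mul,
    integral_zonalFun_mul_inv hn k hφ (hmem.integrable one_le_two), zonalCoeff]
  ring

theorem leftReg_toLp {φ : SO n → ℂ} (hφ : IsBiinvariant φ)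
    (hmem : MemLp φ 2 (haarProb (SO n))) {u : SO n} (hu : u ∈ SOsub n) :
    leftReg u (hmem.toLp φ) = hmem.toLp φ := by
  refine Lp.ext ?_
  have h := (quasiMeasurePreserving_mul_left (haarProb (SO n)) u⁻¹).ae hmem.coeFn_toLp
  filter_upwards [coeFn_leftReg u (hmem.toLp φ), h, hmem.coeFn_toLp] with x h1 h2 h3
  rw [h1, h2, h3]
  have := hφ u⁻¹ ((SOsub n).inv_mem hu) 1 (one_mem _) x
  rwa [mul_one] at this

theorem zonalFun_sq_of_abs_ent {g : SO n} (hg : |ent 0 g| = 1) (k : ℕ) :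
    zonalFun k g * zonalFun k g = 1 := by
  rcases eq_or_eq_neg_of_abs_eq hg with h | h
  · rw [zonalFun, h, zonal_eval_one, mul_one]
  · rw [zonalFun, h, zonal_eval_neg_one, ← mul_pow]
    simp

/-- Every P_k² equals 1 on the exceptional set, whose measure is therefore at most ∫ P_k² = 1/m_k,
and m_k → ∞. -/
theorem ae_abs_ent_lt_one (hn : 3 ≤ n) : ∀ᵐ g ∂haarProb (SO n), |ent 0 g| < 1 := by
  set S : Set (SO n) := {g | |ent 0 g| = 1} with hS
  have hSm : MeasurableSet S :=
    (isClosed_eq (f := fun g : SO n => |ent 0 g|) (by fun_prop) continuous_const).measurableSet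
  have hle : ∀ k : ℕ, (haarProb (SO n)).real S ≤ (mult (n - 2) k)⁻¹ := by
    intro k
    have h1 := integral_zonalFun_mul (n := n) hn k k
    rw [if_pos rfl] at h1
    have hc : Continuous fun g : SO n => zonalFun k g * zonalFun k g := by fun_prop
    rw [← h1]
    refine le_trans (le_of_eq ?_) (setIntegral_le_integral (s := S)
      (integrable_haarProb hc) (Eventually.of_forall fun g => mul_self_nonneg _))
    rw [setIntegral_congr_fun hSm fun g hg => zonalFun_sq_of_abs_ent hg k]
    simp
  have hlim : Tendsto (fun k : ℕ => (mult (n - 2) k)⁻¹) atTop (𝓝 0) := by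
    refine tendsto_inv_atTop_zero.comp (tendsto_atTop_mono
      (fun k => le_mult (d := n - 2) (by omega) k) ?_)
    have h0 : (0 : ℝ) < ((n - 2 : ℕ) : ℝ) := by exact_mod_cast (by omega : 0 < n - 2)
    exact tendsto_natCast_atTop_atTop.atTop_div_const h0
  have h0 : (haarProb (SO n)).real S = 0 :=
    le_antisymm (ge_of_tendsto' hlim hle) measureReal_nonneg
  have h1 : haarProb (SO n) S = 0 := (measureReal_eq_zero_iff).mp h0
  filter_upwards [compl_mem_ae_iff.mpr h1] with g hg
  exact lt_of_le_of_ne (abs_ent_le_one 0 g) hg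

/-- The expansion converges to φ in L_2, hence almost everywhere along a subsequence. Where |g_11| <
1 the full series converges by the dual bound, so the two limits agree. -/
theorem ae_eq_zonalSeries (hn : 3 ≤ n) (hp : p ≠ 0) (h0 : 0 < criticalOrder n p) {φ : SO n → ℂ}
    (hφ : IsBiinvariant φ) (hmem : MemLp φ 2 (haarProb (SO n))) {C : ℝ≥0}
    (ha : DualBound n p C (zonalCoeff φ)) :
    ∀ᵐ g ∂haarProb (SO n), φ g = zonalSeries n (zonalCoeff φ) 0 (ent 0 g) := by
  have hsum := (hasSum_harmProj hn fun u hu => leftReg_toLp hφ hmem hu).tendsto_sum_nat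
  obtain ⟨ns, hns, hae⟩ := (tendstoInMeasure_of_tendsto_Lp hsum).exists_seq_tendsto_ae
  have hpart : ∀ᵐ g ∂haarProb (SO n), ∀ N : ℕ,
      (∑ k ∈ Finset.range N, harmProj n k (hmem.toLp φ) : L2SO n) g
        = ∑ k ∈ Finset.range N, zonalSeq n 0 (ent 0 g) k * zonalCoeff φ k := by
    refine ae_all_iff.mpr fun N => ?_
    filter_upwards [Lp.coeFn_finsetSum (Finset.range N) fun k => harmProj n k (hmem.toLp φ),
      ae_all_iff.mpr fun k => harmProj_toLp hn k hφ hmem] with g h1 h2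
    rw [h1, Finset.sum_apply]
    refine Finset.sum_congr rfl fun k _ => ?_
    rw [h2 k, mul_comm]
    rfl
  filter_upwards [hae, hpart, ae_abs_ent_lt_one hn, hmem.coeFn_toLp] with g h1 h2 h3 h4
  have h5 := (ha.summable_zonalSeq hn hp (j := 0) (by simpa using h0) h3).hasSum.tendsto_sum_nat
  simp only [h2] at h1
  rw [← h4]
  exact tendsto_nhds_unique h1 (h5.comp hns.tendsto_atTop)

theorem apply_cosetRep (hn : 3 ≤ n) {φ : SO n → ℂ} (hφ : IsBiinvariant φ) (g : SO n) :
    φ g = φ (cosetRep hn (g.1 0 0)) := by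
  obtain ⟨u, hu, v, hv, h⟩ := exists_eq_mul_cosetRep_mul hn g
  conv_lhs => rw [h]
  exact hφ u hu v hv _

/-- Functions on `(-1, 1)` that are continuous are determined by their composition with the first
entry almost everywhere. -/
theorem eqOn_of_ae_eq_comp_ent (hn : 3 ≤ n) {f ψ : ℝ → ℂ} (hf : ContinuousOn f (Ioo (-1) 1))
    (hψ : ContinuousOn ψ (Ioo (-1) 1))
    (h : ∀ᵐ g : SO n ∂haarProb (SO n), f (ent 0 g) = ψ (ent 0 g)) : EqOn f ψ (Ioo (-1) 1) := by
  have hU : IsOpen {g : SO n | ent 0 g ∈ Ioo (-1 : ℝ) 1} := isOpen_Ioo.preimage (continuous_ent 0)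
  -- Haar measure charges open sets, so equality almost everywhere becomes equality on the open set
  -- |g_11| < 1, where `cosetRep` attains every value in (-1, 1).
  have h1 := Measure.eqOn_open_of_ae_eq (μ := haarProb (SO n)) (f := fun g => f (ent 0 g))
    (g := fun g => ψ (ent 0 g)) (ae_restrict_of_ae h) hU
    (hf.comp (continuous_ent 0).continuousOn fun _ hg => hg)
    (hψ.comp (continuous_ent 0).continuousOn fun _ hg => hg)
  intro x hx
  have he : ent 0 (cosetRep (n := n) hn x) = x := ent_cosetRep hn hx.1.le hx.2.le
  have := h1 (x := cosetRep hn x) (by simpa [he] using hx)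
  simpa [he] using this

end

end SchurRegularity

/-! ### The main theorem -/

open SchurRegularity in
theorem mainTheorem8 (n : ℕ) [NeZero n] (hn : 3 ≤ n) (p : ℝ≥0∞)
    (hp : ENNReal.ofReal (2 + 2 / ((n : ℝ) - 2)) < p) :
    (∀ φ : SO n → ℂ, IsBiinvariant φ →
      (IsSchurMultiplier (haarProb (SO n)) p p φ ∨ IsSchurMultiplier (haarProb (SO n)) p ∞ φ) →
      ∃ φt : ℝ → ℂ, (∀ k : SO n, φ k = φt (k.1 0 0)) ∧
        (∃ ψ : ℝ → ℂ, (∀ᵐ k : SO n ∂(haarProb (SO n)), φ k = ψ (k.1 0 0)) ∧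
          ∀ ε : ℝ, 0 < ε → ε < criticalOrder n p →
            HolderClass (smoothnessOrder n p ε) (Ioo (-1) 1) ψ) ∧
        (ContinuousOn φt (Ioo (-1) 1) → ∀ ε : ℝ, 0 < ε → ε < criticalOrder n p →
            HolderClass (smoothnessOrder n p ε) (Ioo (-1) 1) φt)) ∧
    (∃ T : ℝ → L2SO n →L[ℂ] L2SO n,
      (∀ g : SO n, T (g.1 0 0) = doubleAverage g) ∧
      ∀ ε : ℝ, 0 < ε → ε < criticalOrder n p →
        HolderClassSchatten p (smoothnessOrder n p ε) (Ioo (-1) 1) T) := by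
  have hp0 : p ≠ 0 := ne_zero_of_ofReal_lt hp
  have hcrit : 0 < criticalOrder n p := criticalOrder_pos hn hp
  refine ⟨fun φ hφ hmult => ?_, fun δ => doubleAverage (cosetRep hn δ), doubleAverage_cosetRep hn,
    fun ε h0 h1 => holderClassSchatten_doubleAverage hn hp0 h0 h1⟩
  have hmem : MemLp φ 2 (haarProb (SO n)) := by
    rcases hmult with h | h <;> exact h.1.mono_exponent le_top
  -- Both kinds of multiplier give the same dual bound, since only the operator norm of the image
  -- enters.
  obtain ⟨C, ha⟩ : ∃ C, DualBound n p C (zonalCoeff φ) := by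
    rcases hmult with h | h
    · exact exists_dualBound hn hp0 hp0 h
    · exact exists_dualBound hn hp0 ENNReal.top_ne_zero h
  have hae := ae_eq_zonalSeries hn hp0 hcrit hφ hmem ha
  have hsmooth : ∀ ε : ℝ, 0 < ε → ε < criticalOrder n p → HolderClass (smoothnessOrder n p ε)
      (Ioo (-1) 1) (zonalSeries n (zonalCoeff φ) 0) := fun ε h0 h1 =>
    ha.holderClass_zonalSeries hn hp0 (smoothnessOrder_pos h0 h1).le (smoothnessOrder_le h0)
      (floor_smoothnessOrder_lt h0 h1)
  -- The function φt is forced on [-1, 1] and may differ from the smooth ψ on a null set; continuity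
  -- on (-1, 1) removes this difference.
  refine ⟨fun δ => φ (cosetRep hn δ), apply_cosetRep hn hφ, ⟨_, hae, hsmooth⟩,
    fun hcont ε h0 h1 => (hsmooth ε h0 h1).congr ?_⟩
  refine eqOn_of_ae_eq_comp_ent hn hcont (fun x hx => ?_) ?_
  · exact (ha.continuousAt_zonalSeries hn hp0 (by simpa using hcrit)
      (abs_lt.mpr hx)).continuousWithinAt
  · filter_upwards [hae] with g hg
    rw [← hg]
    exact (apply_cosetRep hn hφ g).symm
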